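/- **Setting.** All alphabets are finite and entropies are in bits. A discrete memoryless interference channel is given by $p(y_1y_2|x_1x_2)$, with inputs $X_1,X_2$ and outputs $Y_1,Y_2$. A source pair $(S,T)\sim p(s,t)$ emits i.i.d. pairs $(S_i,T_i)$. It is *admissible* for the channel if for every $\epsilon\in(0,1)$ and all sufficiently large $n$ there are encoders $f_1:\mathcal S^n\to\mathcal X_1^n$, $f_2:\mathcal T^n\to\mathcal X_2^n$ and decoders $\phi_1:\mathcal Y_1^n\to\mathcal S^n$, $\phi_2:\mathcal Y_2^n\to\mathcal T^n$ such that both error probabilities $\Pr\{\phi_1(Y_1^n)\ne S^n\}$ and $\Pr\{\phi_2(Y_2^n)\ne T^n\}$ are at most $\epsilon$. The *common part* of $(S,T)$ (Gács–Körner, Witsenhausen) is the random variable $K=f(S)=g(T)$ (almost surely) of which every random variable that is almost surely both a function of $S$ and a function of $T$ is almost surely a function; $(S,T)$ has *no common part* if $K$ is constant. **(i)** Suppose that $(S,T)$ has no common part and that there are a time-sharing variable $Q$ and auxiliary variables $W_1,W_2$ with $$p(s,t,q,w_1,w_2,x_1,x_2)=p(s,t)\,p(q)\,p(w_1|q)\,p(w_2|q)\,p(x_1|s\,w_1q)\,p(x_2|t\,w_2q)$$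 (the outputs being produced from $(x_1,x_2)$ by the channel), such that \begin{align*} H(S)&<I(SX_1;Y_1|QW_2),\\ H(T)&<I(TX_2;Y_2|QW_1),\\ H(S)+H(T)&<I(SX_1;Y_1|QW_1W_2)+I(W_1TX_2;Y_2|Q),\\ H(S)+H(T)&<I(TX_2;Y_2|QW_1W_2)+I(W_2SX_1;Y_1|Q),\\ H(S)+H(T)&<I(SW_2X_1;Y_1|QW_1)+I(TW_1X_2;Y_2|QW_2),\\ 2H(S)+H(T)&<I(SX_1;Y_1|QW_1W_2)+I(SW_2X_1;Y_1|Q)+I(TW_1X_2;Y_2|QW_2),\\ H(S)+2H(T)&<I(TX_2;Y_2|QW_1W_2)+I(TW_1X_2;Y_2|Q)+I(SW_2X_1;Y_1|QW_1). \end{align*} Then $(S,T)$ is admissible for the channel. **(ii)** Let $S$ and $T$ be independent and choose the joint distribution $p(s)p(t)p(q)p(w_1|q)p(w_2|q)p(x_1|w_1q)p(x_2|w_2q)$. Then the seven inequalities in (i) hold if and only if the following inequalities of Chong et al. hold with $R_1=H(S)$ and $R_2=H(T)$, where the mutual informations are those of $p(q)p(w_1|q)p(w_2|q)p(x_1|w_1q)p(x_2|w_2q)p(y_1y_2|x_1x_2)$: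 \begin{align*} R_1&<I(X_1;Y_1|QW_2),\\ R_2&<I(X_2;Y_2|QW_1),\\ R_1+R_2&<I(X_1;Y_1|QW_1W_2)+I(W_1X_2;Y_2|Q),\\ R_1+R_2&<I(X_2;Y_2|QW_1W_2)+I(W_2X_1;Y_1|Q),\\ R_1+R_2&<I(W_2X_1;Y_1|QW_1)+I(W_1X_2;Y_2|QW_2),\\ 2R_1+R_2&<I(X_1;Y_1|QW_1W_2)+I(W_2X_1;Y_1|Q)+I(W_1X_2;Y_2|QW_2),\\ R_1+2R_2&<I(X_2;Y_2|QW_1W_2)+I(W_1X_2;Y_2|Q)+I(W_2X_1;Y_1|QW_1). \end{align*} **(iii)** Let $\mathcal R_{\mathrm{HK}}$ be the set of pairs of nonnegative rates $(R_1,R_2)$ that satisfy these last seven inequalities for some distribution $p(q)p(w_1|q)p(w_2|q)p(x_1|w_1q)p(x_2|w_2q)$ (the simplified Han–Kobayashi region). The set of all pairs $(H(S),H(T))$ of independent sources that satisfy the conditions of (i) with a joint distribution chosen as in (ii) is exactly $\mathcal R_{\mathrm{HK}}$. Moreover, every independent source pair with $(H(S),H(T))\in\mathcal R_{\mathrm{HK}}$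 is admissible for the channel. -/

import Mathlib

open scoped BigOperators

noncomputable section

namespace InterferenceChannel

/-! ### Entropies on finite sample spaces (base-2 logarithms) -/

section Information

variable {Ω α β γ : Type*} [Fintype Ω] [Fintype α] [Fintype β] [Fintype γ]

/-- Shannon entropy `-∑ p(a) log₂ p(a)`, in bits, of a distribution on a finite alphabet. -/
def entropy (p : α → ℝ) : ℝ := (∑ a, Real.negMulLog (p a)) / Real.log 2

open Classical in
/-- The law of the random variable `A` when the sample point has distribution `P`. -/
def law (P : Ω → ℝ) (A : Ω → α) (a : α) : ℝ := ∑ ω, if A ω = a then P ω else 0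

/-- The tuple of two random variables. -/
def join (A : Ω → α) (B : Ω → β) : Ω → α × β := fun ω => (A ω, B ω)

infixr:67 " &ᵣ " => join

/-- `H(A)` for a random variable `A`. -/
def rvEntropy (P : Ω → ℝ) (A : Ω → α) : ℝ := entropy (law P A)

/-- `H(A|C) = H(A,C) - H(C)`. -/
def condEntropy (P : Ω → ℝ) (A : Ω → α) (C : Ω → γ) : ℝ :=
  rvEntropy P (A &ᵣ C) - rvEntropy P C

/-- `I(A;B|C) = H(A|C) - H(A|B,C)`. -/
def condMI (P : Ω → ℝ) (A : Ω → α) (B : Ω → β) (C : Ω → γ) : ℝ :=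
  condEntropy P A C - condEntropy P A (B &ᵣ C)

end Information

/-! ### Sources and their common part -/

section Source

variable {S T : Type*} [Fintype S] [Fintype T]

/-- The distribution `p(s)` of the first component of the source. -/
def margS (p : S × T → ℝ) (s : S) : ℝ := ∑ t, p (s, t)

/-- The distribution `p(t)` of the second component of the source. -/
def margT (p : S × T → ℝ) (t : T) : ℝ := ∑ s, p (s, t)

/-- The distribution `p(s)p(t)` of an independent source pair. -/
def indep (pS : S → ℝ) (pT : T → ℝ) : S × T → ℝ := fun st => pS st.1 * pT st.2

/-- `f(S) = g(T)` with probability one. -/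
def AgreeAS (p : S × T → ℝ) (f : S → ℕ) (g : T → ℕ) : Prop :=
  ∀ s t, 0 < p (s, t) → f s = g t

/-- `K = f(S) = g(T)` is the common part of `(S,T)` in the sense of Gács, Körner and Witsenhausen:
it is almost surely a function of each component, and every such random variable is almost surely a
function of `K`.  (The alphabets are finite, so labels in `ℕ` suffice.) -/
def IsCommonPart (p : S × T → ℝ) (f : S → ℕ) (g : T → ℕ) : Prop :=
  AgreeAS p f g ∧
    ∀ (f' : S → ℕ) (g' : T → ℕ), AgreeAS p f' g' →
      ∃ h : ℕ → ℕ, ∀ s t, 0 < p (s, t) → f' s = h (f s)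

/-- There is no common part: the common part is a constant. -/
def NoCommonPart (p : S × T → ℝ) : Prop := IsCommonPart p (fun _ => 0) (fun _ => 0)

end Source

/-! ### Block codes and admissibility -/

section Admissible

variable {S T X₁ X₂ Y₁ Y₂ : Type*} [Fintype S] [Fintype T] [Fintype Y₁] [Fintype Y₂]

/-- A source-channel block code of length `n`. -/
structure BlockCode (S T X₁ X₂ Y₁ Y₂ : Type*) (n : ℕ) where
  /-- first encoder -/
  f₁ : (Fin n → S) → (Fin n → X₁)
  /-- second encoder -/
  f₂ : (Fin n → T) → (Fin n → X₂)
  /-- first decoder -/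
  φ₁ : (Fin n → Y₁) → (Fin n → S)
  /-- second decoder -/
  φ₂ : (Fin n → Y₂) → (Fin n → T)

/-- Probability of the source sequences `s`, `t` and the outputs `y₁`, `y₂` when the code is used on
the memoryless source `p` and the memoryless channel `N x₁ x₂ (y₁, y₂) = p(y₁ y₂ | x₁ x₂)`. -/
def BlockCode.prob {n : ℕ} (c : BlockCode S T X₁ X₂ Y₁ Y₂ n) (p : S × T → ℝ)
    (N : X₁ → X₂ → Y₁ × Y₂ → ℝ) (s : Fin n → S) (t : Fin n → T)
    (y₁ : Fin n → Y₁) (y₂ : Fin n → Y₂) : ℝ :=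
  (∏ i, p (s i, t i)) * ∏ i, N (c.f₁ s i) (c.f₂ t i) (y₁ i, y₂ i)

open Classical in
/-- Probability of error at decoder 1. -/
def BlockCode.err₁ {n : ℕ} (c : BlockCode S T X₁ X₂ Y₁ Y₂ n) (p : S × T → ℝ)
    (N : X₁ → X₂ → Y₁ × Y₂ → ℝ) : ℝ :=
  ∑ s, ∑ t, ∑ y₁, ∑ y₂, if s ≠ c.φ₁ y₁ then c.prob p N s t y₁ y₂ else 0

open Classical in
/-- Probability of error at decoder 2. -/
def BlockCode.err₂ {n : ℕ} (c : BlockCode S T X₁ X₂ Y₁ Y₂ n) (p : S × T → ℝ)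
    (N : X₁ → X₂ → Y₁ × Y₂ → ℝ) : ℝ :=
  ∑ s, ∑ t, ∑ y₁, ∑ y₂, if t ≠ c.φ₂ y₂ then c.prob p N s t y₁ y₂ else 0

/-- The source `p` is admissible for the channel `N`. -/
def Admissible (p : S × T → ℝ) (N : X₁ → X₂ → Y₁ × Y₂ → ℝ) : Prop :=
  ∀ ε : ℝ, 0 < ε → ε < 1 → ∃ n₀ : ℕ, ∀ n, n₀ ≤ n →
    ∃ c : BlockCode S T X₁ X₂ Y₁ Y₂ n, max (c.err₁ p N) (c.err₂ p N) ≤ ε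

end Admissible

/-! ### Auxiliary variables with inputs that may depend on the sources -/

/-- The factors `p(q)`, `p(w₁|q)`, `p(w₂|q)`, `p(x₁|s w₁ q)`, `p(x₂|t w₂ q)`. -/
structure SourceLaw (S T Q W₁ W₂ X₁ X₂ : Type*) [Fintype Q] [Fintype W₁] [Fintype W₂]
    [Fintype X₁] [Fintype X₂] where
  /-- `p(q)` -/
  pQ : Q → ℝ
  /-- `p(w₁|q)` -/
  pW₁ : Q → W₁ → ℝ
  /-- `p(w₂|q)` -/
  pW₂ : Q → W₂ → ℝ
  /-- `p(x₁|s w₁ q)` -/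
  pX₁ : S → W₁ → Q → X₁ → ℝ
  /-- `p(x₂|t w₂ q)` -/
  pX₂ : T → W₂ → Q → X₂ → ℝ
  pQ_mem : pQ ∈ stdSimplex ℝ Q
  pW₁_mem : ∀ q, pW₁ q ∈ stdSimplex ℝ W₁
  pW₂_mem : ∀ q, pW₂ q ∈ stdSimplex ℝ W₂
  pX₁_mem : ∀ s w₁ q, pX₁ s w₁ q ∈ stdSimplex ℝ X₁
  pX₂_mem : ∀ t w₂ q, pX₂ t w₂ q ∈ stdSimplex ℝ X₂

section SourceConditions

variable {S T Q W₁ W₂ X₁ X₂ Y₁ Y₂ : Type*} [Fintype S] [Fintype T] [Fintype Q] [Fintype W₁]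
  [Fintype W₂] [Fintype X₁] [Fintype X₂] [Fintype Y₁] [Fintype Y₂]

/-- The joint distribution
`p(s,t) p(q) p(w₁|q) p(w₂|q) p(x₁|s w₁ q) p(x₂|t w₂ q) p(y₁ y₂|x₁ x₂)`. -/
def SourceLaw.joint (L : SourceLaw S T Q W₁ W₂ X₁ X₂) (p : S × T → ℝ)
    (N : X₁ → X₂ → Y₁ × Y₂ → ℝ) : S × T × Q × W₁ × W₂ × X₁ × X₂ × Y₁ × Y₂ → ℝ :=
  fun (s, t, q, w₁, w₂, x₁, x₂, y₁, y₂) =>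
    p (s, t) * L.pQ q * L.pW₁ q w₁ * L.pW₂ q w₂ * L.pX₁ s w₁ q x₁ * L.pX₂ t w₂ q x₂ *
      N x₁ x₂ (y₁, y₂)

/-- The seven inequalities for correlated sources. -/
def SourceConditions (p : S × T → ℝ) (N : X₁ → X₂ → Y₁ × Y₂ → ℝ)
    (L : SourceLaw S T Q W₁ W₂ X₁ X₂) : Prop :=
  let P : S × T × Q × W₁ × W₂ × X₁ × X₂ × Y₁ × Y₂ → ℝ := L.joint p N
  let HS : ℝ := entropy (margS p)
  let HT : ℝ := entropy (margT p)
  let s : S × T × Q × W₁ × W₂ × X₁ × X₂ × Y₁ × Y₂ → S := fun (s, _, _, _, _, _, _, _, _) => s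
  let t : S × T × Q × W₁ × W₂ × X₁ × X₂ × Y₁ × Y₂ → T := fun (_, t, _, _, _, _, _, _, _) => t
  let q : S × T × Q × W₁ × W₂ × X₁ × X₂ × Y₁ × Y₂ → Q := fun (_, _, q, _, _, _, _, _, _) => q
  let w₁ : S × T × Q × W₁ × W₂ × X₁ × X₂ × Y₁ × Y₂ → W₁ := fun (_, _, _, w₁, _, _, _, _, _) => w₁
  let w₂ : S × T × Q × W₁ × W₂ × X₁ × X₂ × Y₁ × Y₂ → W₂ := fun (_, _, _, _, w₂, _, _, _, _) => w₂
  let x₁ : S × T × Q × W₁ × W₂ × X₁ × X₂ × Y₁ × Y₂ → X₁ := fun (_, _, _, _, _, x₁, _, _, _) => x₁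
  let x₂ : S × T × Q × W₁ × W₂ × X₁ × X₂ × Y₁ × Y₂ → X₂ := fun (_, _, _, _, _, _, x₂, _, _) => x₂
  let y₁ : S × T × Q × W₁ × W₂ × X₁ × X₂ × Y₁ × Y₂ → Y₁ := fun (_, _, _, _, _, _, _, y₁, _) => y₁
  let y₂ : S × T × Q × W₁ × W₂ × X₁ × X₂ × Y₁ × Y₂ → Y₂ := fun (_, _, _, _, _, _, _, _, y₂) => y₂
  HS < condMI P (s &ᵣ x₁) y₁ (q &ᵣ w₂) ∧
  HT < condMI P (t &ᵣ x₂) y₂ (q &ᵣ w₁) ∧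
  HS + HT < condMI P (s &ᵣ x₁) y₁ (q &ᵣ w₁ &ᵣ w₂) + condMI P (w₁ &ᵣ t &ᵣ x₂) y₂ q ∧
  HS + HT < condMI P (t &ᵣ x₂) y₂ (q &ᵣ w₁ &ᵣ w₂) + condMI P (w₂ &ᵣ s &ᵣ x₁) y₁ q ∧
  HS + HT < condMI P (s &ᵣ w₂ &ᵣ x₁) y₁ (q &ᵣ w₁) + condMI P (t &ᵣ w₁ &ᵣ x₂) y₂ (q &ᵣ w₂) ∧
  2 * HS + HT < condMI P (s &ᵣ x₁) y₁ (q &ᵣ w₁ &ᵣ w₂) + condMI P (s &ᵣ w₂ &ᵣ x₁) y₁ q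
    + condMI P (t &ᵣ w₁ &ᵣ x₂) y₂ (q &ᵣ w₂) ∧
  HS + 2 * HT < condMI P (t &ᵣ x₂) y₂ (q &ᵣ w₁ &ᵣ w₂) + condMI P (t &ᵣ w₁ &ᵣ x₂) y₂ q
    + condMI P (s &ᵣ w₂ &ᵣ x₁) y₁ (q &ᵣ w₁)

end SourceConditions

/-! ### The simplified Han–Kobayashi region of Chong et al. -/

/-- The factors of `p(q) p(w₁|q) p(w₂|q) p(x₁|w₁ q) p(x₂|w₂ q)`. -/
structure HKLaw (Q W₁ W₂ X₁ X₂ : Type*) [Fintype Q] [Fintype W₁] [Fintype W₂]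
    [Fintype X₁] [Fintype X₂] where
  /-- `p(q)` -/
  pQ : Q → ℝ
  /-- `p(w₁|q)` -/
  pW₁ : Q → W₁ → ℝ
  /-- `p(w₂|q)` -/
  pW₂ : Q → W₂ → ℝ
  /-- `p(x₁|w₁ q)` -/
  pX₁ : W₁ → Q → X₁ → ℝ
  /-- `p(x₂|w₂ q)` -/
  pX₂ : W₂ → Q → X₂ → ℝ
  pQ_mem : pQ ∈ stdSimplex ℝ Q
  pW₁_mem : ∀ q, pW₁ q ∈ stdSimplex ℝ W₁
  pW₂_mem : ∀ q, pW₂ q ∈ stdSimplex ℝ W₂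
  pX₁_mem : ∀ w₁ q, pX₁ w₁ q ∈ stdSimplex ℝ X₁
  pX₂_mem : ∀ w₂ q, pX₂ w₂ q ∈ stdSimplex ℝ X₂

section HK

variable {Q W₁ W₂ X₁ X₂ Y₁ Y₂ : Type*} [Fintype Q] [Fintype W₁]
  [Fintype W₂] [Fintype X₁] [Fintype X₂] [Fintype Y₁] [Fintype Y₂]

/-- The choice `p(x₁|s w₁ q) = p(x₁|w₁ q)` and `p(x₂|t w₂ q) = p(x₂|w₂ q)`. -/
def HKLaw.toSourceLaw (L : HKLaw Q W₁ W₂ X₁ X₂) (S T : Type*) :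
    SourceLaw S T Q W₁ W₂ X₁ X₂ where
  pQ := L.pQ
  pW₁ := L.pW₁
  pW₂ := L.pW₂
  pX₁ := fun _ => L.pX₁
  pX₂ := fun _ => L.pX₂
  pQ_mem := L.pQ_mem
  pW₁_mem := L.pW₁_mem
  pW₂_mem := L.pW₂_mem
  pX₁_mem := fun _ => L.pX₁_mem
  pX₂_mem := fun _ => L.pX₂_mem

/-- The joint distribution `p(q) p(w₁|q) p(w₂|q) p(x₁|w₁ q) p(x₂|w₂ q) p(y₁ y₂|x₁ x₂)`. -/
def HKLaw.joint (L : HKLaw Q W₁ W₂ X₁ X₂) (N : X₁ → X₂ → Y₁ × Y₂ → ℝ) :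
    Q × W₁ × W₂ × X₁ × X₂ × Y₁ × Y₂ → ℝ :=
  fun (q, w₁, w₂, x₁, x₂, y₁, y₂) =>
    L.pQ q * L.pW₁ q w₁ * L.pW₂ q w₂ * L.pX₁ w₁ q x₁ * L.pX₂ w₂ q x₂ * N x₁ x₂ (y₁, y₂)

/-- The seven inequalities of the simplified Han–Kobayashi inner bound. -/
def HKConditions (N : X₁ → X₂ → Y₁ × Y₂ → ℝ) (L : HKLaw Q W₁ W₂ X₁ X₂) (R₁ R₂ : ℝ) : Prop :=
  let P : Q × W₁ × W₂ × X₁ × X₂ × Y₁ × Y₂ → ℝ := L.joint N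
  let q : Q × W₁ × W₂ × X₁ × X₂ × Y₁ × Y₂ → Q := fun (q, _, _, _, _, _, _) => q
  let w₁ : Q × W₁ × W₂ × X₁ × X₂ × Y₁ × Y₂ → W₁ := fun (_, w₁, _, _, _, _, _) => w₁
  let w₂ : Q × W₁ × W₂ × X₁ × X₂ × Y₁ × Y₂ → W₂ := fun (_, _, w₂, _, _, _, _) => w₂
  let x₁ : Q × W₁ × W₂ × X₁ × X₂ × Y₁ × Y₂ → X₁ := fun (_, _, _, x₁, _, _, _) => x₁
  let x₂ : Q × W₁ × W₂ × X₁ × X₂ × Y₁ × Y₂ → X₂ := fun (_, _, _, _, x₂, _, _) => x₂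
  let y₁ : Q × W₁ × W₂ × X₁ × X₂ × Y₁ × Y₂ → Y₁ := fun (_, _, _, _, _, y₁, _) => y₁
  let y₂ : Q × W₁ × W₂ × X₁ × X₂ × Y₁ × Y₂ → Y₂ := fun (_, _, _, _, _, _, y₂) => y₂
  R₁ < condMI P x₁ y₁ (q &ᵣ w₂) ∧
  R₂ < condMI P x₂ y₂ (q &ᵣ w₁) ∧
  R₁ + R₂ < condMI P x₁ y₁ (q &ᵣ w₁ &ᵣ w₂) + condMI P (w₁ &ᵣ x₂) y₂ q ∧
  R₁ + R₂ < condMI P x₂ y₂ (q &ᵣ w₁ &ᵣ w₂) + condMI P (w₂ &ᵣ x₁) y₁ q ∧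
  R₁ + R₂ < condMI P (w₂ &ᵣ x₁) y₁ (q &ᵣ w₁) + condMI P (w₁ &ᵣ x₂) y₂ (q &ᵣ w₂) ∧
  2 * R₁ + R₂ < condMI P x₁ y₁ (q &ᵣ w₁ &ᵣ w₂) + condMI P (w₂ &ᵣ x₁) y₁ q
    + condMI P (w₁ &ᵣ x₂) y₂ (q &ᵣ w₂) ∧
  R₁ + 2 * R₂ < condMI P x₂ y₂ (q &ᵣ w₁ &ᵣ w₂) + condMI P (w₁ &ᵣ x₂) y₂ q
    + condMI P (w₂ &ᵣ x₁) y₁ (q &ᵣ w₁)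

/-- The simplified Han–Kobayashi region: pairs of nonnegative rates that satisfy the seven
inequalities for some auxiliary variables with finite alphabets. -/
def hkRegion (N : X₁ → X₂ → Y₁ × Y₂ → ℝ) : Set (ℝ × ℝ) :=
  {R | 0 ≤ R.1 ∧ 0 ≤ R.2 ∧ ∃ (a b c : ℕ) (L : HKLaw (Fin a) (Fin b) (Fin c) X₁ X₂),
    HKConditions N L R.1 R.2}

/-- The region that the conditions for correlated sources give for independent sources: pairs
`(H(S), H(T))` of independent finite sources that satisfy `SourceConditions` with inputs drawn as
`p(x₁|w₁ q)` and `p(x₂|w₂ q)`, for some auxiliary variables with finite alphabets. -/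
def indepSourceRegion (N : X₁ → X₂ → Y₁ × Y₂ → ℝ) : Set (ℝ × ℝ) :=
  {R | ∃ (k l : ℕ) (pS : Fin k → ℝ) (pT : Fin l → ℝ) (a b c : ℕ)
    (L : HKLaw (Fin a) (Fin b) (Fin c) X₁ X₂),
    pS ∈ stdSimplex ℝ (Fin k) ∧ pT ∈ stdSimplex ℝ (Fin l) ∧
    SourceConditions (indep pS pT) N (L.toSourceLaw (Fin k) (Fin l)) ∧
    R.1 = entropy pS ∧ R.2 = entropy pT}

end HK

end InterferenceChannel

end

open InterferenceChannel

set_option linter.unusedSectionVars false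

namespace InterferenceChannel

/-! ### Entropy and conditional mutual information of finite laws. -/

section Laws

variable {Ω Ω' α β γ : Type*} [Fintype Ω] [Fintype Ω'] [Fintype α] [Fintype β] [Fintype γ]

/-! Part (i) is a random coding argument. User 1 hashes its source words uniformly into `M₁` bins,
draws one cloud centre per bin from p(w₁|q), and draws for every word s a channel word from p(x₁|s
w₁ q), where w₁ is the centre of the bin of s. User 2 does the same with `M₂` bins. The hash value
plays the part of the Han–Kobayashi common message, and its rate is a free parameter. Decoder 1
looks for a word s and some centre of user 2, not necessarily the true one, that together pass four
likelihood-ratio tests.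

A wrong word shares the true own centre (a hash collision, probability 1/M₁) or has a fresh one, and
it is tested with the true foreign centre or with one of at most M₂ fresh ones. Each test compares
the likelihood of one of these four hypotheses with the true joint law, which contains the factor
p(s). A change of measure (`sum_mul_sum_law_le`) therefore bounds the sum over all wrong words at
once, without counting them. The result is the bound `SourceLaw.average_error_le`, valid for
arbitrary finite alphabets, which is then applied to blocks of length n.

On blocks all laws are products, and Chebyshev's inequality (`exists_tail_le`) shows that the true
word passes the tests with thresholds close to the expected log-ratios. By `SourceLaw.rate_bounds`
these expectations are, or are at least, the mutual informations of the theorem minus H(S). With M₁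
≈ 2^(nx) and M₂ ≈ 2^(ny), all four error terms at both decoders vanish under linear conditions on x
and y, and `exists_hash_rates` derives the existence of such x and y from the seven inequalities.
Decoder 2 is decoder 1 with the users exchanged, and averaging the sum of the two errors fixes the
time-sharing sequence and both codebooks simultaneously.

For part (ii), S is independent of all other variables that occur with it in an information. It adds
H(S) to two entropies of opposite sign and cancels; the same holds for T. Part (iii) needs in
addition that every nonnegative number is the entropy of a finite source (`exists_entropy_eq`). -/

lemma law_nonneg {P : Ω → ℝ} (hP : ∀ ω, 0 ≤ P ω) (A : Ω → α) (a : α) : 0 ≤ law P A a := by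
  unfold law
  exact Finset.sum_nonneg fun ω _ => by split_ifs <;> simp [hP]

open Classical in
lemma le_law {P : Ω → ℝ} (hP : ∀ ω, 0 ≤ P ω) (A : Ω → α) (ω : Ω) : P ω ≤ law P A (A ω) := by
  unfold law
  have := Finset.single_le_sum (f := fun ω' => if A ω' = A ω then P ω' else 0)
    (fun ω' _ => by split_ifs <;> simp [hP]) (Finset.mem_univ ω)
  simpa using this

lemma sum_law_mul (P : Ω → ℝ) (A : Ω → α) (g : α → ℝ) :
    ∑ a, law P A a * g a = ∑ ω, P ω * g (A ω) := by
  classical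
  simp only [law, Finset.sum_mul]
  rw [Finset.sum_comm]
  refine Finset.sum_congr rfl fun ω _ => ?_
  simp [ite_mul]

lemma sum_law (P : Ω → ℝ) (A : Ω → α) : ∑ a, law P A a = ∑ ω, P ω := by
  simpa using sum_law_mul P A (fun _ => 1)

lemma sum_law_join (P : Ω → ℝ) (A : Ω → α) (C : Ω → γ) (c : γ) :
    ∑ a, law P (A &ᵣ C) (a, c) = law P C c := by
  classical
  simp only [law, join, Prod.mk.injEq]
  rw [Finset.sum_comm]
  refine Finset.sum_congr rfl fun ω _ => ?_
  by_cases h : C ω = c <;> simp [h]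

/-- Relabelling the values of a random variable does not change the probability of its value. -/
lemma law_apply_congr (P : Ω → ℝ) {A : Ω → α} {B : Ω → β}
    (h : ∀ ω ω', A ω' = A ω ↔ B ω' = B ω) (ω : Ω) : law P A (A ω) = law P B (B ω) := by
  classical
  simp [law, h]

lemma rvEntropy_eq (P : Ω → ℝ) (A : Ω → α) :
    rvEntropy P A = -(∑ ω, P ω * Real.logb 2 (law P A (A ω))) := by
  have := sum_law_mul P A (fun a => Real.log (law P A a))
  simp only [rvEntropy, entropy, Real.negMulLog, neg_mul, Finset.sum_neg_distrib, this, Real.logb,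
    neg_div, Finset.sum_div, mul_div_assoc]

/-- Entropy depends only on the partition of the sample space into fibres. This is what allows
tuples to be reordered and regrouped in all later identities between informations. -/
lemma rvEntropy_congr (P : Ω → ℝ) {A : Ω → α} {B : Ω → β}
    (h : ∀ ω ω', A ω' = A ω ↔ B ω' = B ω) : rvEntropy P A = rvEntropy P B := by
  simp only [rvEntropy_eq, law_apply_congr P h]

lemma law_comp_equiv (e : Ω' ≃ Ω) (P : Ω → ℝ) (A : Ω → α) :
    law (fun ω => P (e ω)) (fun ω => A (e ω)) = law P A := by
  classical
  funext a
  exact e.sum_comp (fun ω => if A ω = a then P ω else 0)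

lemma rvEntropy_comp_equiv (e : Ω' ≃ Ω) (P : Ω → ℝ) (A : Ω → α) :
    rvEntropy (fun ω => P (e ω)) (fun ω => A (e ω)) = rvEntropy P A := by
  rw [rvEntropy, law_comp_equiv, rvEntropy]

lemma condMI_eq (P : Ω → ℝ) (A : Ω → α) (B : Ω → β) (C : Ω → γ) :
    condMI P A B C = rvEntropy P (A &ᵣ C) - rvEntropy P C
      - (rvEntropy P (A &ᵣ B &ᵣ C) - rvEntropy P (B &ᵣ C)) := rfl

/-- Gibbs' inequality: apply log x ≤ x - 1 to the ratio p(a,c)p(b,c) / (p(a,b,c)p(c)), whose mean is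
at most the total mass of `P`. -/
lemma condMI_nonneg {P : Ω → ℝ} (hP : ∀ ω, 0 ≤ P ω) (A : Ω → α) (B : Ω → β) (C : Ω → γ) :
    0 ≤ condMI P A B C := by
  set pABC := law P (A &ᵣ B &ᵣ C) with hABC
  set pAC := law P (A &ᵣ C) with hAC
  set pBC := law P (B &ᵣ C) with hBC
  set pC := law P C with hC
  have hlog : 0 < Real.log 2 := Real.log_pos (by norm_num)
  have key : ∀ ω, P ω - P ω * (pAC (A ω, C ω) * pBC (B ω, C ω) /
      (pABC (A ω, B ω, C ω) * pC (C ω))) ≤ P ω * Real.log (pABC (A ω, B ω, C ω)) +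
      P ω * Real.log (pC (C ω)) - P ω * Real.log (pAC (A ω, C ω)) -
      P ω * Real.log (pBC (B ω, C ω)) := by
    intro ω
    rcases (hP ω).eq_or_lt with h0 | h0
    · simp [← h0]
    have h1 : 0 < pABC (A ω, B ω, C ω) := h0.trans_le (le_law hP (A &ᵣ B &ᵣ C) ω)
    have h2 : 0 < pAC (A ω, C ω) := h0.trans_le (le_law hP (A &ᵣ C) ω)
    have h3 : 0 < pBC (B ω, C ω) := h0.trans_le (le_law hP (B &ᵣ C) ω)
    have h4 : 0 < pC (C ω) := h0.trans_le (le_law hP C ω)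
    have h5 := Real.log_le_sub_one_of_pos
      (show 0 < pAC (A ω, C ω) * pBC (B ω, C ω) / (pABC (A ω, B ω, C ω) * pC (C ω)) by positivity)
    rw [Real.log_div (by positivity) (by positivity), Real.log_mul h2.ne' h3.ne',
      Real.log_mul h1.ne' h4.ne'] at h5
    nlinarith
  have hsum := Finset.sum_le_sum fun ω (_ : ω ∈ Finset.univ) => key ω
  have hle : ∑ ω, P ω * (pAC (A ω, C ω) * pBC (B ω, C ω) /
      (pABC (A ω, B ω, C ω) * pC (C ω))) ≤ ∑ ω, P ω := by
    have h1 := sum_law_mul P (A &ᵣ B &ᵣ C)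
      (fun x => pAC (x.1, x.2.2) * pBC x.2 / (pABC x * pC x.2.2))
    have h2 : ∑ ω, P ω * (pAC (A ω, C ω) * pBC (B ω, C ω) /
      (pABC (A ω, B ω, C ω) * pC (C ω))) = ∑ x, pABC x *
        (pAC (x.1, x.2.2) * pBC x.2 / (pABC x * pC x.2.2)) := h1.symm
    rw [h2]
    calc ∑ x, pABC x * (pAC (x.1, x.2.2) * pBC x.2 / (pABC x * pC x.2.2))
        ≤ ∑ x : α × β × γ, pAC (x.1, x.2.2) * (pBC x.2 / pC x.2.2) := by
          refine Finset.sum_le_sum fun x _ => ?_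
          have e1 : 0 ≤ pABC x := law_nonneg hP _ x
          have e2 : 0 ≤ pAC (x.1, x.2.2) := law_nonneg hP _ _
          have e3 : 0 ≤ pBC x.2 := law_nonneg hP _ _
          have e4 : 0 ≤ pC x.2.2 := law_nonneg hP _ _
          -- Where p(a,b,c) = 0 the left term is lost while the right one may be positive, so the
          -- mean of the ratio is bounded, not computed.
          rcases e1.eq_or_lt with h | h
          · rw [← h, zero_mul]; positivity
          · apply le_of_eq
            rw [mul_div_assoc', mul_div_mul_left _ _ h.ne', mul_div_assoc]
      _ = ∑ y : β × γ, pC y.2 * (pBC y / pC y.2) := by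
          rw [Fintype.sum_prod_type, Finset.sum_comm]
          refine Finset.sum_congr rfl fun y _ => ?_
          dsimp only
          rw [← Finset.sum_mul]
          congr 1
          exact sum_law_join P A C y.2
      _ ≤ ∑ y, pBC y := by
          refine Finset.sum_le_sum fun y _ => ?_
          have e3 : 0 ≤ pBC y := law_nonneg hP _ _
          -- If p(c) = 0 the quotient is 0 by convention, and the bound survives.
          rcases eq_or_ne (pC y.2) 0 with h | h
          · simp [h, e3]
          · rw [mul_div_cancel₀ _ h]
      _ = ∑ ω, P ω := sum_law P _
  rw [Finset.sum_sub_distrib, Finset.sum_sub_distrib, Finset.sum_sub_distrib,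
    Finset.sum_add_distrib] at hsum
  have hfin : condMI P A B C = (∑ ω, P ω * Real.log (pABC (A ω, B ω, C ω)) +
      ∑ ω, P ω * Real.log (pC (C ω)) - ∑ ω, P ω * Real.log (pAC (A ω, C ω)) -
      ∑ ω, P ω * Real.log (pBC (B ω, C ω))) / Real.log 2 := by
    rw [condMI_eq]
    simp only [rvEntropy_eq, Real.logb, ← mul_div_assoc, ← Finset.sum_div]
    simp only [← hABC, ← hAC, ← hBC, ← hC, join]
    ring
  rw [hfin]
  exact div_nonneg (by linarith) hlog.le

end Laws

/-! ### Removing an independent source from a mutual information. -/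

section IndependentSources

variable {S T Ω α β γ δ : Type*} [Fintype S] [Fintype T] [Fintype Ω] [Fintype α] [Fintype β]
  [Fintype γ] [Fintype δ]

lemma law_snd_snd {pS : S → ℝ} {pT : T → ℝ} (hS : ∑ s, pS s = 1) (hT : ∑ t, pT t = 1)
    (P : Ω → ℝ) (A : Ω → α) :
    law (fun ω : S × T × Ω => pS ω.1 * pT ω.2.1 * P ω.2.2) (fun ω => A ω.2.2) = law P A := by
  classical
  funext a
  simp only [law, Fintype.sum_prod_type]
  simp only [← mul_ite_zero, mul_assoc, ← Finset.mul_sum]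
  simp only [← Finset.sum_mul, hS, hT, one_mul]

lemma rvEntropy_snd_snd {pS : S → ℝ} {pT : T → ℝ} (hS : ∑ s, pS s = 1) (hT : ∑ t, pT t = 1)
    (P : Ω → ℝ) (A : Ω → α) :
    rvEntropy (fun ω : S × T × Ω => pS ω.1 * pT ω.2.1 * P ω.2.2) (fun ω => A ω.2.2) =
      rvEntropy P A := by
  rw [rvEntropy, law_snd_snd hS hT, rvEntropy]

lemma law_fst_join {pS : S → ℝ} {pT : T → ℝ} (hT : ∑ t, pT t = 1)
    (P : Ω → ℝ) (A : Ω → α) (s : S) (a : α) :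
    law (fun ω : S × T × Ω => pS ω.1 * pT ω.2.1 * P ω.2.2) (fun ω => (ω.1, A ω.2.2)) (s, a) =
      pS s * law P A a := by
  classical
  simp only [law, Fintype.sum_prod_type, Prod.mk.injEq, ite_and]
  rw [Finset.sum_eq_single s (fun s' _ h => by simp [h]) (by simp)]
  simp only [if_true, ← mul_ite_zero, mul_assoc, ← Finset.mul_sum]
  rw [← Finset.sum_mul, hT, one_mul]

lemma rvEntropy_fst_join {pS : S → ℝ} {pT : T → ℝ} (hS : ∑ s, pS s = 1) (hT : ∑ t, pT t = 1)
    {P : Ω → ℝ} (hP : ∑ ω, P ω = 1) (A : Ω → α) :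
    rvEntropy (fun ω : S × T × Ω => pS ω.1 * pT ω.2.1 * P ω.2.2) (fun ω => (ω.1, A ω.2.2)) =
      entropy pS + rvEntropy P A := by
  have h : ∀ x y : ℝ, Real.negMulLog (x * y) = y * Real.negMulLog x + x * Real.negMulLog y :=
    Real.negMulLog_mul
  simp only [rvEntropy, entropy, Fintype.sum_prod_type, law_fst_join hT, h, Finset.sum_add_distrib]
  simp_rw [← Finset.mul_sum, ← Finset.sum_mul, sum_law, hP, hS, one_mul,
    add_div]

/-- `A'` carries the same information as the pair of S and `A`. Since S is independent of the rest,
it adds H(S) both to H(A,C) and to H(A,B,C), which enter with opposite signs. -/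
lemma condMI_eq_of_fst {pS : S → ℝ} {pT : T → ℝ} (hS : ∑ s, pS s = 1) (hT : ∑ t, pT t = 1)
    {P : Ω → ℝ} (hP : ∑ ω, P ω = 1) {A' : S × T × Ω → δ} (A : Ω → α) (B : Ω → β) (C : Ω → γ)
    (hA : ∀ ω ω', A' ω' = A' ω ↔ ω'.1 = ω.1 ∧ A ω'.2.2 = A ω.2.2) :
    condMI (fun ω : S × T × Ω => pS ω.1 * pT ω.2.1 * P ω.2.2) A' (fun ω => B ω.2.2)
      (fun ω => C ω.2.2) = condMI P A B C := by
  rw [condMI_eq, condMI_eq]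
  have h1 := rvEntropy_fst_join hS hT hP (A &ᵣ C)
  have h2 := rvEntropy_fst_join hS hT hP (A &ᵣ B &ᵣ C)
  have h3 := rvEntropy_snd_snd hS hT P C
  have h4 := rvEntropy_snd_snd hS hT P (B &ᵣ C)
  rw [rvEntropy_congr (B := fun ω : S × T × Ω => (ω.1, (A &ᵣ C) ω.2.2)), h1, h3,
    rvEntropy_congr (B := fun ω : S × T × Ω => (ω.1, (A &ᵣ B &ᵣ C) ω.2.2)), h2]
  · exact (congrArg (fun z => entropy pS + rvEntropy P (A &ᵣ C) - rvEntropy P C -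
      (entropy pS + rvEntropy P (A &ᵣ B &ᵣ C) - z)) h4).trans (by ring)
  all_goals
    intro ω ω'
    simp only [join, Prod.mk.injEq, hA]
    tauto

lemma condMI_eq_of_snd {pS : S → ℝ} {pT : T → ℝ} (hS : ∑ s, pS s = 1) (hT : ∑ t, pT t = 1)
    {P : Ω → ℝ} (hP : ∑ ω, P ω = 1) {A' : S × T × Ω → δ} (A : Ω → α) (B : Ω → β) (C : Ω → γ)
    (hA : ∀ ω ω', A' ω' = A' ω ↔ ω'.2.1 = ω.2.1 ∧ A ω'.2.2 = A ω.2.2) :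
    condMI (fun ω : S × T × Ω => pS ω.1 * pT ω.2.1 * P ω.2.2) A' (fun ω => B ω.2.2)
      (fun ω => C ω.2.2) = condMI P A B C := by
  let e : T × S × Ω ≃ S × T × Ω :=
    ⟨fun x => (x.2.1, x.1, x.2.2), fun x => (x.2.1, x.1, x.2.2), fun _ => rfl, fun _ => rfl⟩
  rw [← condMI_eq_of_fst hT hS hP (A' := fun x => A' (e x)) A B C (fun ω ω' => hA (e ω) (e ω'))]
  have hPe : (fun ω : T × S × Ω => pT ω.1 * pS ω.2.1 * P ω.2.2) =
      fun ω => (fun ω : S × T × Ω => pS ω.1 * pT ω.2.1 * P ω.2.2) (e ω) := by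
    funext ω
    simp only [e, Equiv.coe_fn_mk]
    ring
  rw [hPe, condMI_eq, condMI_eq]
  set P' : S × T × Ω → ℝ := fun ω => pS ω.1 * pT ω.2.1 * P ω.2.2
  have h1 := rvEntropy_comp_equiv e P' (A' &ᵣ fun ω => C ω.2.2)
  have h2 := rvEntropy_comp_equiv e P' (A' &ᵣ (fun ω => B ω.2.2) &ᵣ fun ω => C ω.2.2)
  have h3 := rvEntropy_comp_equiv e P' (fun ω => C ω.2.2)
  have h4 := rvEntropy_comp_equiv e P' ((fun ω => B ω.2.2) &ᵣ fun ω => C ω.2.2)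
  rw [← h1, ← h2, ← h3, ← h4]
  rfl

end IndependentSources

/-! ### The region for independent sources. -/

section HK

variable {S T Q W₁ W₂ X₁ X₂ Y₁ Y₂ : Type*} [Fintype S] [Fintype T] [Fintype Q] [Fintype W₁]
  [Fintype W₂] [Fintype X₁] [Fintype X₂] [Fintype Y₁] [Fintype Y₂]

lemma HKLaw.sum_joint (L : HKLaw Q W₁ W₂ X₁ X₂) {N : X₁ → X₂ → Y₁ × Y₂ → ℝ}
    (hN : ∀ x₁ x₂, N x₁ x₂ ∈ stdSimplex ℝ (Y₁ × Y₂)) : ∑ ω, L.joint N ω = 1 := by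
  have hN' : ∀ x₁ x₂, ∑ y₁, ∑ y₂, N x₁ x₂ (y₁, y₂) = 1 := fun x₁ x₂ => by
    rw [← Fintype.sum_prod_type, (hN x₁ x₂).2]
  simp only [Fintype.sum_prod_type, HKLaw.joint, ← Finset.mul_sum, hN', (L.pX₂_mem _ _).2,
    (L.pX₁_mem _ _).2, (L.pW₂_mem _).2, (L.pW₁_mem _).2, L.pQ_mem.2, mul_one]

lemma margS_indep {pS : S → ℝ} {pT : T → ℝ} (hT : pT ∈ stdSimplex ℝ T) :
    margS (indep pS pT) = pS := by
  funext s
  simp only [margS, indep, ← Finset.mul_sum, hT.2, mul_one]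

lemma margT_indep {pS : S → ℝ} {pT : T → ℝ} (hS : pS ∈ stdSimplex ℝ S) :
    margT (indep pS pT) = pT := by
  funext s
  simp only [margT, indep, ← Finset.sum_mul, hS.2, one_mul]

lemma sourceConditions_indep_iff {N : X₁ → X₂ → Y₁ × Y₂ → ℝ}
    (hN : ∀ x₁ x₂, N x₁ x₂ ∈ stdSimplex ℝ (Y₁ × Y₂)) {pS : S → ℝ} {pT : T → ℝ}
    (hS : pS ∈ stdSimplex ℝ S) (hT : pT ∈ stdSimplex ℝ T) (L : HKLaw Q W₁ W₂ X₁ X₂) :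
    SourceConditions (indep pS pT) N (L.toSourceLaw S T) ↔
      HKConditions N L (entropy pS) (entropy pT) := by
  have hP : (L.toSourceLaw S T).joint (indep pS pT) N =
      fun ω => pS ω.1 * pT ω.2.1 * L.joint N ω.2.2 := by
    funext ⟨s, t, q, w₁, w₂, x₁, x₂, y₁, y₂⟩
    simp only [SourceLaw.joint, HKLaw.joint, HKLaw.toSourceLaw, indep]
    ring
  unfold SourceConditions HKConditions
  rw [hP, margS_indep hT, margT_indep hS]
  have hJ := L.sum_joint hN
  set P := L.joint N
  extract_lets P₁ HS HT s t q w₁ w₂ x₁ x₂ y₁ y₂ P₂ q' w₁' w₂' x₁' x₂' y₁' y₂'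
  have a1 : condMI P₁ (s &ᵣ x₁) y₁ (q &ᵣ w₂) = condMI P₂ (x₁') y₁' (q' &ᵣ w₂') :=
    condMI_eq_of_fst hS.2 hT.2 hJ (x₁') y₁' (q' &ᵣ w₂')
      (fun ω ω' => by simp only [join, Prod.mk.injEq]; exact Iff.rfl)
  have a2 : condMI P₁ (s &ᵣ x₁) y₁ (q &ᵣ w₁ &ᵣ w₂) = condMI P₂ (x₁') y₁' (q' &ᵣ w₁' &ᵣ w₂') :=
    condMI_eq_of_fst hS.2 hT.2 hJ (x₁') y₁' (q' &ᵣ w₁' &ᵣ w₂')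
      (fun ω ω' => by simp only [join, Prod.mk.injEq]; exact Iff.rfl)
  have a3 : condMI P₁ (w₂ &ᵣ s &ᵣ x₁) y₁ (q) = condMI P₂ (w₂' &ᵣ x₁') y₁' (q') :=
    condMI_eq_of_fst hS.2 hT.2 hJ (w₂' &ᵣ x₁') y₁' (q')
      (fun ω ω' => by simp only [join, Prod.mk.injEq]; exact and_left_comm)
  have a4 : condMI P₁ (s &ᵣ w₂ &ᵣ x₁) y₁ (q &ᵣ w₁) = condMI P₂ (w₂' &ᵣ x₁') y₁' (q' &ᵣ w₁') :=
    condMI_eq_of_fst hS.2 hT.2 hJ (w₂' &ᵣ x₁') y₁' (q' &ᵣ w₁')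
      (fun ω ω' => by simp only [join, Prod.mk.injEq]; exact Iff.rfl)
  have a5 : condMI P₁ (s &ᵣ w₂ &ᵣ x₁) y₁ (q) = condMI P₂ (w₂' &ᵣ x₁') y₁' (q') :=
    condMI_eq_of_fst hS.2 hT.2 hJ (w₂' &ᵣ x₁') y₁' (q')
      (fun ω ω' => by simp only [join, Prod.mk.injEq]; exact Iff.rfl)
  have b1 : condMI P₁ (t &ᵣ x₂) y₂ (q &ᵣ w₁) = condMI P₂ (x₂') y₂' (q' &ᵣ w₁') :=
    condMI_eq_of_snd hS.2 hT.2 hJ (x₂') y₂' (q' &ᵣ w₁')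
      (fun ω ω' => by simp only [join, Prod.mk.injEq]; exact Iff.rfl)
  have b2 : condMI P₁ (t &ᵣ x₂) y₂ (q &ᵣ w₁ &ᵣ w₂) = condMI P₂ (x₂') y₂' (q' &ᵣ w₁' &ᵣ w₂') :=
    condMI_eq_of_snd hS.2 hT.2 hJ (x₂') y₂' (q' &ᵣ w₁' &ᵣ w₂')
      (fun ω ω' => by simp only [join, Prod.mk.injEq]; exact Iff.rfl)
  have b3 : condMI P₁ (w₁ &ᵣ t &ᵣ x₂) y₂ (q) = condMI P₂ (w₁' &ᵣ x₂') y₂' (q') :=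
    condMI_eq_of_snd hS.2 hT.2 hJ (w₁' &ᵣ x₂') y₂' (q')
      (fun ω ω' => by simp only [join, Prod.mk.injEq]; exact and_left_comm)
  have b4 : condMI P₁ (t &ᵣ w₁ &ᵣ x₂) y₂ (q &ᵣ w₂) = condMI P₂ (w₁' &ᵣ x₂') y₂' (q' &ᵣ w₂') :=
    condMI_eq_of_snd hS.2 hT.2 hJ (w₁' &ᵣ x₂') y₂' (q' &ᵣ w₂')
      (fun ω ω' => by simp only [join, Prod.mk.injEq]; exact Iff.rfl)
  have b5 : condMI P₁ (t &ᵣ w₁ &ᵣ x₂) y₂ (q) = condMI P₂ (w₁' &ᵣ x₂') y₂' (q') :=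
    condMI_eq_of_snd hS.2 hT.2 hJ (w₁' &ᵣ x₂') y₂' (q')
      (fun ω ω' => by simp only [join, Prod.mk.injEq]; exact Iff.rfl)
  rw [a1, a2, a3, a4, a5, b1, b2, b3, b4, b5]

lemma entropy_nonneg {p : S → ℝ} (hp : p ∈ stdSimplex ℝ S) : 0 ≤ entropy p := by
  refine div_nonneg (Finset.sum_nonneg fun s _ => ?_) (Real.log_nonneg (by norm_num))
  exact Real.negMulLog_nonneg (hp.1 s)
    (hp.2 ▸ Finset.single_le_sum (f := p) (fun i _ => hp.1 i) (Finset.mem_univ s))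

/-- Mix a point mass with the uniform law on 2^⌈R⌉ points. The entropy varies continuously from 0 to
⌈R⌉, so the intermediate value theorem applies. -/
lemma exists_entropy_eq {R : ℝ} (hR : 0 ≤ R) :
    ∃ (k : ℕ) (p : Fin k → ℝ), p ∈ stdSimplex ℝ (Fin k) ∧ entropy p = R := by
  let m := ⌈R⌉₊
  let k := 2 ^ m
  have : NeZero k := ⟨by positivity⟩
  have hk0 : (0 : ℝ) < k := by positivity
  let f : ℝ → Fin k → ℝ := fun θ i => (1 - θ) * (if i = 0 then 1 else 0) + θ * (k : ℝ)⁻¹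
  have hc : Continuous fun θ => entropy (f θ) := by
    unfold entropy
    refine Continuous.div_const (continuous_finsetSum _ fun i _ => ?_) _
    exact Real.continuous_negMulLog.comp (by fun_prop)
  have h0 : entropy (f 0) = 0 := by
    have : ∀ i, Real.negMulLog (f 0 i) = 0 := fun i => by
      by_cases h : i = 0 <;> simp [f, h]
    simp [entropy, this]
  have h1 : entropy (f 1) = m := by
    have hlog : Real.log 2 ≠ 0 := (Real.log_pos (by norm_num)).ne'
    simp only [entropy, f, Real.negMulLog, sub_self, zero_mul, zero_add, one_mul, Finset.sum_const,
      Finset.card_univ, Fintype.card_fin, nsmul_eq_mul, Real.log_inv]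
    have : Real.log k = m * Real.log 2 := by simp [k]
    rw [this]
    field_simp
  have hmem : R ∈ Set.Icc (entropy (f 0)) (entropy (f 1)) := by
    rw [h0, h1]
    exact ⟨hR, Nat.le_ceil R⟩
  obtain ⟨θ, ⟨hθ0, hθ1⟩, hθ⟩ := intermediate_value_Icc zero_le_one hc.continuousOn hmem
  refine ⟨k, f θ, ⟨fun i => ?_, ?_⟩, hθ⟩
  · have : 0 ≤ 1 - θ := by linarith
    simp only [f]
    split_ifs <;> positivity
  · simp only [f, Finset.sum_add_distrib, ← Finset.mul_sum, Finset.sum_ite_eq', Finset.mem_univ,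
      if_true, Finset.sum_const, Finset.card_univ, Fintype.card_fin, nsmul_eq_mul]
    field_simp
    ring

lemma indepSourceRegion_eq_hkRegion {N : X₁ → X₂ → Y₁ × Y₂ → ℝ}
    (hN : ∀ x₁ x₂, N x₁ x₂ ∈ stdSimplex ℝ (Y₁ × Y₂)) : indepSourceRegion N = hkRegion N := by
  ext ⟨R₁, R₂⟩
  constructor
  · rintro ⟨k, l, pS, pT, a, b, c, L, hS, hT, hL, rfl, rfl⟩
    exact ⟨entropy_nonneg hS, entropy_nonneg hT, a, b, c, L,
      (sourceConditions_indep_iff hN hS hT L).1 hL⟩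
  · rintro ⟨h1, h2, a, b, c, L, hL⟩
    obtain ⟨k, pS, hS, rfl⟩ := exists_entropy_eq h1
    obtain ⟨l, pT, hT, rfl⟩ := exists_entropy_eq h2
    exact ⟨k, l, pS, pT, a, b, c, L, hS, hT, (sourceConditions_indep_iff hN hS hT L).2 hL, rfl, rfl⟩

end HK

/-! ### Marginals of product measures on function spaces. -/

section Marginals

variable {ι κ : Type*} [Fintype ι] [DecidableEq ι] [Fintype κ]

lemma sum_prod_pi (k : ι → κ → ℝ) (hk : ∀ i, ∑ a, k i a = 1) :
    ∑ f : ι → κ, ∏ l, k l (f l) = 1 := by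
  rw [← Fintype.piFinset_univ, ← Finset.prod_univ_sum]
  simp [hk]

/-- Expand `F` in indicators of the pair of values at `i` and `j`. Each indicator can be absorbed
into the factors `i` and `j`, after which the sum of products is a product of sums. -/
lemma sum_pi_marginal_pair (k : ι → κ → ℝ) (hk : ∀ i, ∑ a, k i a = 1) {i j : ι} (hij : i ≠ j)
    (F : κ → κ → ℝ) :
    ∑ f : ι → κ, (∏ l, k l (f l)) * F (f i) (f j) = ∑ a, ∑ b, k i a * k j b * F a b := by
  classical
  have h1 : ∀ a b, ∑ f : ι → κ, ∏ l, (k l (f l) * (if l = i then (if f l = a then 1 else 0) else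
      if l = j then (if f l = b then 1 else 0) else 1)) = k i a * k j b := by
    intro a b
    rw [← Fintype.piFinset_univ, ← Finset.prod_univ_sum (fun _ => Finset.univ)
      (fun l c => k l c * (if l = i then (if c = a then 1 else 0) else
      if l = j then (if c = b then 1 else 0) else 1))]
    rw [Finset.prod_eq_mul i j hij]
    · simp [hij.symm]
    · intro l _ hl
      simp [hl.1, hl.2, hk]
    · simp
    · simp
  have h2 : ∀ a b (f : ι → κ), ∏ l, (k l (f l) * (if l = i then (if f l = a then 1 else 0) else
      if l = j then (if f l = b then 1 else 0) else 1)) =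
      (∏ l, k l (f l)) * ((if f i = a then 1 else 0) * (if f j = b then 1 else 0)) := by
    intro a b f
    rw [Finset.prod_mul_distrib]
    congr 1
    rw [Finset.prod_eq_mul i j hij]
    · simp [hij.symm]
    · intro l _ hl
      simp [hl.1, hl.2]
    · simp
    · simp
  simp_rw [← h1, h2, Finset.sum_mul]
  have h3 : ∀ a, ∑ b, ∑ f : ι → κ, (∏ l, k l (f l)) * ((if f i = a then 1 else 0) *
      (if f j = b then 1 else 0)) * F a b = ∑ f : ι → κ, ∑ b, (∏ l, k l (f l)) *
      ((if f i = a then 1 else 0) * (if f j = b then 1 else 0)) * F a b := fun a =>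
    Finset.sum_comm
  simp_rw [h3]
  rw [Finset.sum_comm]
  refine Finset.sum_congr rfl fun f _ => ?_
  simp

lemma sum_pi_marginal (k : ι → κ → ℝ) (hk : ∀ i, ∑ a, k i a = 1) (i : ι) (F : κ → ℝ) :
    ∑ f : ι → κ, (∏ l, k l (f l)) * F (f i) = ∑ a, k i a * F a := by
  classical
  have h1 : ∀ a, ∑ f : ι → κ, ∏ l, (k l (f l) * (if l = i then (if f l = a then 1 else 0) else
      1)) = k i a := by
    intro a
    rw [← Fintype.piFinset_univ, ← Finset.prod_univ_sum (fun _ => Finset.univ)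
      (fun l c => k l c * (if l = i then (if c = a then 1 else 0) else 1))]
    rw [Finset.prod_eq_single i]
    · simp
    · intro l _ hl
      simp [hl, hk]
    · simp
  have h2 : ∀ a (f : ι → κ), ∏ l, (k l (f l) * (if l = i then (if f l = a then 1 else 0) else
      1)) = (∏ l, k l (f l)) * (if f i = a then 1 else 0) := by
    intro a f
    rw [Finset.prod_mul_distrib]
    congr 1
    rw [Finset.prod_eq_single i]
    · simp
    · intro l _ hl
      simp [hl]
    · simp
  simp_rw [← h1, h2, Finset.sum_mul]
  rw [Finset.sum_comm]
  refine Finset.sum_congr rfl fun f _ => ?_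
  simp

end Marginals

/-! ### Random codebooks with hashed cloud centres. -/

section Books

/-- The codebook of one user: a hash of the source words, the cloud centres indexed by the hash
values, and the channel words. -/
abbrev Book (S W X : Type*) (M : ℕ) := (S → Fin M) × (Fin M → W) × (S → X)

variable {S W X : Type*} {M : ℕ}

/-- The cloud centre of the source word `s`. -/
def Book.center (c : Book S W X M) (s : S) : W := c.2.1 (c.1 s)

variable [Fintype S] [DecidableEq S] [Fintype W] [Fintype X]

/-- Random coding distribution: uniform hash, i.i.d. cloud centres, satellites drawn given the
source word and its cloud centre. -/
noncomputable def Book.weight (kW : W → ℝ) (kX : S → W → X → ℝ) (c : Book S W X M) : ℝ :=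
  (∏ _s : S, (M : ℝ)⁻¹) * ((∏ m, kW (c.2.1 m)) * ∏ s, kX s (c.center s) (c.2.2 s))

variable {kW : W → ℝ} {kX : S → W → X → ℝ}

lemma Book.weight_nonneg (hW : kW ∈ stdSimplex ℝ W) (hX : ∀ s w, kX s w ∈ stdSimplex ℝ X)
    (c : Book S W X M) : 0 ≤ c.weight kW kX :=
  mul_nonneg (by positivity) (mul_nonneg (Finset.prod_nonneg fun _ _ => hW.1 _)
    (Finset.prod_nonneg fun _ _ => (hX _ _).1 _))

lemma Book.sum_eq (F : Book S W X M → ℝ) :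
    ∑ c : Book S W X M, c.weight kW kX * F c =
      ∑ b : S → Fin M, (∏ _s : S, (M : ℝ)⁻¹) * ∑ w : Fin M → W, (∏ m, kW (w m)) *
        ∑ x : S → X, (∏ s, kX s (w (b s)) (x s)) * F (b, w, x) := by
  simp only [Fintype.sum_prod_type, Book.weight, Book.center, Finset.mul_sum, mul_assoc]

lemma sum_uniform (hM : M ≠ 0) : ∑ _a : Fin M, (M : ℝ)⁻¹ = 1 := by
  simp [hM]

variable (hM : M ≠ 0) (hW : kW ∈ stdSimplex ℝ W) (hX : ∀ s w, kX s w ∈ stdSimplex ℝ X)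
include hM hW hX

lemma Book.sum_weight_mul (s : S) (F : W → X → ℝ) :
    ∑ c : Book S W X M, c.weight kW kX * F (c.center s) (c.2.2 s) =
      ∑ w, kW w * ∑ x, kX s w x * F w x := by
  rw [Book.sum_eq]
  have h1 : ∀ (b : S → Fin M) (w : Fin M → W),
      ∑ x : S → X, (∏ s, kX s (w (b s)) (x s)) * F (w (b s)) (x s) =
        ∑ x, kX s (w (b s)) x * F (w (b s)) x := fun b w =>
    sum_pi_marginal (fun s => kX s (w (b s))) (fun s => (hX _ _).2) s (F (w (b s)))
  have h2 : ∀ b : S → Fin M, ∑ w : Fin M → W, (∏ m, kW (w m)) *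
      ∑ x, kX s (w (b s)) x * F (w (b s)) x = ∑ w, kW w * ∑ x, kX s w x * F w x := fun b =>
    sum_pi_marginal (fun _ => kW) (fun _ => hW.2) (b s) (fun w => ∑ x, kX s w x * F w x)
  simp only [Book.center, h1, h2]
  rw [← Finset.sum_mul, sum_prod_pi (fun _ _ => (M : ℝ)⁻¹) (fun _ => sum_uniform hM), one_mul]

lemma Book.sum_weight [Nonempty S] : ∑ c : Book S W X M, c.weight kW kX = 1 := by
  obtain ⟨s⟩ := ‹Nonempty S›
  have := Book.sum_weight_mul hM hW hX s (fun _ _ => 1)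
  simpa [(hX _ _).2, hW.2] using this

/-- Two distinct words collide under the hash with probability 1/M and then share a centre;
otherwise their centres are independent. The satellites are conditionally independent in both cases.
The second term is kept at full weight even on a collision, which gives the inequality. -/
lemma Book.sum_weight_mul_pair_le {s s' : S} (hs : s ≠ s') {F : W → X → W → X → ℝ}
    (hF : ∀ w x w' x', 0 ≤ F w x w' x') :
    ∑ c : Book S W X M, c.weight kW kX * F (c.center s) (c.2.2 s) (c.center s') (c.2.2 s') ≤
      ∑ w, kW w * ∑ x, kX s w x * ((M : ℝ)⁻¹ * (∑ x', kX s' w x' * F w x w x') +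
        ∑ w', kW w' * ∑ x', kX s' w' x' * F w x w' x') := by
  rw [Book.sum_eq]
  let H : W → W → ℝ := fun w w' => ∑ x, ∑ x', kX s w x * kX s' w' x' * F w x w' x'
  have hH : ∀ w w', 0 ≤ H w w' := fun w w' => Finset.sum_nonneg fun x _ =>
    Finset.sum_nonneg fun x' _ => mul_nonneg (mul_nonneg ((hX _ _).1 _) ((hX _ _).1 _)) (hF _ _ _ _)
  have h1 : ∀ (b : S → Fin M) (w : Fin M → W),
      ∑ x : S → X, (∏ s, kX s (w (b s)) (x s)) * F (w (b s)) (x s) (w (b s')) (x s') =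
        H (w (b s)) (w (b s')) := fun b w =>
    sum_pi_marginal_pair (fun s => kX s (w (b s))) (fun s => (hX _ _).2) hs
      (fun x x' => F (w (b s)) x (w (b s')) x')
  let D : ℝ := ∑ w, kW w * H w w
  let I : ℝ := ∑ w, ∑ w', kW w * kW w' * H w w'
  have hI : 0 ≤ I := Finset.sum_nonneg fun w _ => Finset.sum_nonneg fun w' _ =>
    mul_nonneg (mul_nonneg (hW.1 _) (hW.1 _)) (hH _ _)
  have h2 : ∀ m m' : Fin M, ∑ w : Fin M → W, (∏ m, kW (w m)) * H (w m) (w m') ≤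
      (if m = m' then D else 0) + I := by
    intro m m'
    split_ifs with h
    · subst h
      rw [sum_pi_marginal (fun _ => kW) (fun _ => hW.2) m (fun w => H w w)]
      linarith
    · rw [sum_pi_marginal_pair (fun _ => kW) (fun _ => hW.2) h H, zero_add]
  have h3 := sum_pi_marginal_pair (fun (_ : S) (_ : Fin M) => (M : ℝ)⁻¹)
    (fun _ => sum_uniform hM) hs (fun m m' => (if m = m' then D else 0) + I)
  simp only [Book.center, h1]
  have hM' : (M : ℝ) ≠ 0 := by exact_mod_cast hM
  calc _ ≤ ∑ b : S → Fin M, (∏ _s : S, (M : ℝ)⁻¹) * ((if b s = b s' then D else 0) + I) :=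
        Finset.sum_le_sum fun b _ => mul_le_mul_of_nonneg_left (h2 _ _) (by positivity)
    _ = (M : ℝ)⁻¹ * D + I := by
        rw [h3]
        simp only [mul_add, Finset.sum_add_distrib, mul_ite, mul_zero, Finset.sum_ite_eq,
          Finset.mem_univ, if_true, Finset.sum_const, Finset.card_univ, Fintype.card_fin,
          nsmul_eq_mul]
        field_simp
    _ = _ := by
        simp only [D, I, H, mul_add, Finset.mul_sum, Finset.sum_add_distrib]
        congr 1
        · refine Finset.sum_congr rfl fun w _ => Finset.sum_congr rfl fun x _ =>
            Finset.sum_congr rfl fun x' _ => by ring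
        · refine Finset.sum_congr rfl fun w _ => ?_
          rw [Finset.sum_comm]
          refine Finset.sum_congr rfl fun x _ => Finset.sum_congr rfl fun w' _ =>
            Finset.sum_congr rfl fun x' _ => by ring

/-- One of the M centres belongs to `s`. The other M - 1 are independent of that centre and of the
satellite of `s`, and are counted as M. -/
lemma Book.sum_weight_mul_sum_center_le (s : S) {G : W → X → W → ℝ} (hG : ∀ w x w', 0 ≤ G w x w') :
    ∑ c : Book S W X M, c.weight kW kX * ∑ m, G (c.center s) (c.2.2 s) (c.2.1 m) ≤
      ∑ w, kW w * ∑ x, kX s w x * (G w x w + M * ∑ w', kW w' * G w x w') := by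
  rw [Book.sum_eq]
  let H : W → W → ℝ := fun w w' => ∑ x, kX s w x * G w x w'
  have hH : ∀ w w', 0 ≤ H w w' := fun w w' => Finset.sum_nonneg fun x _ =>
    mul_nonneg ((hX _ _).1 _) (hG _ _ _)
  have h1 : ∀ (b : S → Fin M) (w : Fin M → W),
      ∑ x : S → X, (∏ s, kX s (w (b s)) (x s)) * ∑ m, G (w (b s)) (x s) (w m) =
        ∑ m, H (w (b s)) (w m) := fun b w => by
    rw [sum_pi_marginal (fun s => kX s (w (b s))) (fun s => (hX _ _).2) s
      (fun x => ∑ m, G (w (b s)) x (w m)), Finset.sum_comm]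
    simp only [Finset.mul_sum]
  let D : ℝ := ∑ w, kW w * H w w
  let I : ℝ := ∑ w, ∑ w', kW w * kW w' * H w w'
  have hI : 0 ≤ I := Finset.sum_nonneg fun w _ => Finset.sum_nonneg fun w' _ =>
    mul_nonneg (mul_nonneg (hW.1 _) (hW.1 _)) (hH _ _)
  have h2 : ∀ m m' : Fin M, ∑ w : Fin M → W, (∏ m, kW (w m)) * H (w m) (w m') ≤
      (if m = m' then D else 0) + I := by
    intro m m'
    split_ifs with h
    · subst h
      rw [sum_pi_marginal (fun _ => kW) (fun _ => hW.2) m (fun w => H w w)]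
      linarith
    · rw [sum_pi_marginal_pair (fun _ => kW) (fun _ => hW.2) h H, zero_add]
  have h3 : ∀ m : Fin M, ∑ w : Fin M → W, (∏ m, kW (w m)) * ∑ m', H (w m) (w m') ≤ D + M * I := by
    intro m
    simp only [Finset.mul_sum]
    rw [Finset.sum_comm]
    refine (Finset.sum_le_sum fun m' _ => h2 m m').trans ?_
    simp [Finset.sum_add_distrib]
  simp only [Book.center, h1]
  calc _ ≤ ∑ b : S → Fin M, (∏ _s : S, (M : ℝ)⁻¹) * (D + M * I) :=
        Finset.sum_le_sum fun b _ => mul_le_mul_of_nonneg_left (h3 _) (by positivity)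
    _ = D + M * I := by
        rw [← Finset.sum_mul, sum_prod_pi (fun _ _ => (M : ℝ)⁻¹) (fun _ => sum_uniform hM), one_mul]
    _ = _ := by
        simp only [D, I, H, mul_add, Finset.mul_sum, Finset.sum_add_distrib]
        congr 1
        refine Finset.sum_congr rfl fun w _ => ?_
        rw [Finset.sum_comm]
        refine Finset.sum_congr rfl fun x _ => Finset.sum_congr rfl fun w' _ => by ring

end Books

lemma sum_mul_sum_comm {ι κ : Type*} [Fintype ι] [Fintype κ] (a : ι → ℝ) (b : κ → ℝ)
    (c : ι → κ → ℝ) : ∑ i, a i * ∑ j, b j * c i j = ∑ j, b j * ∑ i, a i * c i j := by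
  simp only [Finset.mul_sum]
  rw [Finset.sum_comm]
  exact Finset.sum_congr rfl fun _ _ => Finset.sum_congr rfl fun _ _ => by ring

/-- Change of measure: the weights law(C)·k are dominated by β times a probability law, so their
total mass is at most β. In the applications `v` is what a wrong word shares with the truth and `z`
is everything redrawn, including the wrong source word itself; its number of values never enters. -/
lemma sum_mul_sum_law_le {Ω V Z U : Type*} [Fintype Ω] [Fintype V] [Fintype Z] [Fintype U]
    {P : Ω → ℝ} (hP : ∑ ω, P ω = 1) (C : Ω → V) (F : Ω → U) (e : V × Z ≃ U) (k : V → Z → ℝ) {β : ℝ}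
    (h : ∀ v z, law P C v * k v z ≤ β * law P F (e (v, z))) :
    ∑ ω, P ω * ∑ z, k (C ω) z ≤ β := by
  rw [← sum_law_mul P C (fun v => ∑ z, k v z)]
  simp only [Finset.mul_sum]
  calc _ ≤ ∑ v, ∑ z, β * law P F (e (v, z)) :=
        Finset.sum_le_sum fun v _ => Finset.sum_le_sum fun z _ => h v z
    _ = ∑ x : V × Z, β * law P F (e x) := by rw [Fintype.sum_prod_type]
    _ = β := by
        rw [e.sum_comp (fun x => β * law P F x), ← Finset.mul_sum, sum_law, hP, mul_one]

/-! ### The one-shot random coding bound for the first decoder. -/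

section OneShot

variable {S T Q W₁ W₂ X₁ X₂ Y₁ Y₂ : Type*}

/-- What the first decoder has to recover or observes: `(q, s, w₁, x₁, w₂, y₁)`. -/
def obs (ω : S × T × Q × W₁ × W₂ × X₁ × X₂ × Y₁ × Y₂) : Q × S × W₁ × X₁ × W₂ × Y₁ :=
  (ω.2.2.1, ω.1, ω.2.2.2.1, ω.2.2.2.2.2.1, ω.2.2.2.2.1, ω.2.2.2.2.2.2.2.1)

/-- `(q, w₁, w₂, y₁)` -/
def obsCenters (ω : S × T × Q × W₁ × W₂ × X₁ × X₂ × Y₁ × Y₂) : Q × W₁ × W₂ × Y₁ :=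
  (ω.2.2.1, ω.2.2.2.1, ω.2.2.2.2.1, ω.2.2.2.2.2.2.2.1)

/-- `(q, w₁, y₁)` -/
def obsOwn (ω : S × T × Q × W₁ × W₂ × X₁ × X₂ × Y₁ × Y₂) : Q × W₁ × Y₁ :=
  (ω.2.2.1, ω.2.2.2.1, ω.2.2.2.2.2.2.2.1)

/-- `(q, w₂, y₁)` -/
def obsOther (ω : S × T × Q × W₁ × W₂ × X₁ × X₂ × Y₁ × Y₂) : Q × W₂ × Y₁ :=
  (ω.2.2.1, ω.2.2.2.2.1, ω.2.2.2.2.2.2.2.1)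

/-- `(q, y₁)` -/
def obsOut (ω : S × T × Q × W₁ × W₂ × X₁ × X₂ × Y₁ × Y₂) : Q × Y₁ :=
  (ω.2.2.1, ω.2.2.2.2.2.2.2.1)

open Classical in
/-- The decoder picks a source word that is accepted together with some cloud centre of the other
user. -/
noncomputable def decode [Nonempty S] {M₁ M₂ : ℕ} (A : Set (Q × S × W₁ × X₁ × W₂ × Y₁)) (q : Q)
    (c₁ : Book S W₁ X₁ M₁) (c₂ : Book T W₂ X₂ M₂) (y : Y₁) : S :=
  if h : ∃ s m, (q, s, c₁.center s, c₁.2.2 s, c₂.2.1 m, y) ∈ A then h.choose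
  else Classical.arbitrary S

open Classical in
/-- Probability that the first source word is decoded incorrectly. -/
noncomputable def wordErr [Fintype S] [Fintype T] [Fintype Y₁] [Fintype Y₂] (p : S × T → ℝ)
    (N : X₁ → X₂ → Y₁ × Y₂ → ℝ) (f₁ : S → X₁) (f₂ : T → X₂) (φ : Y₁ → S) : ℝ :=
  ∑ s, ∑ t, ∑ y₁, ∑ y₂, if s ≠ φ y₁ then p (s, t) * N (f₁ s) (f₂ t) (y₁, y₂) else 0

open Classical in
-- Union bound: either the true word fails the test with its true foreign centre, or a candidate
-- exists and the decoder's choice is a wrong word that passed with some centre.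
lemma decode_error_le [Nonempty S] [Fintype S] {M₁ M₂ : ℕ} (A : Set (Q × S × W₁ × X₁ × W₂ × Y₁))
    (q : Q) (c₁ : Book S W₁ X₁ M₁) (c₂ : Book T W₂ X₂ M₂) (s : S) (t : T) (y : Y₁) :
    (if s ≠ decode A q c₁ c₂ y then (1 : ℝ) else 0) ≤
      (if (q, s, c₁.center s, c₁.2.2 s, c₂.center t, y) ∈ A then 0 else 1) +
      ∑ s', if s' = s then 0 else
        ∑ m, if (q, s', c₁.center s', c₁.2.2 s', c₂.2.1 m, y) ∈ A then (1 : ℝ) else 0 := by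
  have hnn : ∀ s', 0 ≤ (if s' = s then (0 : ℝ) else
        ∑ m, if (q, s', c₁.center s', c₁.2.2 s', c₂.2.1 m, y) ∈ A then (1 : ℝ) else 0) := by
    intro s'
    split_ifs
    · exact le_rfl
    · exact Finset.sum_nonneg fun m _ => by split_ifs <;> norm_num
  by_cases h1 : s ≠ decode A q c₁ c₂ y
  swap
  · rw [if_neg h1]
    exact add_nonneg (by split_ifs <;> norm_num) (Finset.sum_nonneg fun s' _ => hnn s')
  by_cases h2 : (q, s, c₁.center s, c₁.2.2 s, c₂.center t, y) ∈ A
  · have h3 : ∃ s m, (q, s, c₁.center s, c₁.2.2 s, c₂.2.1 m, y) ∈ A := ⟨s, c₂.1 t, h2⟩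
    have h4 : decode A q c₁ c₂ y = h3.choose := dif_pos h3
    obtain ⟨m, hm⟩ := h3.choose_spec
    rw [← h4] at hm
    rw [if_pos h1, if_pos h2, zero_add]
    refine le_trans ?_ (Finset.single_le_sum (fun s' _ => hnn s')
      (Finset.mem_univ (decode A q c₁ c₂ y)))
    rw [if_neg h1.symm]
    have := Finset.single_le_sum (f := fun m => if (q, decode A q c₁ c₂ y,
      c₁.center (decode A q c₁ c₂ y), c₁.2.2 (decode A q c₁ c₂ y), c₂.2.1 m, y) ∈ A
      then (1 : ℝ) else 0) (fun m _ => by split_ifs <;> norm_num) (Finset.mem_univ m)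
    simpa [hm] using this
  · rw [if_pos h1, if_neg h2]
    linarith [Finset.sum_nonneg fun s' (_ : s' ∈ Finset.univ) => hnn s']

variable [Fintype S] [Fintype T] [Fintype Q] [Fintype W₁]
  [Fintype W₂] [Fintype X₁] [Fintype X₂] [Fintype Y₁] [Fintype Y₂]

/-- Random coding distribution of the first user's codebook given the time-sharing variable. -/
noncomputable def SourceLaw.bookWeight₁ [DecidableEq S] (L : SourceLaw S T Q W₁ W₂ X₁ X₂) {M : ℕ}
    (q : Q) (c : Book S W₁ X₁ M) : ℝ := c.weight (L.pW₁ q) (fun s w => L.pX₁ s w q)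

/-- Random coding distribution of the second user's codebook given the time-sharing variable. -/
noncomputable def SourceLaw.bookWeight₂ [DecidableEq T] (L : SourceLaw S T Q W₁ W₂ X₁ X₂) {M : ℕ}
    (q : Q) (c : Book T W₂ X₂ M) : ℝ := c.weight (L.pW₂ q) (fun t w => L.pX₂ t w q)

lemma SourceLaw.joint_nonneg (L : SourceLaw S T Q W₁ W₂ X₁ X₂) {p : S × T → ℝ}
    (hp : p ∈ stdSimplex ℝ (S × T)) {N : X₁ → X₂ → Y₁ × Y₂ → ℝ}
    (hN : ∀ x₁ x₂, N x₁ x₂ ∈ stdSimplex ℝ (Y₁ × Y₂)) (ω) : 0 ≤ L.joint p N ω := by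
  obtain ⟨s, t, q, w₁, w₂, x₁, x₂, y₁, y₂⟩ := ω
  exact mul_nonneg (mul_nonneg (mul_nonneg (mul_nonneg (mul_nonneg (mul_nonneg (hp.1 _)
    (L.pQ_mem.1 _)) ((L.pW₁_mem _).1 _)) ((L.pW₂_mem _).1 _)) ((L.pX₁_mem _ _ _).1 _))
    ((L.pX₂_mem _ _ _).1 _)) ((hN _ _).1 _)

lemma SourceLaw.sum_joint (L : SourceLaw S T Q W₁ W₂ X₁ X₂) {p : S × T → ℝ}
    (hp : p ∈ stdSimplex ℝ (S × T)) {N : X₁ → X₂ → Y₁ × Y₂ → ℝ}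
    (hN : ∀ x₁ x₂, N x₁ x₂ ∈ stdSimplex ℝ (Y₁ × Y₂)) : ∑ ω, L.joint p N ω = 1 := by
  have hN' : ∀ x₁ x₂, ∑ y₁, ∑ y₂, N x₁ x₂ (y₁, y₂) = 1 := fun x₁ x₂ => by
    rw [← Fintype.sum_prod_type, (hN x₁ x₂).2]
  have hp' : ∑ s, ∑ t, p (s, t) = 1 := by rw [← Fintype.sum_prod_type, hp.2]
  simp only [Fintype.sum_prod_type, SourceLaw.joint, ← Finset.mul_sum, hN', (L.pX₂_mem _ _ _).2,
    (L.pX₁_mem _ _ _).2, (L.pW₂_mem _).2, (L.pW₁_mem _).2, L.pQ_mem.2, mul_one, hp']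

/-- Average acceptance of a wrong source word, given the time-sharing variable, the cloud centres
and the output. -/
noncomputable def SourceLaw.falseAccept (L : SourceLaw S T Q W₁ W₂ X₁ X₂) (M₁ M₂ : ℕ)
    (a : Q × S × W₁ × X₁ × W₂ × Y₁ → ℝ) (s : S) (q : Q) (w₁ : W₁) (w₂ : W₂) (y : Y₁) : ℝ :=
  (M₁ : ℝ)⁻¹ * (∑ x, L.pX₁ s w₁ q x * (a (q, s, w₁, x, w₂, y) +
    M₂ * ∑ w₂', L.pW₂ q w₂' * a (q, s, w₁, x, w₂', y))) +
  ∑ w₁', L.pW₁ q w₁' * ∑ x, L.pX₁ s w₁' q x * (a (q, s, w₁', x, w₂, y) +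
    M₂ * ∑ w₂', L.pW₂ q w₂' * a (q, s, w₁', x, w₂', y))

lemma SourceLaw.falseAccept_nonneg (L : SourceLaw S T Q W₁ W₂ X₁ X₂) (M₁ M₂ : ℕ)
    {a : Q × S × W₁ × X₁ × W₂ × Y₁ → ℝ} (ha : ∀ u, 0 ≤ a u) (s : S) (q : Q) (w₁ : W₁) (w₂ : W₂)
    (y : Y₁) : 0 ≤ L.falseAccept M₁ M₂ a s q w₁ w₂ y := by
  have h1 := fun s w q => (L.pX₁_mem s w q).1
  have h2 := fun q => (L.pW₁_mem q).1
  have h3 := fun q => (L.pW₂_mem q).1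
  have h4 : ∀ w x, 0 ≤ a (q, s, w, x, w₂, y) + M₂ * ∑ w₂', L.pW₂ q w₂' * a (q, s, w, x, w₂', y) :=
    fun w x => add_nonneg (ha _) (mul_nonneg (Nat.cast_nonneg _)
      (Finset.sum_nonneg fun w' _ => mul_nonneg (h3 _ _) (ha _)))
  exact add_nonneg (mul_nonneg (by positivity) (Finset.sum_nonneg fun x _ =>
    mul_nonneg (h1 _ _ _ _) (h4 _ _))) (Finset.sum_nonneg fun w _ => mul_nonneg (h2 _ _)
    (Finset.sum_nonneg fun x _ => mul_nonneg (h1 _ _ _ _) (h4 _ _)))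

variable [DecidableEq S] [DecidableEq T]

/-- Averaging over `c₂` first separates the true centre of user 2 from the fresh ones. Averaging
over `c₁` then separates a hash collision from a fresh own centre. The four combinations are the
terms of `SourceLaw.falseAccept`. -/
lemma SourceLaw.average_false_accept_le (L : SourceLaw S T Q W₁ W₂ X₁ X₂)
    {N : X₁ → X₂ → Y₁ × Y₂ → ℝ} (hN : ∀ x₁ x₂, N x₁ x₂ ∈ stdSimplex ℝ (Y₁ × Y₂)) {M₁ M₂ : ℕ}
    (hM₁ : M₁ ≠ 0) (hM₂ : M₂ ≠ 0) {a : Q × S × W₁ × X₁ × W₂ × Y₁ → ℝ} (ha : ∀ u, 0 ≤ a u)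
    (q : Q) {s s' : S} (hs : s ≠ s') (t : T) :
    ∑ c₁ : Book S W₁ X₁ M₁, L.bookWeight₁ q c₁ * ∑ c₂ : Book T W₂ X₂ M₂, L.bookWeight₂ q c₂ *
      ∑ m, ∑ y, N (c₁.2.2 s) (c₂.2.2 t) y *
        a (q, s', c₁.center s', c₁.2.2 s', c₂.2.1 m, y.1) ≤
    ∑ w₁, L.pW₁ q w₁ * ∑ x₁, L.pX₁ s w₁ q x₁ * ∑ w₂, L.pW₂ q w₂ * ∑ x₂, L.pX₂ t w₂ q x₂ *
      ∑ y, N x₁ x₂ y * L.falseAccept M₁ M₂ a s' q w₁ w₂ y.1 := by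
  have hN0 := fun x₁ x₂ => (hN x₁ x₂).1
  have h1 := fun s w q => (L.pX₁_mem s w q).1
  have h2 := fun q => (L.pW₁_mem q).1
  have h3 := fun q => (L.pW₂_mem q).1
  have h4 := fun s w q => (L.pX₂_mem s w q).1
  -- The bound after averaging over the second book, as a function of the sent and the competing
  -- centre and satellite.
  let F : W₁ → X₁ → W₁ → X₁ → ℝ := fun _ x w' x' => ∑ w₂, L.pW₂ q w₂ * ∑ x₂, L.pX₂ t w₂ q x₂ *
    (∑ y, N x x₂ y * a (q, s', w', x', w₂, y.1) +
      M₂ * ∑ w₂', L.pW₂ q w₂' * ∑ y, N x x₂ y * a (q, s', w', x', w₂', y.1))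
  have hF : ∀ w x w' x', 0 ≤ F w x w' x' := fun w x w' x' =>
    Finset.sum_nonneg fun w₂ _ => mul_nonneg (h3 _ _) (Finset.sum_nonneg fun x₂ _ =>
      mul_nonneg (h4 _ _ _ _) (add_nonneg
        (Finset.sum_nonneg fun y _ => mul_nonneg (hN0 _ _ _) (ha _))
        (mul_nonneg (Nat.cast_nonneg _) (Finset.sum_nonneg fun w₂' _ => mul_nonneg (h3 _ _)
          (Finset.sum_nonneg fun y _ => mul_nonneg (hN0 _ _ _) (ha _))))))
  have hFeq : ∀ w x w' x', F w x w' x' = ∑ w₂, L.pW₂ q w₂ * ∑ x₂, L.pX₂ t w₂ q x₂ *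
      ∑ y, N x x₂ y * (a (q, s', w', x', w₂, y.1) +
        M₂ * ∑ w₂', L.pW₂ q w₂' * a (q, s', w', x', w₂', y.1)) := by
    intro w x w' x'
    refine Finset.sum_congr rfl fun w₂ _ => congrArg _ (Finset.sum_congr rfl fun x₂ _ =>
      congrArg _ ?_)
    rw [sum_mul_sum_comm, Finset.mul_sum, ← Finset.sum_add_distrib]
    exact Finset.sum_congr rfl fun y _ => by ring
  have hstep : ∀ c₁ : Book S W₁ X₁ M₁, ∑ c₂ : Book T W₂ X₂ M₂, L.bookWeight₂ q c₂ *
      ∑ m, ∑ y, N (c₁.2.2 s) (c₂.2.2 t) y * a (q, s', c₁.center s', c₁.2.2 s', c₂.2.1 m, y.1) ≤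
      F (c₁.center s) (c₁.2.2 s) (c₁.center s') (c₁.2.2 s') := fun c₁ =>
    Book.sum_weight_mul_sum_center_le hM₂ (L.pW₂_mem q) (fun t w => L.pX₂_mem t w q) t
      (G := fun _ x w => ∑ y, N (c₁.2.2 s) x y * a (q, s', c₁.center s', c₁.2.2 s', w, y.1))
      (fun _ _ _ => Finset.sum_nonneg fun y _ => mul_nonneg (hN0 _ _ _) (ha _))
  refine (Finset.sum_le_sum fun c₁ _ => mul_le_mul_of_nonneg_left (hstep c₁)
    (Book.weight_nonneg (L.pW₁_mem q) (fun s w => L.pX₁_mem s w q) c₁)).trans ?_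
  refine (Book.sum_weight_mul_pair_le hM₁ (L.pW₁_mem q) (fun s w => L.pX₁_mem s w q) hs hF).trans
    (le_of_eq ?_)
  refine Finset.sum_congr rfl fun w₁ _ => congrArg _ (Finset.sum_congr rfl fun x₁ _ =>
      congrArg _ ?_)
  have hx : ∀ (w w' : W₁), ∑ x', L.pX₁ s' w' q x' * F w x₁ w' x' =
      ∑ w₂, L.pW₂ q w₂ * ∑ x₂, L.pX₂ t w₂ q x₂ * ∑ y, N x₁ x₂ y * ∑ x', L.pX₁ s' w' q x' *
        (a (q, s', w', x', w₂, y.1) +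
          M₂ * ∑ w₂', L.pW₂ q w₂' * a (q, s', w', x', w₂', y.1)) := by
    intro w w'
    simp only [hFeq]
    rw [sum_mul_sum_comm]
    refine Finset.sum_congr rfl fun w₂ _ => congrArg _ ?_
    rw [sum_mul_sum_comm]
    refine Finset.sum_congr rfl fun x₂ _ => congrArg _ ?_
    rw [sum_mul_sum_comm]
  simp only [hx]
  rw [sum_mul_sum_comm (L.pW₁ q), Finset.mul_sum, ← Finset.sum_add_distrib]
  refine Finset.sum_congr rfl fun w₂ _ => ?_
  rw [sum_mul_sum_comm (L.pW₁ q), mul_left_comm, ← mul_add, Finset.mul_sum, ← Finset.sum_add_distrib]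
  congr 1
  refine Finset.sum_congr rfl fun x₂ _ => ?_
  rw [sum_mul_sum_comm (L.pW₁ q), mul_left_comm, ← mul_add, Finset.mul_sum, ← Finset.sum_add_distrib]
  congr 1
  refine Finset.sum_congr rfl fun y _ => ?_
  rw [mul_left_comm, ← mul_add]
  rfl

end OneShot

section OneShot

variable {S T Q W₁ W₂ X₁ X₂ Y₁ Y₂ : Type*} [Fintype S] [Fintype T] [Fintype Q] [Fintype W₁]
  [Fintype W₂] [Fintype X₁] [Fintype X₂] [Fintype Y₁] [Fintype Y₂]

open Classical in
lemma wordErr_decode_le [Nonempty S] {p : S × T → ℝ} (hp : ∀ st, 0 ≤ p st)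
    {N : X₁ → X₂ → Y₁ × Y₂ → ℝ} (hN : ∀ x₁ x₂ y, 0 ≤ N x₁ x₂ y)
    {M₁ M₂ : ℕ} (A : Set (Q × S × W₁ × X₁ × W₂ × Y₁)) (q : Q)
    (c₁ : Book S W₁ X₁ M₁) (c₂ : Book T W₂ X₂ M₂) :
    wordErr p N c₁.2.2 c₂.2.2 (decode A q c₁ c₂) ≤
      ∑ st : S × T, p st * (∑ y, N (c₁.2.2 st.1) (c₂.2.2 st.2) y *
          (if (q, st.1, c₁.center st.1, c₁.2.2 st.1, c₂.center st.2, y.1) ∈ A then 0 else 1) +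
        ∑ s', if s' = st.1 then 0 else ∑ m, ∑ y, N (c₁.2.2 st.1) (c₂.2.2 st.2) y *
          if (q, s', c₁.center s', c₁.2.2 s', c₂.2.1 m, y.1) ∈ A then (1 : ℝ) else 0) := by
  unfold wordErr
  rw [← Fintype.sum_prod_type' (f := fun s t => ∑ y₁, ∑ y₂, if s ≠ decode A q c₁ c₂ y₁ then
    p (s, t) * N (c₁.2.2 s) (c₂.2.2 t) (y₁, y₂) else 0)]
  refine Finset.sum_le_sum fun st _ => ?_
  rw [← Fintype.sum_prod_type' (f := fun y₁ y₂ => if st.1 ≠ decode A q c₁ c₂ y₁ then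
    p (st.1, st.2) * N (c₁.2.2 st.1) (c₂.2.2 st.2) (y₁, y₂) else 0)]
  have h1 : ∀ s', (if s' = st.1 then 0 else ∑ m, ∑ y, N (c₁.2.2 st.1) (c₂.2.2 st.2) y *
      if (q, s', c₁.center s', c₁.2.2 s', c₂.2.1 m, y.1) ∈ A then (1 : ℝ) else 0) =
      ∑ y, N (c₁.2.2 st.1) (c₂.2.2 st.2) y * if s' = st.1 then 0 else ∑ m,
        if (q, s', c₁.center s', c₁.2.2 s', c₂.2.1 m, y.1) ∈ A then (1 : ℝ) else 0 := by
    intro s'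
    by_cases h : s' = st.1
    · simp [h]
    · simp only [h, if_false]
      rw [Finset.sum_comm]
      simp only [Finset.mul_sum]
  simp only [h1]
  rw [Finset.sum_comm, ← Finset.sum_add_distrib, Finset.mul_sum]
  refine Finset.sum_le_sum fun y _ => ?_
  rw [← Finset.mul_sum, ← mul_add]
  have h2 := mul_le_mul_of_nonneg_left (decode_error_le A q c₁ c₂ st.1 st.2 y.1)
    (mul_nonneg (hp st) (hN (c₁.2.2 st.1) (c₂.2.2 st.2) y))
  rw [mul_assoc, mul_assoc] at h2
  refine le_trans (le_of_eq ?_) h2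
  split_ifs <;> simp

variable [DecidableEq S] [DecidableEq T]

open Classical in
lemma SourceLaw.average_given_source_le (L : SourceLaw S T Q W₁ W₂ X₁ X₂)
    {N : X₁ → X₂ → Y₁ × Y₂ → ℝ} (hN : ∀ x₁ x₂, N x₁ x₂ ∈ stdSimplex ℝ (Y₁ × Y₂)) {M₁ M₂ : ℕ}
    (hM₁ : M₁ ≠ 0) (hM₂ : M₂ ≠ 0) {a a' : Q × S × W₁ × X₁ × W₂ × Y₁ → ℝ} (ha : ∀ u, 0 ≤ a u)
    (q : Q) (s : S) (t : T) :
    ∑ c₁ : Book S W₁ X₁ M₁, L.bookWeight₁ q c₁ * ∑ c₂ : Book T W₂ X₂ M₂, L.bookWeight₂ q c₂ *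
      (∑ y, N (c₁.2.2 s) (c₂.2.2 t) y * a' (q, s, c₁.center s, c₁.2.2 s, c₂.center t, y.1) +
        ∑ s', if s' = s then 0 else ∑ m, ∑ y, N (c₁.2.2 s) (c₂.2.2 t) y *
          a (q, s', c₁.center s', c₁.2.2 s', c₂.2.1 m, y.1)) ≤
    ∑ w₁, L.pW₁ q w₁ * ∑ x₁, L.pX₁ s w₁ q x₁ * ∑ w₂, L.pW₂ q w₂ * ∑ x₂, L.pX₂ t w₂ q x₂ *
      ∑ y, N x₁ x₂ y * (a' (q, s, w₁, x₁, w₂, y.1) +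
        ∑ s', L.falseAccept M₁ M₂ a s' q w₁ w₂ y.1) := by
  have h1 := fun s w q => (L.pX₁_mem s w q).1
  have h2 := fun q => (L.pW₁_mem q).1
  have h3 := fun q => (L.pW₂_mem q).1
  have h4 := fun s w q => (L.pX₂_mem s w q).1
  have hA : ∑ c₁ : Book S W₁ X₁ M₁, L.bookWeight₁ q c₁ * ∑ c₂ : Book T W₂ X₂ M₂,
      L.bookWeight₂ q c₂ * ∑ y, N (c₁.2.2 s) (c₂.2.2 t) y *
        a' (q, s, c₁.center s, c₁.2.2 s, c₂.center t, y.1) =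
      ∑ w₁, L.pW₁ q w₁ * ∑ x₁, L.pX₁ s w₁ q x₁ * ∑ w₂, L.pW₂ q w₂ * ∑ x₂, L.pX₂ t w₂ q x₂ *
        ∑ y, N x₁ x₂ y * a' (q, s, w₁, x₁, w₂, y.1) := by
    have := fun c₁ : Book S W₁ X₁ M₁ => Book.sum_weight_mul hM₂ (L.pW₂_mem q)
      (fun t w => L.pX₂_mem t w q) t (fun w x => ∑ y, N (c₁.2.2 s) x y *
        a' (q, s, c₁.center s, c₁.2.2 s, w, y.1))
    unfold SourceLaw.bookWeight₂
    simp only [this]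
    exact Book.sum_weight_mul hM₁ (L.pW₁_mem q) (fun s w => L.pX₁_mem s w q) s
      (fun w₁ x₁ => ∑ w₂, L.pW₂ q w₂ * ∑ x₂, L.pX₂ t w₂ q x₂ *
        ∑ y, N x₁ x₂ y * a' (q, s, w₁, x₁, w₂, y.1))
  have hB : ∀ s', ∑ c₁ : Book S W₁ X₁ M₁, L.bookWeight₁ q c₁ * ∑ c₂ : Book T W₂ X₂ M₂,
      L.bookWeight₂ q c₂ * (if s' = s then 0 else ∑ m, ∑ y, N (c₁.2.2 s) (c₂.2.2 t) y *
        a (q, s', c₁.center s', c₁.2.2 s', c₂.2.1 m, y.1)) ≤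
      ∑ w₁, L.pW₁ q w₁ * ∑ x₁, L.pX₁ s w₁ q x₁ * ∑ w₂, L.pW₂ q w₂ * ∑ x₂, L.pX₂ t w₂ q x₂ *
        ∑ y, N x₁ x₂ y * L.falseAccept M₁ M₂ a s' q w₁ w₂ y.1 := by
    intro s'
    -- The true word contributes nothing on the left, and its nonnegative bound may be added on the
    -- right. The later sum can thus run over all source words.
    by_cases h : s' = s
    · simp only [h, if_true, mul_zero, Finset.sum_const_zero]
      exact Finset.sum_nonneg fun w₁ _ => mul_nonneg (h2 _ _) <| Finset.sum_nonneg fun x₁ _ =>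
        mul_nonneg (h1 _ _ _ _) <| Finset.sum_nonneg fun w₂ _ => mul_nonneg (h3 _ _) <|
        Finset.sum_nonneg fun x₂ _ => mul_nonneg (h4 _ _ _ _) <| Finset.sum_nonneg fun y _ =>
        mul_nonneg ((hN _ _).1 _) (L.falseAccept_nonneg M₁ M₂ ha _ _ _ _ _)
    · simp only [h, if_false]
      exact L.average_false_accept_le hN hM₁ hM₂ ha q (Ne.symm h) t
  have hBs := Finset.sum_le_sum fun s' (_ : s' ∈ Finset.univ) => hB s'
  have e1 : ∀ (f : Book T W₂ X₂ M₂ → S → ℝ),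
      ∑ c₂, L.bookWeight₂ q c₂ * ∑ s', f c₂ s' = ∑ s', ∑ c₂, L.bookWeight₂ q c₂ * f c₂ s' := by
    intro f
    simp only [Finset.mul_sum]
    exact Finset.sum_comm
  have e2 : ∀ (f : Book S W₁ X₁ M₁ → S → ℝ),
      ∑ c₁, L.bookWeight₁ q c₁ * ∑ s', f c₁ s' = ∑ s', ∑ c₁, L.bookWeight₁ q c₁ * f c₁ s' := by
    intro f
    simp only [Finset.mul_sum]
    exact Finset.sum_comm
  simp only [mul_add, Finset.sum_add_distrib, hA, e1, e2]
  refine add_le_add_right (hBs.trans (le_of_eq ?_)) _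
  simp only [Finset.mul_sum]
  rw [Finset.sum_comm]
  refine Finset.sum_congr rfl fun w₁ _ => ?_
  rw [Finset.sum_comm]
  refine Finset.sum_congr rfl fun x₁ _ => ?_
  rw [Finset.sum_comm]
  refine Finset.sum_congr rfl fun w₂ _ => ?_
  rw [Finset.sum_comm]
  refine Finset.sum_congr rfl fun x₂ _ => ?_
  rw [Finset.sum_comm]

omit [DecidableEq S] [DecidableEq T] in
lemma SourceLaw.sum_joint_mul (L : SourceLaw S T Q W₁ W₂ X₁ X₂) (p : S × T → ℝ)
    (N : X₁ → X₂ → Y₁ × Y₂ → ℝ) (g : S → Q → W₁ → X₁ → W₂ → Y₁ → ℝ) :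
    ∑ st : S × T, p st * ∑ q, L.pQ q * ∑ w₁, L.pW₁ q w₁ * ∑ x₁, L.pX₁ st.1 w₁ q x₁ *
      ∑ w₂, L.pW₂ q w₂ * ∑ x₂, L.pX₂ st.2 w₂ q x₂ * ∑ y, N x₁ x₂ y * g st.1 q w₁ x₁ w₂ y.1 =
    ∑ ω, L.joint p N ω * g ω.1 ω.2.2.1 ω.2.2.2.1 ω.2.2.2.2.2.1 ω.2.2.2.2.1
      ω.2.2.2.2.2.2.2.1 := by
  simp only [Fintype.sum_prod_type, Finset.mul_sum, SourceLaw.joint]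
  refine Finset.sum_congr rfl fun s _ => Finset.sum_congr rfl fun t _ =>
    Finset.sum_congr rfl fun q _ => Finset.sum_congr rfl fun w₁ _ => ?_
  rw [Finset.sum_comm]
  refine Finset.sum_congr rfl fun w₂ _ => Finset.sum_congr rfl fun x₁ _ =>
    Finset.sum_congr rfl fun x₂ _ => Finset.sum_congr rfl fun y₁ _ =>
    Finset.sum_congr rfl fun y₂ _ => by ring

omit [DecidableEq S] [DecidableEq T] in
-- One change of measure for each term of `SourceLaw.falseAccept`. The conditioning variables are
-- those that the wrong candidate shares with the truth: both centres, the own one, the foreign one,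
-- or neither, always with q and the output.
lemma SourceLaw.sum_joint_falseAccept_le (L : SourceLaw S T Q W₁ W₂ X₁ X₂) {p : S × T → ℝ}
    (hp : p ∈ stdSimplex ℝ (S × T)) {N : X₁ → X₂ → Y₁ × Y₂ → ℝ}
    (hN : ∀ x₁ x₂, N x₁ x₂ ∈ stdSimplex ℝ (Y₁ × Y₂)) (M₁ M₂ : ℕ)
    {a : Q × S × W₁ × X₁ × W₂ × Y₁ → ℝ} {βa βe βd βg : ℝ}
    (ha : ∀ q s w₁ x₁ w₂ y, law (L.joint p N) obsCenters (q, w₁, w₂, y) *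
      (L.pX₁ s w₁ q x₁ * a (q, s, w₁, x₁, w₂, y)) ≤
        βa * law (L.joint p N) obs (q, s, w₁, x₁, w₂, y))
    (he : ∀ q s w₁ x₁ w₂ y, law (L.joint p N) obsOwn (q, w₁, y) *
      (L.pX₁ s w₁ q x₁ * (L.pW₂ q w₂ * a (q, s, w₁, x₁, w₂, y))) ≤
        βe * law (L.joint p N) obs (q, s, w₁, x₁, w₂, y))
    (hd : ∀ q s w₁ x₁ w₂ y, law (L.joint p N) obsOther (q, w₂, y) *
      (L.pW₁ q w₁ * (L.pX₁ s w₁ q x₁ * a (q, s, w₁, x₁, w₂, y))) ≤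
        βd * law (L.joint p N) obs (q, s, w₁, x₁, w₂, y))
    (hg : ∀ q s w₁ x₁ w₂ y, law (L.joint p N) obsOut (q, y) *
      (L.pW₁ q w₁ * (L.pX₁ s w₁ q x₁ * (L.pW₂ q w₂ * a (q, s, w₁, x₁, w₂, y)))) ≤
        βg * law (L.joint p N) obs (q, s, w₁, x₁, w₂, y)) :
    ∑ ω, L.joint p N ω * ∑ s, L.falseAccept M₁ M₂ a s ω.2.2.1 ω.2.2.2.1 ω.2.2.2.2.1
      ω.2.2.2.2.2.2.2.1 ≤
      (M₁ : ℝ)⁻¹ * βa + (M₁ : ℝ)⁻¹ * M₂ * βe + βd + M₂ * βg := by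
  have hJ := L.sum_joint hp hN
  have ta := sum_mul_sum_law_le hJ obsCenters obs (Z := S × X₁)
    ⟨fun v => (v.1.1, v.2.1, v.1.2.1, v.2.2, v.1.2.2.1, v.1.2.2.2),
      fun u => ((u.1, u.2.2.1, u.2.2.2.2.1, u.2.2.2.2.2), u.2.1, u.2.2.2.1),
      fun _ => rfl, fun _ => rfl⟩
    (fun v z => L.pX₁ z.1 v.2.1 v.1 z.2 * a (v.1, z.1, v.2.1, z.2, v.2.2.1, v.2.2.2))
    (fun v z => ha v.1 z.1 v.2.1 z.2 v.2.2.1 v.2.2.2)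
  have te := sum_mul_sum_law_le hJ obsOwn obs (Z := S × X₁ × W₂)
    ⟨fun v => (v.1.1, v.2.1, v.1.2.1, v.2.2.1, v.2.2.2, v.1.2.2),
      fun u => ((u.1, u.2.2.1, u.2.2.2.2.2), u.2.1, u.2.2.2.1, u.2.2.2.2.1),
      fun _ => rfl, fun _ => rfl⟩
    (fun v z => L.pX₁ z.1 v.2.1 v.1 z.2.1 * (L.pW₂ v.1 z.2.2 *
      a (v.1, z.1, v.2.1, z.2.1, z.2.2, v.2.2)))
    (fun v z => he v.1 z.1 v.2.1 z.2.1 z.2.2 v.2.2)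
  have td := sum_mul_sum_law_le hJ obsOther obs (Z := S × W₁ × X₁)
    ⟨fun v => (v.1.1, v.2.1, v.2.2.1, v.2.2.2, v.1.2.1, v.1.2.2),
      fun u => ((u.1, u.2.2.2.2.1, u.2.2.2.2.2), u.2.1, u.2.2.1, u.2.2.2.1),
      fun _ => rfl, fun _ => rfl⟩
    (fun v z => L.pW₁ v.1 z.2.1 * (L.pX₁ z.1 z.2.1 v.1 z.2.2 *
      a (v.1, z.1, z.2.1, z.2.2, v.2.1, v.2.2)))
    (fun v z => hd v.1 z.1 z.2.1 z.2.2 v.2.1 v.2.2)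
  have tg := sum_mul_sum_law_le hJ obsOut obs (Z := S × W₁ × X₁ × W₂)
    ⟨fun v => (v.1.1, v.2.1, v.2.2.1, v.2.2.2.1, v.2.2.2.2, v.1.2),
      fun u => ((u.1, u.2.2.2.2.2), u.2.1, u.2.2.1, u.2.2.2.1, u.2.2.2.2.1),
      fun _ => rfl, fun _ => rfl⟩
    (fun v z => L.pW₁ v.1 z.2.1 * (L.pX₁ z.1 z.2.1 v.1 z.2.2.1 * (L.pW₂ v.1 z.2.2.2 *
      a (v.1, z.1, z.2.1, z.2.2.1, z.2.2.2, v.2))))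
    (fun v z => hg v.1 z.1 z.2.1 z.2.2.1 z.2.2.2 v.2)
  have hsplit : ∀ ω : S × T × Q × W₁ × W₂ × X₁ × X₂ × Y₁ × Y₂,
      L.joint p N ω * ∑ s, L.falseAccept M₁ M₂ a s ω.2.2.1 ω.2.2.2.1
        ω.2.2.2.2.1 ω.2.2.2.2.2.2.2.1 =
      (M₁ : ℝ)⁻¹ * (L.joint p N ω * ∑ z : S × X₁, L.pX₁ z.1 (obsCenters ω).2.1 (obsCenters ω).1 z.2 *
        a ((obsCenters ω).1, z.1, (obsCenters ω).2.1, z.2, (obsCenters ω).2.2.1,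
          (obsCenters ω).2.2.2)) +
      (M₁ : ℝ)⁻¹ * M₂ * (L.joint p N ω * ∑ z : S × X₁ × W₂,
        L.pX₁ z.1 (obsOwn ω).2.1 (obsOwn ω).1 z.2.1 *
        (L.pW₂ (obsOwn ω).1 z.2.2 *
        a ((obsOwn ω).1, z.1, (obsOwn ω).2.1, z.2.1, z.2.2, (obsOwn ω).2.2))) +
      (L.joint p N ω * ∑ z : S × W₁ × X₁, L.pW₁ (obsOther ω).1 z.2.1 *
        (L.pX₁ z.1 z.2.1 (obsOther ω).1 z.2.2 *
        a ((obsOther ω).1, z.1, z.2.1, z.2.2, (obsOther ω).2.1, (obsOther ω).2.2))) +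
      M₂ * (L.joint p N ω * ∑ z : S × W₁ × X₁ × W₂, L.pW₁ (obsOut ω).1 z.2.1 *
        (L.pX₁ z.1 z.2.1 (obsOut ω).1 z.2.2.1 *
        (L.pW₂ (obsOut ω).1 z.2.2.2 *
        a ((obsOut ω).1, z.1, z.2.1, z.2.2.1, z.2.2.2, (obsOut ω).2)))) := by
    intro ω
    rw [mul_left_comm ((M₁ : ℝ)⁻¹), mul_left_comm ((M₁ : ℝ)⁻¹ * M₂), mul_left_comm (M₂ : ℝ),
      ← mul_add, ← mul_add, ← mul_add]
    congr 1
    simp only [obsCenters, obsOwn, obsOther, obsOut, SourceLaw.falseAccept, Fintype.sum_prod_type,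
      Finset.mul_sum, ← Finset.sum_add_distrib]
    refine Finset.sum_congr rfl fun s _ => ?_
    simp only [mul_add, Finset.sum_add_distrib, Finset.mul_sum]
    rw [← add_assoc]
    refine congrArg₂ _ (congrArg₂ _ (congrArg₂ _ rfl ?_) rfl) ?_
    · exact Finset.sum_congr rfl fun _ _ => Finset.sum_congr rfl fun _ _ => by ring
    · exact Finset.sum_congr rfl fun _ _ => Finset.sum_congr rfl fun _ _ =>
        Finset.sum_congr rfl fun _ _ => by ring
  simp only [hsplit, Finset.sum_add_distrib]
  rw [← Finset.mul_sum, ← Finset.mul_sum, ← Finset.mul_sum]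
  gcongr

open Classical in
-- The first term is the probability that the true word is rejected, the bracket that of accepting a
-- wrong one. The four hypotheses on `A` are exactly the domination that the change of measure needs
-- on accepted candidates. Nothing is assumed to be a product, so the bound applies to blocks
-- regarded as single letters.
theorem SourceLaw.average_error_le [Nonempty S] (L : SourceLaw S T Q W₁ W₂ X₁ X₂) {p : S × T → ℝ}
    (hp : p ∈ stdSimplex ℝ (S × T)) {N : X₁ → X₂ → Y₁ × Y₂ → ℝ}
    (hN : ∀ x₁ x₂, N x₁ x₂ ∈ stdSimplex ℝ (Y₁ × Y₂)) {M₁ M₂ : ℕ} (hM₁ : M₁ ≠ 0) (hM₂ : M₂ ≠ 0)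
    (A : Set (Q × S × W₁ × X₁ × W₂ × Y₁)) {βa βe βd βg : ℝ}
    (hβa : 0 ≤ βa) (hβe : 0 ≤ βe) (hβd : 0 ≤ βd) (hβg : 0 ≤ βg)
    (ha : ∀ q s w₁ x₁ w₂ y, (q, s, w₁, x₁, w₂, y) ∈ A →
      law (L.joint p N) obsCenters (q, w₁, w₂, y) * L.pX₁ s w₁ q x₁ ≤
        βa * law (L.joint p N) obs (q, s, w₁, x₁, w₂, y))
    (he : ∀ q s w₁ x₁ w₂ y, (q, s, w₁, x₁, w₂, y) ∈ A →
      law (L.joint p N) obsOwn (q, w₁, y) * (L.pX₁ s w₁ q x₁ * L.pW₂ q w₂) ≤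
        βe * law (L.joint p N) obs (q, s, w₁, x₁, w₂, y))
    (hd : ∀ q s w₁ x₁ w₂ y, (q, s, w₁, x₁, w₂, y) ∈ A →
      law (L.joint p N) obsOther (q, w₂, y) * (L.pW₁ q w₁ * L.pX₁ s w₁ q x₁) ≤
        βd * law (L.joint p N) obs (q, s, w₁, x₁, w₂, y))
    (hg : ∀ q s w₁ x₁ w₂ y, (q, s, w₁, x₁, w₂, y) ∈ A →
      law (L.joint p N) obsOut (q, y) * (L.pW₁ q w₁ * (L.pX₁ s w₁ q x₁ * L.pW₂ q w₂)) ≤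
        βg * law (L.joint p N) obs (q, s, w₁, x₁, w₂, y)) :
    ∑ q, L.pQ q * ∑ c₁ : Book S W₁ X₁ M₁, L.bookWeight₁ q c₁ * ∑ c₂ : Book T W₂ X₂ M₂,
      L.bookWeight₂ q c₂ * wordErr p N c₁.2.2 c₂.2.2 (decode A q c₁ c₂) ≤
    ∑ ω, L.joint p N ω * (if obs ω ∈ A then 0 else 1) +
      ((M₁ : ℝ)⁻¹ * βa + (M₁ : ℝ)⁻¹ * M₂ * βe + βd + M₂ * βg) := by
  have hJ := L.joint_nonneg hp hN
  set a : Q × S × W₁ × X₁ × W₂ × Y₁ → ℝ := fun u => if u ∈ A then 1 else 0 with ha_def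
  set a' : Q × S × W₁ × X₁ × W₂ × Y₁ → ℝ := fun u => if u ∈ A then 0 else 1 with ha'_def
  have ha0 : ∀ u, 0 ≤ a u := fun u => by simp only [ha_def]; split_ifs <;> norm_num
  have hw₁ : ∀ q (c : Book S W₁ X₁ M₁), 0 ≤ L.bookWeight₁ q c := fun q c =>
    Book.weight_nonneg (L.pW₁_mem q) (fun s w => L.pX₁_mem s w q) c
  have hw₂ : ∀ q (c : Book T W₂ X₂ M₂), 0 ≤ L.bookWeight₂ q c := fun q c =>
    Book.weight_nonneg (L.pW₂_mem q) (fun s w => L.pX₂_mem s w q) c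
  have hmul : ∀ {l k r : ℝ} {u} {β : ℝ}, 0 ≤ β → 0 ≤ r → (u ∈ A → l * k ≤ β * r) →
      l * (k * a u) ≤ β * r := by
    intro l k r u β hβ hr h
    by_cases hu : u ∈ A
    · simpa [ha_def, hu] using h hu
    · simpa [ha_def, hu] using mul_nonneg hβ hr
  have hfalse := L.sum_joint_falseAccept_le hp hN M₁ M₂ (a := a) (βa := βa) (βe := βe) (βd := βd)
    (βg := βg) (fun q s w₁ x₁ w₂ y => hmul hβa (law_nonneg hJ _ _) (ha q s w₁ x₁ w₂ y))
    (fun q s w₁ x₁ w₂ y => by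
      simpa only [mul_assoc] using hmul hβe (law_nonneg hJ _ _) (he q s w₁ x₁ w₂ y))
    (fun q s w₁ x₁ w₂ y => by
      simpa only [mul_assoc] using hmul hβd (law_nonneg hJ _ _) (hd q s w₁ x₁ w₂ y))
    (fun q s w₁ x₁ w₂ y => by
      simpa only [mul_assoc] using hmul hβg (law_nonneg hJ _ _) (hg q s w₁ x₁ w₂ y))
  calc _ ≤ ∑ q, L.pQ q * ∑ c₁ : Book S W₁ X₁ M₁, L.bookWeight₁ q c₁ * ∑ c₂ : Book T W₂ X₂ M₂,
      L.bookWeight₂ q c₂ * ∑ st : S × T, p st * (∑ y, N (c₁.2.2 st.1) (c₂.2.2 st.2) y *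
          a' (q, st.1, c₁.center st.1, c₁.2.2 st.1, c₂.center st.2, y.1) +
        ∑ s', if s' = st.1 then 0 else ∑ m, ∑ y, N (c₁.2.2 st.1) (c₂.2.2 st.2) y *
          a (q, s', c₁.center s', c₁.2.2 s', c₂.2.1 m, y.1)) :=
        Finset.sum_le_sum fun q _ => mul_le_mul_of_nonneg_left (Finset.sum_le_sum fun c₁ _ =>
          mul_le_mul_of_nonneg_left (Finset.sum_le_sum fun c₂ _ => mul_le_mul_of_nonneg_left
            (by
              refine (wordErr_decode_le hp.1 (fun x₁ x₂ => (hN x₁ x₂).1) A q c₁ c₂).trans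
                (le_of_eq (Finset.sum_congr rfl fun st _ => congrArg _ (congrArg _
                  (Finset.sum_congr rfl fun s' _ => ?_))))
              split_ifs <;> rfl) (hw₂ q c₂))
            (hw₁ q c₁)) (L.pQ_mem.1 q)
    _ = ∑ st : S × T, p st * ∑ q, L.pQ q * ∑ c₁ : Book S W₁ X₁ M₁, L.bookWeight₁ q c₁ *
        ∑ c₂ : Book T W₂ X₂ M₂, L.bookWeight₂ q c₂ *
        (∑ y, N (c₁.2.2 st.1) (c₂.2.2 st.2) y *
          a' (q, st.1, c₁.center st.1, c₁.2.2 st.1, c₂.center st.2, y.1) +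
        ∑ s', if s' = st.1 then 0 else ∑ m, ∑ y, N (c₁.2.2 st.1) (c₂.2.2 st.2) y *
          a (q, s', c₁.center s', c₁.2.2 s', c₂.2.1 m, y.1)) := by
        have e1 : ∀ q (f : Book T W₂ X₂ M₂ → S × T → ℝ),
          ∑ c₂, L.bookWeight₂ q c₂ * ∑ st, p st * f c₂ st =
            ∑ st, p st * ∑ c₂, L.bookWeight₂ q c₂ * f c₂ st := fun _ _ => sum_mul_sum_comm _ _ _
        have e2 : ∀ q (f : Book S W₁ X₁ M₁ → S × T → ℝ),
          ∑ c₁, L.bookWeight₁ q c₁ * ∑ st, p st * f c₁ st =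
            ∑ st, p st * ∑ c₁, L.bookWeight₁ q c₁ * f c₁ st := fun _ _ => sum_mul_sum_comm _ _ _
        simp only [e1, e2]
        exact sum_mul_sum_comm _ _ _
    _ ≤ ∑ st : S × T, p st * ∑ q, L.pQ q * ∑ w₁, L.pW₁ q w₁ * ∑ x₁, L.pX₁ st.1 w₁ q x₁ *
        ∑ w₂, L.pW₂ q w₂ * ∑ x₂, L.pX₂ st.2 w₂ q x₂ *
        ∑ y, N x₁ x₂ y * (a' (q, st.1, w₁, x₁, w₂, y.1) +
          ∑ s', L.falseAccept M₁ M₂ a s' q w₁ w₂ y.1) :=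
        Finset.sum_le_sum fun st _ => mul_le_mul_of_nonneg_left (Finset.sum_le_sum fun q _ =>
          mul_le_mul_of_nonneg_left (L.average_given_source_le hN hM₁ hM₂ ha0 q st.1 st.2)
            (L.pQ_mem.1 q)) (hp.1 st)
    _ = ∑ ω, L.joint p N ω * a' (obs ω) + ∑ ω, L.joint p N ω * ∑ s', L.falseAccept M₁ M₂ a s'
          ω.2.2.1 ω.2.2.2.1 ω.2.2.2.2.1 ω.2.2.2.2.2.2.2.1 := by
        rw [L.sum_joint_mul p N (fun s q w₁ x₁ w₂ y => a' (q, s, w₁, x₁, w₂, y) +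
          ∑ s', L.falseAccept M₁ M₂ a s' q w₁ w₂ y), ← Finset.sum_add_distrib]
        exact Finset.sum_congr rfl fun ω _ => mul_add _ _ _
    _ ≤ _ := add_le_add_right hfalse _

end OneShot

/-! ### Product laws and Chebyshev's inequality. -/

section ProductLaws

variable {Ω α κ : Type*} [Fintype Ω] [Fintype κ]

lemma exists_le_of_sum_mul_le {ι : Type*} [Fintype ι] {w f : ι → ℝ} {δ : ℝ} (hw : ∀ i, 0 ≤ w i)
    (hsum : ∑ i, w i = 1) (h : ∑ i, w i * f i ≤ δ) : ∃ i, f i ≤ δ := by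
  by_contra! hc
  have h0 : ∑ i, w i * (f i - δ) ≤ 0 := by
    simp only [mul_sub, Finset.sum_sub_distrib, ← Finset.sum_mul, hsum]
    linarith
  have h1 : ∀ i ∈ Finset.univ, 0 ≤ w i * (f i - δ) := fun i _ =>
    mul_nonneg (hw i) (by linarith [hc i])
  have h2 := (Finset.sum_eq_zero_iff_of_nonneg h1).1 (le_antisymm h0 (Finset.sum_nonneg h1))
  have h3 : ∀ i, w i = 0 := fun i =>
    (mul_eq_zero.1 (h2 i (Finset.mem_univ i))).resolve_right (by linarith [hc i])
  simp [h3] at hsum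

lemma prod_mem_stdSimplex {n : ℕ} {k : Fin n → κ → ℝ} (hk : ∀ i, k i ∈ stdSimplex ℝ κ) :
    (fun f : Fin n → κ => ∏ i, k i (f i)) ∈ stdSimplex ℝ (Fin n → κ) :=
  ⟨fun _ => Finset.prod_nonneg fun i _ => (hk i).1 _, sum_prod_pi k fun i => (hk i).2⟩

open Classical in
lemma sum_ite_prod_eq_prod_law {n : ℕ} (P : Ω → ℝ) (A : Ω → α) (a : Fin n → α) :
    ∑ ω : Fin n → Ω, (if ∀ i, A (ω i) = a i then ∏ i, P (ω i) else 0) = ∏ i, law P A (a i) := by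
  simp only [law]
  rw [Finset.prod_univ_sum, Fintype.piFinset_univ]
  refine Finset.sum_congr rfl fun ω _ => ?_
  split_ifs with h
  · simp [h]
  · push Not at h
    obtain ⟨i, hi⟩ := h
    exact (Finset.prod_eq_zero (Finset.mem_univ i) (by simp [hi])).symm

/-- Variance of an i.i.d. sum: the cross terms vanish by independence and centring. -/
lemma sum_prod_mul_sq_sum {P Z : Ω → ℝ} (hP : ∑ ω, P ω = 1) (hZ : ∑ ω, P ω * Z ω = 0) (n : ℕ) :
    ∑ ω : Fin n → Ω, (∏ i, P (ω i)) * (∑ i, Z (ω i)) ^ 2 = n * ∑ ω, P ω * Z ω ^ 2 := by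
  have h1 : ∀ ω : Fin n → Ω, (∏ i, P (ω i)) * (∑ i, Z (ω i)) ^ 2 =
      ∑ i, ∑ j, (∏ i, P (ω i)) * (Z (ω i) * Z (ω j)) := fun ω => by
    rw [sq, Finset.sum_mul_sum, Finset.mul_sum]
    simp only [Finset.mul_sum]
  simp only [h1]
  rw [Finset.sum_comm]
  have h2 : ∀ i : Fin n, ∑ ω : Fin n → Ω, ∑ j, (∏ i, P (ω i)) * (Z (ω i) * Z (ω j)) =
      ∑ ω, P ω * Z ω ^ 2 := by
    intro i
    rw [Finset.sum_comm, Finset.sum_eq_single i]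
    · rw [sum_pi_marginal (fun _ => P) (fun _ => hP) i (fun a => Z a * Z a)]
      simp only [sq]
    · intro j _ hj
      rw [sum_pi_marginal_pair (fun _ => P) (fun _ => hP) hj.symm (fun a b => Z a * Z b)]
      have : ∀ a, ∑ b, P a * P b * (Z a * Z b) = (P a * Z a) * ∑ b, P b * Z b := fun a => by
        rw [Finset.mul_sum]
        exact Finset.sum_congr rfl fun b _ => by ring
      simp [this, hZ]
    · simp
  simp [h2]

open Classical in
/-- Chebyshev's inequality for the log-ratio of two product functions. -/
lemma exists_tail_le {P : Ω → ℝ} (hP : P ∈ stdSimplex ℝ Ω) {u v : Ω → ℝ}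
    (hu : ∀ ω, 0 < P ω → 0 < u ω) (hv : ∀ ω, 0 < P ω → 0 < v ω) {μ δ : ℝ}
    (hμ : ∑ ω, P ω * Real.logb 2 (u ω / v ω) = μ) (hδ : 0 < δ) :
    ∃ K : ℝ, 0 ≤ K ∧ ∀ n : ℕ, 1 ≤ n → ∑ ω : Fin n → Ω, (∏ i, P (ω i)) *
      (if ∏ i, v (ω i) ≤ (2 : ℝ) ^ (-(n * (μ - δ))) * ∏ i, u (ω i) then 0 else 1) ≤ K / n := by
  set Z : Ω → ℝ := fun ω => Real.logb 2 (u ω / v ω) - μ with hZdef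
  have hZ : ∑ ω, P ω * Z ω = 0 := by
    simp only [hZdef, mul_sub, Finset.sum_sub_distrib, hμ, ← Finset.sum_mul, hP.2]
    ring
  have hV : 0 ≤ ∑ ω, P ω * Z ω ^ 2 :=
    Finset.sum_nonneg fun ω _ => mul_nonneg (hP.1 ω) (sq_nonneg _)
  refine ⟨(∑ ω, P ω * Z ω ^ 2) / δ ^ 2, by positivity, fun n hn => ?_⟩
  have hn0 : (0 : ℝ) < n := by exact_mod_cast hn
  have hpt : ∀ ω : Fin n → Ω, (∏ i, P (ω i)) *
      (if ∏ i, v (ω i) ≤ (2 : ℝ) ^ (-(n * (μ - δ))) * ∏ i, u (ω i) then 0 else 1) ≤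
      (∏ i, P (ω i)) * (∑ i, Z (ω i)) ^ 2 * (1 / (n * δ) ^ 2) := by
    intro ω
    have hnn : 0 ≤ ∏ i, P (ω i) := Finset.prod_nonneg fun i _ => hP.1 _
    rcases hnn.eq_or_lt with h0 | h0
    · simp [← h0]
    split_ifs with hc
    · rw [mul_zero]; positivity
    rw [mul_assoc]
    refine mul_le_mul_of_nonneg_left ?_ hnn
    have hpos : ∀ i, 0 < P (ω i) := fun i => (hP.1 _).lt_of_ne fun h =>
      h0.ne' (Finset.prod_eq_zero (Finset.mem_univ i) h.symm)
    have hu' : ∀ i, 0 < u (ω i) := fun i => hu _ (hpos i)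
    have hv' : ∀ i, 0 < v (ω i) := fun i => hv _ (hpos i)
    have hU : 0 < ∏ i, u (ω i) := Finset.prod_pos fun i _ => hu' i
    have hlt : (2 : ℝ) ^ (-(n * (μ - δ))) * ∏ i, u (ω i) < ∏ i, v (ω i) := not_le.1 hc
    have hlog := Real.logb_lt_logb (b := 2) (by norm_num)
      (mul_pos (Real.rpow_pos_of_pos two_pos _) hU) hlt
    rw [Real.logb_mul (Real.rpow_pos_of_pos two_pos _).ne' hU.ne',
      Real.logb_rpow two_pos (by norm_num), Real.logb_prod _ _ (fun i _ => (hu' i).ne'),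
      Real.logb_prod _ _ (fun i _ => (hv' i).ne')] at hlog
    have hsum : ∑ i, Z (ω i) = ∑ i, Real.logb 2 (u (ω i)) - ∑ i, Real.logb 2 (v (ω i)) - n * μ := by
      simp only [hZdef, Finset.sum_sub_distrib, Finset.sum_const, Finset.card_univ,
        Fintype.card_fin, nsmul_eq_mul]
      rw [← Finset.sum_sub_distrib]
      congr 1
      exact Finset.sum_congr rfl fun i _ => Real.logb_div (hu' i).ne' (hv' i).ne'
    -- A failed test means that the centred log-ratio sum lies more than nδ below its mean, so its
    -- square is at least (nδ)².
    have hdev : n * δ ≤ -∑ i, Z (ω i) := by rw [hsum]; nlinarith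
    rw [mul_one_div, one_le_div (by positivity)]
    have := pow_le_pow_left₀ (by positivity) hdev 2
    simpa using this
  refine (Finset.sum_le_sum fun ω _ => hpt ω).trans (le_of_eq ?_)
  rw [← Finset.sum_mul, sum_prod_mul_sq_sum hP.2 hZ]
  field_simp

end ProductLaws

/-! ### Memoryless extensions and acceptance of the true word. -/

section Blocks

variable {S T Q W₁ W₂ X₁ X₂ Y₁ Y₂ : Type*} [Fintype S] [Fintype T] [Fintype Q] [Fintype W₁]
  [Fintype W₂] [Fintype X₁] [Fintype X₂] [Fintype Y₁] [Fintype Y₂]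

/-- The memoryless extension of a source. -/
def blockSource (p : S × T → ℝ) (n : ℕ) : (Fin n → S) × (Fin n → T) → ℝ :=
  fun st => ∏ i, p (st.1 i, st.2 i)

/-- The memoryless extension of a channel. -/
def blockChannel (N : X₁ → X₂ → Y₁ × Y₂ → ℝ) (n : ℕ) :
    (Fin n → X₁) → (Fin n → X₂) → (Fin n → Y₁) × (Fin n → Y₂) → ℝ :=
  fun x₁ x₂ y => ∏ i, N (x₁ i) (x₂ i) (y.1 i, y.2 i)

lemma prod_pair_mem_stdSimplex {α β : Type*} [Fintype α] [Fintype β] {n : ℕ}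
    {k : Fin n → α × β → ℝ} (hk : ∀ i, k i ∈ stdSimplex ℝ (α × β)) :
    (fun f : (Fin n → α) × (Fin n → β) => ∏ i, k i (f.1 i, f.2 i)) ∈
      stdSimplex ℝ ((Fin n → α) × (Fin n → β)) := by
  refine ⟨fun _ => Finset.prod_nonneg fun i _ => (hk i).1 _, ?_⟩
  rw [← (prod_mem_stdSimplex hk).2]
  exact Fintype.sum_equiv (Equiv.arrowProdEquivProdArrow (Fin n) (fun _ => α) (fun _ => β)).symm
    _ _ (fun _ => rfl)

lemma blockSource_mem {p : S × T → ℝ} (hp : p ∈ stdSimplex ℝ (S × T)) (n : ℕ) :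
    blockSource p n ∈ stdSimplex ℝ ((Fin n → S) × (Fin n → T)) :=
  prod_pair_mem_stdSimplex fun _ => hp

lemma blockChannel_mem {N : X₁ → X₂ → Y₁ × Y₂ → ℝ}
    (hN : ∀ x₁ x₂, N x₁ x₂ ∈ stdSimplex ℝ (Y₁ × Y₂)) (n : ℕ) (x₁ : Fin n → X₁) (x₂ : Fin n → X₂) :
    blockChannel N n x₁ x₂ ∈ stdSimplex ℝ ((Fin n → Y₁) × (Fin n → Y₂)) :=
  prod_pair_mem_stdSimplex fun i => hN (x₁ i) (x₂ i)

/-- The memoryless extension of the auxiliary kernels. -/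
def SourceLaw.block (L : SourceLaw S T Q W₁ W₂ X₁ X₂) (n : ℕ) :
    SourceLaw (Fin n → S) (Fin n → T) (Fin n → Q) (Fin n → W₁) (Fin n → W₂) (Fin n → X₁)
      (Fin n → X₂) where
  pQ := fun q => ∏ i, L.pQ (q i)
  pW₁ := fun q w => ∏ i, L.pW₁ (q i) (w i)
  pW₂ := fun q w => ∏ i, L.pW₂ (q i) (w i)
  pX₁ := fun s w q x => ∏ i, L.pX₁ (s i) (w i) (q i) (x i)
  pX₂ := fun t w q x => ∏ i, L.pX₂ (t i) (w i) (q i) (x i)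
  pQ_mem := prod_mem_stdSimplex fun _ => L.pQ_mem
  pW₁_mem := fun q => prod_mem_stdSimplex fun i => L.pW₁_mem (q i)
  pW₂_mem := fun q => prod_mem_stdSimplex fun i => L.pW₂_mem (q i)
  pX₁_mem := fun s w q => prod_mem_stdSimplex fun i => L.pX₁_mem (s i) (w i) (q i)
  pX₂_mem := fun t w q => prod_mem_stdSimplex fun i => L.pX₂_mem (t i) (w i) (q i)

/-- Sequences of samples are samples of sequences. -/
def blockEquiv (S T Q W₁ W₂ X₁ X₂ Y₁ Y₂ : Type*) (n : ℕ) :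
    (Fin n → S × T × Q × W₁ × W₂ × X₁ × X₂ × Y₁ × Y₂) ≃
      (Fin n → S) × (Fin n → T) × (Fin n → Q) × (Fin n → W₁) × (Fin n → W₂) × (Fin n → X₁) ×
        (Fin n → X₂) × (Fin n → Y₁) × (Fin n → Y₂) where
  toFun ω := (fun i => (ω i).1, fun i => (ω i).2.1, fun i => (ω i).2.2.1,
    fun i => (ω i).2.2.2.1, fun i => (ω i).2.2.2.2.1, fun i => (ω i).2.2.2.2.2.1,
    fun i => (ω i).2.2.2.2.2.2.1, fun i => (ω i).2.2.2.2.2.2.2.1,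
    fun i => (ω i).2.2.2.2.2.2.2.2)
  invFun x i := (x.1 i, x.2.1 i, x.2.2.1 i, x.2.2.2.1 i, x.2.2.2.2.1 i, x.2.2.2.2.2.1 i,
    x.2.2.2.2.2.2.1 i, x.2.2.2.2.2.2.2.1 i, x.2.2.2.2.2.2.2.2 i)
  left_inv _ := rfl
  right_inv _ := rfl

lemma SourceLaw.block_joint (L : SourceLaw S T Q W₁ W₂ X₁ X₂) (p : S × T → ℝ)
    (N : X₁ → X₂ → Y₁ × Y₂ → ℝ) (n : ℕ) (ω : Fin n → S × T × Q × W₁ × W₂ × X₁ × X₂ × Y₁ × Y₂) :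
    (L.block n).joint (blockSource p n) (blockChannel N n) (blockEquiv S T Q W₁ W₂ X₁ X₂ Y₁ Y₂ n ω)
      = ∏ i, L.joint p N (ω i) := by
  simp only [SourceLaw.joint, blockEquiv, SourceLaw.block, blockSource, blockChannel,
    Finset.prod_mul_distrib, Equiv.coe_fn_mk]

/-- The block joint law is a product over letters, hence so is the law of any variable that is
formed letter by letter. -/
lemma SourceLaw.law_block {αn α : Type*} (L : SourceLaw S T Q W₁ W₂ X₁ X₂) (p : S × T → ℝ)
    (N : X₁ → X₂ → Y₁ × Y₂ → ℝ) {n : ℕ} (An : (Fin n → S) × (Fin n → T) × (Fin n → Q) ×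
      (Fin n → W₁) × (Fin n → W₂) × (Fin n → X₁) × (Fin n → X₂) × (Fin n → Y₁) × (Fin n → Y₂) → αn)
    (A : S × T × Q × W₁ × W₂ × X₁ × X₂ × Y₁ × Y₂ → α) (an : αn) (a : Fin n → α)
    (h : ∀ ω, An (blockEquiv S T Q W₁ W₂ X₁ X₂ Y₁ Y₂ n ω) = an ↔ ∀ i, A (ω i) = a i) :
    law ((L.block n).joint (blockSource p n) (blockChannel N n)) An an =
      ∏ i, law (L.joint p N) A (a i) := by
  classical
  rw [← sum_ite_prod_eq_prod_law, law,
    ← (blockEquiv S T Q W₁ W₂ X₁ X₂ Y₁ Y₂ n).sum_comp]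
  simp only [h, L.block_joint]

/-- The letterwise likelihoods of a wrong source word, relative to which the decoder tests: the
arguments are the observed variables and the kernels of the variables that are drawn afresh. -/
noncomputable def SourceLaw.fresh {α : Type*} (L : SourceLaw S T Q W₁ W₂ X₁ X₂) (p : S × T → ℝ)
    (N : X₁ → X₂ → Y₁ × Y₂ → ℝ) (C : S × T × Q × W₁ × W₂ × X₁ × X₂ × Y₁ × Y₂ → α)
    (r : S × T × Q × W₁ × W₂ × X₁ × X₂ × Y₁ × Y₂ → ℝ)
    (ω : S × T × Q × W₁ × W₂ × X₁ × X₂ × Y₁ × Y₂) : ℝ := law (L.joint p N) C (C ω) * r ω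

/-- `E log₂ (p(true) / p(fresh))` -/
noncomputable def SourceLaw.rate {α : Type*} (L : SourceLaw S T Q W₁ W₂ X₁ X₂) (p : S × T → ℝ)
    (N : X₁ → X₂ → Y₁ × Y₂ → ℝ) (C : S × T × Q × W₁ × W₂ × X₁ × X₂ × Y₁ × Y₂ → α)
    (r : S × T × Q × W₁ × W₂ × X₁ × X₂ × Y₁ × Y₂ → ℝ) : ℝ :=
  ∑ ω, L.joint p N ω * Real.logb 2 (law (L.joint p N) obs (obs ω) / L.fresh p N C r ω)

/-- `p(x₁|s w₁ q)` at a sample point. -/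
def SourceLaw.kX₁ (L : SourceLaw S T Q W₁ W₂ X₁ X₂)
    (ω : S × T × Q × W₁ × W₂ × X₁ × X₂ × Y₁ × Y₂) : ℝ := L.pX₁ ω.1 ω.2.2.2.1 ω.2.2.1 ω.2.2.2.2.2.1

/-- `p(w₁|q)` at a sample point. -/
def SourceLaw.kW₁ (L : SourceLaw S T Q W₁ W₂ X₁ X₂)
    (ω : S × T × Q × W₁ × W₂ × X₁ × X₂ × Y₁ × Y₂) : ℝ := L.pW₁ ω.2.2.1 ω.2.2.2.1

/-- `p(w₂|q)` at a sample point. -/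
def SourceLaw.kW₂ (L : SourceLaw S T Q W₁ W₂ X₁ X₂)
    (ω : S × T × Q × W₁ × W₂ × X₁ × X₂ × Y₁ × Y₂) : ℝ := L.pW₂ ω.2.2.1 ω.2.2.2.2.1

lemma SourceLaw.pos_of_joint_pos (L : SourceLaw S T Q W₁ W₂ X₁ X₂) {p : S × T → ℝ}
    (hp : p ∈ stdSimplex ℝ (S × T)) {N : X₁ → X₂ → Y₁ × Y₂ → ℝ}
    {ω : S × T × Q × W₁ × W₂ × X₁ × X₂ × Y₁ × Y₂} (h : 0 < L.joint p N ω) :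
    0 < p (ω.1, ω.2.1) ∧ 0 < L.pQ ω.2.2.1 ∧ 0 < L.kW₁ ω ∧ 0 < L.kW₂ ω ∧ 0 < L.kX₁ ω := by
  obtain ⟨s, t, q, w₁, w₂, x₁, x₂, y₁, y₂⟩ := ω
  have h' : p (s, t) * L.pQ q * L.pW₁ q w₁ * L.pW₂ q w₂ * L.pX₁ s w₁ q x₁ * L.pX₂ t w₂ q x₂ *
      N x₁ x₂ (y₁, y₂) ≠ 0 := h.ne'
  simp only [ne_eq, mul_eq_zero, not_or] at h'
  obtain ⟨⟨⟨⟨⟨⟨h1, h2⟩, h3⟩, h4⟩, h5⟩, _⟩, _⟩ := h'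
  exact ⟨(hp.1 _).lt_of_ne' h1, (L.pQ_mem.1 _).lt_of_ne' h2, ((L.pW₁_mem _).1 _).lt_of_ne' h3,
    ((L.pW₂_mem _).1 _).lt_of_ne' h4, ((L.pX₁_mem _ _ _).1 _).lt_of_ne' h5⟩

/-- The words that the first decoder accepts, for given bounds on the likelihood ratios. -/
def SourceLaw.accept (L : SourceLaw S T Q W₁ W₂ X₁ X₂) (p : S × T → ℝ)
    (N : X₁ → X₂ → Y₁ × Y₂ → ℝ) (βa βe βd βg : ℝ) : Set (Q × S × W₁ × X₁ × W₂ × Y₁) :=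
  {u | law (L.joint p N) obsCenters (u.1, u.2.2.1, u.2.2.2.2.1, u.2.2.2.2.2) *
      L.pX₁ u.2.1 u.2.2.1 u.1 u.2.2.2.1 ≤ βa * law (L.joint p N) obs u ∧
    law (L.joint p N) obsOwn (u.1, u.2.2.1, u.2.2.2.2.2) *
      (L.pX₁ u.2.1 u.2.2.1 u.1 u.2.2.2.1 * L.pW₂ u.1 u.2.2.2.2.1) ≤
        βe * law (L.joint p N) obs u ∧
    law (L.joint p N) obsOther (u.1, u.2.2.2.2.1, u.2.2.2.2.2) *
      (L.pW₁ u.1 u.2.2.1 * L.pX₁ u.2.1 u.2.2.1 u.1 u.2.2.2.1) ≤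
        βd * law (L.joint p N) obs u ∧
    law (L.joint p N) obsOut (u.1, u.2.2.2.2.2) *
      (L.pW₁ u.1 u.2.2.1 * (L.pX₁ u.2.1 u.2.2.1 u.1 u.2.2.2.1 * L.pW₂ u.1 u.2.2.2.2.1)) ≤
        βg * law (L.joint p N) obs u}

open Classical in
-- On blocks each of the four tests compares products of letterwise likelihoods. Chebyshev's
-- inequality bounds the failure of each, and the constants add up by the union bound.
lemma SourceLaw.exists_block_tail_le (L : SourceLaw S T Q W₁ W₂ X₁ X₂) {p : S × T → ℝ}
    (hp : p ∈ stdSimplex ℝ (S × T)) {N : X₁ → X₂ → Y₁ × Y₂ → ℝ}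
    (hN : ∀ x₁ x₂, N x₁ x₂ ∈ stdSimplex ℝ (Y₁ × Y₂)) {δ : ℝ} (hδ : 0 < δ) :
    ∃ K : ℝ, 0 ≤ K ∧ ∀ n : ℕ, 1 ≤ n →
      ∑ ω, (L.block n).joint (blockSource p n) (blockChannel N n) ω *
        (if obs ω ∈ (L.block n).accept (blockSource p n) (blockChannel N n)
          ((2 : ℝ) ^ (-(n * (L.rate p N obsCenters L.kX₁ - δ))))
          ((2 : ℝ) ^ (-(n * (L.rate p N obsOwn (fun ω => L.kX₁ ω * L.kW₂ ω) - δ))))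
          ((2 : ℝ) ^ (-(n * (L.rate p N obsOther (fun ω => L.kW₁ ω * L.kX₁ ω) - δ))))
          ((2 : ℝ) ^ (-(n * (L.rate p N obsOut (fun ω => L.kW₁ ω * (L.kX₁ ω * L.kW₂ ω)) - δ))))
        then 0 else 1) ≤ K / n := by
  have hJ0 := L.joint_nonneg hp hN
  have hJ : L.joint p N ∈ stdSimplex ℝ _ := ⟨hJ0, L.sum_joint hp hN⟩
  have hpos := fun ω h => L.pos_of_joint_pos hp (N := N) (ω := ω) h
  have hu : ∀ ω, 0 < L.joint p N ω → 0 < law (L.joint p N) obs (obs ω) := fun ω h =>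
    h.trans_le (le_law hJ0 obs ω)
  obtain ⟨Ka, hKa, ha⟩ := exists_tail_le hJ hu (v := L.fresh p N obsCenters L.kX₁)
    (fun ω h => mul_pos (h.trans_le (le_law hJ0 _ ω)) (hpos ω h).2.2.2.2) rfl hδ
  obtain ⟨Ke, hKe, he⟩ := exists_tail_le hJ hu (v := L.fresh p N obsOwn fun ω => L.kX₁ ω * L.kW₂ ω)
    (fun ω h => mul_pos (h.trans_le (le_law hJ0 _ ω))
      (mul_pos (hpos ω h).2.2.2.2 (hpos ω h).2.2.2.1)) rfl hδ
  obtain ⟨Kd, hKd, hd⟩ := exists_tail_le hJ hu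
    (v := L.fresh p N obsOther fun ω => L.kW₁ ω * L.kX₁ ω)
    (fun ω h => mul_pos (h.trans_le (le_law hJ0 _ ω))
      (mul_pos (hpos ω h).2.2.1 (hpos ω h).2.2.2.2)) rfl hδ
  obtain ⟨Kg, hKg, hg⟩ := exists_tail_le hJ hu
    (v := L.fresh p N obsOut fun ω => L.kW₁ ω * (L.kX₁ ω * L.kW₂ ω))
    (fun ω h => mul_pos (h.trans_le (le_law hJ0 _ ω))
      (mul_pos (hpos ω h).2.2.1 (mul_pos (hpos ω h).2.2.2.2 (hpos ω h).2.2.2.1))) rfl hδ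
  refine ⟨Ka + Ke + Kd + Kg, by positivity, fun n hn => ?_⟩
  rw [← (blockEquiv S T Q W₁ W₂ X₁ X₂ Y₁ Y₂ n).sum_comp]
  rw [add_div, add_div, add_div]
  refine le_trans ?_ (add_le_add (add_le_add (add_le_add (ha n hn) (he n hn)) (hd n hn)) (hg n hn))
  rw [← Finset.sum_add_distrib, ← Finset.sum_add_distrib, ← Finset.sum_add_distrib]
  refine Finset.sum_le_sum fun ω _ => ?_
  rw [L.block_joint, ← mul_add, ← mul_add, ← mul_add]
  refine mul_le_mul_of_nonneg_left ?_ (Finset.prod_nonneg fun i _ => hJ0 _)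
  have law1 := L.law_block p N (n := n) obs obs (obs (blockEquiv S T Q W₁ W₂ X₁ X₂ Y₁ Y₂ n ω))
    (fun i => obs (ω i)) (fun ω' => by
      simp only [obs, blockEquiv, Equiv.coe_fn_mk, Prod.mk.injEq, funext_iff, forall_and])
  have law2 := L.law_block p N (n := n) obsCenters obsCenters
    (obsCenters (blockEquiv S T Q W₁ W₂ X₁ X₂ Y₁ Y₂ n ω))
    (fun i => obsCenters (ω i)) (fun ω' => by
      simp only [obsCenters, blockEquiv, Equiv.coe_fn_mk, Prod.mk.injEq, funext_iff, forall_and])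
  have law3 := L.law_block p N (n := n) obsOwn obsOwn
    (obsOwn (blockEquiv S T Q W₁ W₂ X₁ X₂ Y₁ Y₂ n ω))
    (fun i => obsOwn (ω i)) (fun ω' => by
      simp only [obsOwn, blockEquiv, Equiv.coe_fn_mk, Prod.mk.injEq, funext_iff, forall_and])
  have law4 := L.law_block p N (n := n) obsOther obsOther
    (obsOther (blockEquiv S T Q W₁ W₂ X₁ X₂ Y₁ Y₂ n ω))
    (fun i => obsOther (ω i)) (fun ω' => by
      simp only [obsOther, blockEquiv, Equiv.coe_fn_mk, Prod.mk.injEq, funext_iff, forall_and])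
  have law5 := L.law_block p N (n := n) obsOut obsOut
    (obsOut (blockEquiv S T Q W₁ W₂ X₁ X₂ Y₁ Y₂ n ω))
    (fun i => obsOut (ω i)) (fun ω' => by
      simp only [obsOut, blockEquiv, Equiv.coe_fn_mk, Prod.mk.injEq, funext_iff, forall_and])
  simp only [SourceLaw.fresh, Finset.prod_mul_distrib]
  rw [← law1, ← law2, ← law3, ← law4, ← law5]
  split_ifs with h0 h1 h2 h3 h4 h4 h3 h4 h4 h2 h3 h4 h4 h3 h4 h4 h1 h2 h3 h4 h4 h3 h4 h4 h2 h3 h4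
    h4 h3 h4 h4
  all_goals norm_num
  -- The only case left by arithmetic: all four tests pass although the word is rejected.
  exact absurd ⟨by assumption, by assumption, by assumption, by assumption⟩ h0

end Blocks

/-! ### Invariance of conditional mutual information under relabelling. -/

section Congruence

variable {Ω Ω' α α' β β' γ γ' : Type*} [Fintype Ω] [Fintype Ω'] [Fintype α] [Fintype α']
  [Fintype β] [Fintype β'] [Fintype γ] [Fintype γ']

lemma condMI_congr (P : Ω → ℝ) {A : Ω → α} {A' : Ω → α'} {B : Ω → β} {B' : Ω → β'} {C : Ω → γ}
    {C' : Ω → γ'} (hA : ∀ ω ω', A ω' = A ω ↔ A' ω' = A' ω) (hB : ∀ ω ω', B ω' = B ω ↔ B' ω' = B' ω)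
    (hC : ∀ ω ω', C ω' = C ω ↔ C' ω' = C' ω) : condMI P A B C = condMI P A' B' C' := by
  have h1 : rvEntropy P (A &ᵣ C) = rvEntropy P (A' &ᵣ C') :=
    rvEntropy_congr P fun ω ω' => by simp only [join, Prod.mk.injEq, hA ω ω', hC ω ω']
  have h2 : rvEntropy P (B &ᵣ C) = rvEntropy P (B' &ᵣ C') :=
    rvEntropy_congr P fun ω ω' => by simp only [join, Prod.mk.injEq, hB ω ω', hC ω ω']
  have h3 : rvEntropy P (A &ᵣ B &ᵣ C) = rvEntropy P (A' &ᵣ B' &ᵣ C') :=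
    rvEntropy_congr P fun ω ω' => by
      simp only [join, Prod.mk.injEq, hA ω ω', hB ω ω', hC ω ω']
  rw [condMI_eq, condMI_eq, h1, h2, h3, rvEntropy_congr P hC]

lemma condMI_comp_equiv (e : Ω' ≃ Ω) (P : Ω → ℝ) (A : Ω → α) (B : Ω → β) (C : Ω → γ) :
    condMI (fun ω => P (e ω)) (fun ω => A (e ω)) (fun ω => B (e ω)) (fun ω => C (e ω)) =
      condMI P A B C := by
  rw [condMI_eq, condMI_eq, ← rvEntropy_comp_equiv e P (A &ᵣ C), ← rvEntropy_comp_equiv e P C,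
    ← rvEntropy_comp_equiv e P (A &ᵣ B &ᵣ C), ← rvEntropy_comp_equiv e P (B &ᵣ C)]
  rfl

lemma law_eq_sum_of_equiv (e : Ω ≃ α × β) (P : Ω → ℝ) (A : Ω → α) (h : ∀ ω, A ω = (e ω).1) (a : α) :
    law P A a = ∑ b, P (e.symm (a, b)) := by
  classical
  rw [law, ← e.symm.sum_comp, Fintype.sum_prod_type, Finset.sum_eq_single a]
  · simp [h]
  · intro a' _ ha'
    simp [h, ha']
  · simp

end Congruence

/-! ### The error exponents as mutual informations. -/

section Rates

variable {S T Q W₁ W₂ X₁ X₂ Y₁ Y₂ : Type*} [Fintype S] [Fintype T] [Fintype Q] [Fintype W₁]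
  [Fintype W₂] [Fintype X₁] [Fintype X₂] [Fintype Y₁] [Fintype Y₂]

/-- `(s, w₁, x₁, w₂, q)` -/
def sent (ω : S × T × Q × W₁ × W₂ × X₁ × X₂ × Y₁ × Y₂) : S × W₁ × X₁ × W₂ × Q :=
  (ω.1, ω.2.2.2.1, ω.2.2.2.2.2.1, ω.2.2.2.2.1, ω.2.2.1)

variable (L : SourceLaw S T Q W₁ W₂ X₁ X₂) {p : S × T → ℝ} {N : X₁ → X₂ → Y₁ × Y₂ → ℝ}

section Marginals

variable (hp : p ∈ stdSimplex ℝ (S × T)) (hN : ∀ x₁ x₂, N x₁ x₂ ∈ stdSimplex ℝ (Y₁ × Y₂))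

include hN

lemma SourceLaw.law_sent (s : S) (w₁ : W₁) (x₁ : X₁) (w₂ : W₂) (q : Q) :
    law (L.joint p N) sent (s, w₁, x₁, w₂, q) =
      margS p s * (L.pQ q * (L.pW₁ q w₁ * (L.pW₂ q w₂ * L.pX₁ s w₁ q x₁))) := by
  have hN' : ∀ x₁ x₂, ∑ y₁, ∑ y₂, N x₁ x₂ (y₁, y₂) = 1 := fun x₁ x₂ => by
    rw [← Fintype.sum_prod_type, (hN x₁ x₂).2]
  rw [law_eq_sum_of_equiv (β := T × X₂ × Y₁ × Y₂) ⟨fun ω => ((ω.1, ω.2.2.2.1, ω.2.2.2.2.2.1,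
    ω.2.2.2.2.1, ω.2.2.1), ω.2.1, ω.2.2.2.2.2.2.1, ω.2.2.2.2.2.2.2.1, ω.2.2.2.2.2.2.2.2),
    fun x => (x.1.1, x.2.1, x.1.2.2.2.2, x.1.2.1, x.1.2.2.2.1, x.1.2.2.1, x.2.2.1, x.2.2.2.1,
      x.2.2.2.2), fun _ => rfl, fun _ => rfl⟩ (L.joint p N) sent (fun _ => rfl)]
  simp only [Equiv.coe_fn_symm_mk, Fintype.sum_prod_type, SourceLaw.joint, ← Finset.mul_sum, hN',
    mul_one, (L.pX₂_mem _ _ _).2, ← Finset.sum_mul, mul_assoc]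
  rfl

lemma SourceLaw.law_source (s : S) : law (L.joint p N) (fun ω => ω.1) s = margS p s := by
  have hN' : ∀ x₁ x₂, ∑ y₁, ∑ y₂, N x₁ x₂ (y₁, y₂) = 1 := fun x₁ x₂ => by
    rw [← Fintype.sum_prod_type, (hN x₁ x₂).2]
  rw [law_eq_sum_of_equiv (Equiv.refl _) (L.joint p N) (fun ω => ω.1) (fun _ => rfl)]
  simp only [Equiv.refl_symm, Equiv.refl_apply, Fintype.sum_prod_type, SourceLaw.joint,
    ← Finset.mul_sum, hN', mul_one, (L.pX₂_mem _ _ _).2, (L.pX₁_mem _ _ _).2, (L.pW₂_mem _).2,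
    (L.pW₁_mem _).2, L.pQ_mem.2, margS]

include hp

lemma SourceLaw.law_centers (q : Q) (w₁ : W₁) (w₂ : W₂) :
    law (L.joint p N) (fun ω => (ω.2.2.1, ω.2.2.2.1, ω.2.2.2.2.1)) (q, w₁, w₂) =
      L.pQ q * (L.pW₁ q w₁ * L.pW₂ q w₂) := by
  have hN' : ∀ x₁ x₂, ∑ y₁, ∑ y₂, N x₁ x₂ (y₁, y₂) = 1 := fun x₁ x₂ => by
    rw [← Fintype.sum_prod_type, (hN x₁ x₂).2]
  have hp' : ∑ s, ∑ t, p (s, t) = 1 := by rw [← Fintype.sum_prod_type, hp.2]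
  refine (law_eq_sum_of_equiv (β := S × T × X₁ × X₂ × Y₁ × Y₂) ⟨fun ω => ((ω.2.2.1, ω.2.2.2.1,
    ω.2.2.2.2.1), ω.1, ω.2.1, ω.2.2.2.2.2.1, ω.2.2.2.2.2.2.1, ω.2.2.2.2.2.2.2.1,
    ω.2.2.2.2.2.2.2.2), fun x => (x.2.1, x.2.2.1, x.1.1, x.1.2.1, x.1.2.2, x.2.2.2),
    fun _ => rfl, fun _ => rfl⟩ (L.joint p N) _ (fun _ => rfl) _).trans ?_
  simp only [Equiv.coe_fn_symm_mk, Fintype.sum_prod_type, SourceLaw.joint, ← Finset.mul_sum, hN',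
    mul_one, (L.pX₂_mem _ _ _).2, (L.pX₁_mem _ _ _).2, ← Finset.sum_mul, hp', mul_assoc, one_mul]

lemma SourceLaw.law_own (q : Q) (w₁ : W₁) :
    law (L.joint p N) (fun ω => (ω.2.2.1, ω.2.2.2.1)) (q, w₁) = L.pQ q * L.pW₁ q w₁ := by
  have hN' : ∀ x₁ x₂, ∑ y₁, ∑ y₂, N x₁ x₂ (y₁, y₂) = 1 := fun x₁ x₂ => by
    rw [← Fintype.sum_prod_type, (hN x₁ x₂).2]
  have hp' : ∑ s, ∑ t, p (s, t) = 1 := by rw [← Fintype.sum_prod_type, hp.2]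
  refine (law_eq_sum_of_equiv (β := S × T × W₂ × X₁ × X₂ × Y₁ × Y₂) ⟨fun ω => ((ω.2.2.1, ω.2.2.2.1),
    ω.1, ω.2.1, ω.2.2.2.2), fun x => (x.2.1, x.2.2.1, x.1.1, x.1.2, x.2.2.2),
    fun _ => rfl, fun _ => rfl⟩ (L.joint p N) _ (fun _ => rfl) _).trans ?_
  simp only [Equiv.coe_fn_symm_mk, Fintype.sum_prod_type, SourceLaw.joint, ← Finset.mul_sum, hN',
    mul_one, (L.pX₂_mem _ _ _).2, (L.pX₁_mem _ _ _).2, (L.pW₂_mem _).2, ← Finset.sum_mul, hp',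
    mul_assoc, one_mul]

lemma SourceLaw.law_other (q : Q) (w₂ : W₂) :
    law (L.joint p N) (fun ω => (ω.2.2.1, ω.2.2.2.2.1)) (q, w₂) = L.pQ q * L.pW₂ q w₂ := by
  have hN' : ∀ x₁ x₂, ∑ y₁, ∑ y₂, N x₁ x₂ (y₁, y₂) = 1 := fun x₁ x₂ => by
    rw [← Fintype.sum_prod_type, (hN x₁ x₂).2]
  have hp' : ∑ s, ∑ t, p (s, t) = 1 := by rw [← Fintype.sum_prod_type, hp.2]
  refine (law_eq_sum_of_equiv (β := S × T × W₁ × X₁ × X₂ × Y₁ × Y₂) ⟨fun ω => ((ω.2.2.1,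
    ω.2.2.2.2.1), ω.1, ω.2.1, ω.2.2.2.1, ω.2.2.2.2.2),
    fun x => (x.2.1, x.2.2.1, x.1.1, x.2.2.2.1, x.1.2, x.2.2.2.2),
    fun _ => rfl, fun _ => rfl⟩ (L.joint p N) _ (fun _ => rfl) _).trans ?_
  simp only [Equiv.coe_fn_symm_mk, Fintype.sum_prod_type, SourceLaw.joint, ← Finset.mul_sum, hN',
    mul_one, (L.pX₂_mem _ _ _).2, (L.pX₁_mem _ _ _).2, ← Finset.sum_mul, (L.pW₁_mem _).2, hp',
    mul_assoc, one_mul]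

lemma SourceLaw.law_timeSharing (q : Q) :
    law (L.joint p N) (fun ω => ω.2.2.1) q = L.pQ q := by
  have hN' : ∀ x₁ x₂, ∑ y₁, ∑ y₂, N x₁ x₂ (y₁, y₂) = 1 := fun x₁ x₂ => by
    rw [← Fintype.sum_prod_type, (hN x₁ x₂).2]
  have hp' : ∑ s, ∑ t, p (s, t) = 1 := by rw [← Fintype.sum_prod_type, hp.2]
  refine (law_eq_sum_of_equiv (β := S × T × W₁ × W₂ × X₁ × X₂ × Y₁ × Y₂) ⟨fun ω => (ω.2.2.1,
    ω.1, ω.2.1, ω.2.2.2), fun x => (x.2.1, x.2.2.1, x.1, x.2.2.2),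
    fun _ => rfl, fun _ => rfl⟩ (L.joint p N) _ (fun _ => rfl) _).trans ?_
  simp only [Equiv.coe_fn_symm_mk, Fintype.sum_prod_type, SourceLaw.joint, ← Finset.mul_sum, hN',
    mul_one, (L.pX₂_mem _ _ _).2, (L.pX₁_mem _ _ _).2, (L.pW₂_mem _).2, (L.pW₁_mem _).2,
    ← Finset.sum_mul, hp', one_mul]

/-- By `h` the kernel `r` equals p(sent) / (p(s) p(C₀)) wherever the joint law is positive, so the
log-ratio splits into logarithms of laws whose means are entropies. In the applications `C₀` is `C`
without the output, and the entropies form a mutual information. The term -H(S) comes from p(s),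
which the true law contains and the fresh likelihood lacks. -/
lemma SourceLaw.rate_eq {α γ : Type*} [Fintype α] [Fintype γ]
    (C : S × T × Q × W₁ × W₂ × X₁ × X₂ × Y₁ × Y₂ → α)
    (C₀ : S × T × Q × W₁ × W₂ × X₁ × X₂ × Y₁ × Y₂ → γ)
    (r : S × T × Q × W₁ × W₂ × X₁ × X₂ × Y₁ × Y₂ → ℝ)
    (h : ∀ ω, law (L.joint p N) sent (sent ω) =
      margS p ω.1 * (law (L.joint p N) C₀ (C₀ ω) * r ω)) :
    L.rate p N C r = rvEntropy (L.joint p N) sent - rvEntropy (L.joint p N) C₀ -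
      (rvEntropy (L.joint p N) obs - rvEntropy (L.joint p N) C) - entropy (margS p) := by
  have hJ := L.joint_nonneg hp hN
  have hS : entropy (margS p) = rvEntropy (L.joint p N) (fun ω => ω.1) := by
    rw [rvEntropy, funext (L.law_source hN)]
  rw [hS]
  simp only [rvEntropy_eq, SourceLaw.rate]
  have hpt : ∀ ω, L.joint p N ω *
      Real.logb 2 (law (L.joint p N) obs (obs ω) / L.fresh p N C r ω) =
      L.joint p N ω * Real.logb 2 (law (L.joint p N) obs (obs ω)) -
      L.joint p N ω * Real.logb 2 (law (L.joint p N) C (C ω)) -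
      (L.joint p N ω * Real.logb 2 (law (L.joint p N) sent (sent ω)) -
      L.joint p N ω * Real.logb 2 (law (L.joint p N) (fun ω => ω.1) ω.1) -
      L.joint p N ω * Real.logb 2 (law (L.joint p N) C₀ (C₀ ω))) := by
    intro ω
    rcases (hJ ω).eq_or_lt with h0 | h0
    · simp [← h0]
    have h1 : 0 < law (L.joint p N) obs (obs ω) := h0.trans_le (le_law hJ _ ω)
    have h2 : 0 < law (L.joint p N) C (C ω) := h0.trans_le (le_law hJ _ ω)
    have h3 : 0 < law (L.joint p N) sent (sent ω) := h0.trans_le (le_law hJ _ ω)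
    have h4 : 0 < law (L.joint p N) (fun ω => ω.1) ω.1 :=
      h0.trans_le (le_law hJ (fun ω => ω.1) ω)
    have h5 : 0 < law (L.joint p N) C₀ (C₀ ω) := h0.trans_le (le_law hJ _ ω)
    have hV := h ω
    rw [← L.law_source hN] at hV
    have hr : r ω ≠ 0 := by
      intro hr
      rw [hr, mul_zero, mul_zero] at hV
      exact h3.ne' hV
    rw [hV, SourceLaw.fresh, Real.logb_div h1.ne' (mul_ne_zero h2.ne' hr),
      Real.logb_mul h2.ne' hr, Real.logb_mul h4.ne' (mul_ne_zero h5.ne' hr),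
      Real.logb_mul h5.ne' hr]
    ring
  simp only [hpt, Finset.sum_sub_distrib]
  ring

/-- The exponents of the error events at the first decoder in terms of mutual informations. -/
theorem SourceLaw.rate_bounds :
    L.rate p N obsCenters L.kX₁ = condMI (L.joint p N) (fun ω => (ω.1, ω.2.2.2.2.2.1))
      (fun ω => ω.2.2.2.2.2.2.2.1) (fun ω => (ω.2.2.1, ω.2.2.2.1, ω.2.2.2.2.1)) -
        entropy (margS p) ∧
    L.rate p N obsOwn (fun ω => L.kX₁ ω * L.kW₂ ω) =
      condMI (L.joint p N) (fun ω => (ω.1, ω.2.2.2.2.1, ω.2.2.2.2.2.1))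
      (fun ω => ω.2.2.2.2.2.2.2.1) (fun ω => (ω.2.2.1, ω.2.2.2.1)) - entropy (margS p) ∧
    condMI (L.joint p N) (fun ω => (ω.1, ω.2.2.2.2.2.1))
      (fun ω => ω.2.2.2.2.2.2.2.1) (fun ω => (ω.2.2.1, ω.2.2.2.2.1)) - entropy (margS p) ≤
      L.rate p N obsOther (fun ω => L.kW₁ ω * L.kX₁ ω) ∧
    condMI (L.joint p N) (fun ω => (ω.1, ω.2.2.2.2.1, ω.2.2.2.2.2.1))
      (fun ω => ω.2.2.2.2.2.2.2.1) (fun ω => ω.2.2.1) - entropy (margS p) ≤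
      L.rate p N obsOut (fun ω => L.kW₁ ω * (L.kX₁ ω * L.kW₂ ω)) ∧
    L.rate p N obsCenters L.kX₁ ≤ L.rate p N obsOwn (fun ω => L.kX₁ ω * L.kW₂ ω) ∧
    L.rate p N obsOther (fun ω => L.kW₁ ω * L.kX₁ ω) ≤
      L.rate p N obsOut (fun ω => L.kW₁ ω * (L.kX₁ ω * L.kW₂ ω)) := by
  have hJ := L.joint_nonneg hp hN
  have ra := L.rate_eq hp hN obsCenters (fun ω => (ω.2.2.1, ω.2.2.2.1, ω.2.2.2.2.1)) L.kX₁
    (fun ω => by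
      rw [sent, L.law_sent hN, L.law_centers hp hN, SourceLaw.kX₁]
      ring)
  have re := L.rate_eq hp hN obsOwn (fun ω => (ω.2.2.1, ω.2.2.2.1)) (fun ω => L.kX₁ ω * L.kW₂ ω)
    (fun ω => by
      rw [sent, L.law_sent hN, L.law_own hp hN, SourceLaw.kX₁, SourceLaw.kW₂]
      ring)
  have rd := L.rate_eq hp hN obsOther (fun ω => (ω.2.2.1, ω.2.2.2.2.1))
    (fun ω => L.kW₁ ω * L.kX₁ ω) (fun ω => by
      rw [sent, L.law_sent hN, L.law_other hp hN, SourceLaw.kX₁, SourceLaw.kW₁]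
      ring)
  have rg := L.rate_eq hp hN obsOut (fun ω => ω.2.2.1)
    (fun ω => L.kW₁ ω * (L.kX₁ ω * L.kW₂ ω)) (fun ω => by
      rw [sent, L.law_sent hN, L.law_timeSharing hp hN, SourceLaw.kX₁, SourceLaw.kW₁,
        SourceLaw.kW₂]
      ring)
  set J := L.joint p N
  let s : S × T × Q × W₁ × W₂ × X₁ × X₂ × Y₁ × Y₂ → S := fun ω => ω.1
  let q : S × T × Q × W₁ × W₂ × X₁ × X₂ × Y₁ × Y₂ → Q := fun ω => ω.2.2.1
  let w₁ : S × T × Q × W₁ × W₂ × X₁ × X₂ × Y₁ × Y₂ → W₁ := fun ω => ω.2.2.2.1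
  let w₂ : S × T × Q × W₁ × W₂ × X₁ × X₂ × Y₁ × Y₂ → W₂ := fun ω => ω.2.2.2.2.1
  let x₁ : S × T × Q × W₁ × W₂ × X₁ × X₂ × Y₁ × Y₂ → X₁ := fun ω => ω.2.2.2.2.2.1
  let y₁ : S × T × Q × W₁ × W₂ × X₁ × X₂ × Y₁ × Y₂ → Y₁ := fun ω => ω.2.2.2.2.2.2.2.1
  have ia : condMI J (s &ᵣ x₁) y₁ (q &ᵣ w₁ &ᵣ w₂) = rvEntropy J sent -
      rvEntropy J (q &ᵣ w₁ &ᵣ w₂) - (rvEntropy J obs - rvEntropy J obsCenters) := by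
    have h0 : rvEntropy J ((s &ᵣ x₁) &ᵣ q &ᵣ w₁ &ᵣ w₂) = rvEntropy J sent := rvEntropy_congr J fun ω ω' => by
      simp only [join, Prod.mk.injEq, sent, s, q, w₁, w₂, x₁]; tauto
    have h1 : rvEntropy J ((s &ᵣ x₁) &ᵣ y₁ &ᵣ q &ᵣ w₁ &ᵣ w₂) = rvEntropy J obs := rvEntropy_congr J fun ω ω' => by
      simp only [join, Prod.mk.injEq, obs, s, q, w₁, w₂, x₁, y₁]; tauto
    have h2 : rvEntropy J (y₁ &ᵣ q &ᵣ w₁ &ᵣ w₂) = rvEntropy J obsCenters := rvEntropy_congr J fun ω ω' => by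
      simp only [join, Prod.mk.injEq, obsCenters, q, w₁, w₂, y₁]; tauto
    rw [condMI_eq, h0, h1, h2]
  have ie : condMI J (s &ᵣ w₂ &ᵣ x₁) y₁ (q &ᵣ w₁) = rvEntropy J sent -
      rvEntropy J (q &ᵣ w₁) - (rvEntropy J obs - rvEntropy J obsOwn) := by
    have h0 : rvEntropy J ((s &ᵣ w₂ &ᵣ x₁) &ᵣ q &ᵣ w₁) = rvEntropy J sent := rvEntropy_congr J fun ω ω' => by
      simp only [join, Prod.mk.injEq, sent, s, q, w₁, w₂, x₁]; tauto
    have h1 : rvEntropy J ((s &ᵣ w₂ &ᵣ x₁) &ᵣ y₁ &ᵣ q &ᵣ w₁) = rvEntropy J obs := rvEntropy_congr J fun ω ω' => by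
      simp only [join, Prod.mk.injEq, obs, s, q, w₁, w₂, x₁, y₁]; tauto
    have h2 : rvEntropy J (y₁ &ᵣ q &ᵣ w₁) = rvEntropy J obsOwn := rvEntropy_congr J fun ω ω' => by
      simp only [join, Prod.mk.injEq, obsOwn, q, w₁, y₁]; tauto
    rw [condMI_eq, h0, h1, h2]
  -- The right side is I(S W₁ X₁; Y₁ | Q W₂). It exceeds the left by I(W₁; Y₁ | S X₁ Q W₂), and
  -- nonnegativity of this gap is all that is needed.
  have hd : condMI J (s &ᵣ x₁) y₁ (q &ᵣ w₂) ≤ rvEntropy J sent -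
      rvEntropy J (q &ᵣ w₂) - (rvEntropy J obs - rvEntropy J obsOther) := by
    have h := condMI_nonneg hJ w₁ y₁ ((s &ᵣ x₁) &ᵣ q &ᵣ w₂)
    have h1 : rvEntropy J (y₁ &ᵣ (s &ᵣ x₁) &ᵣ q &ᵣ w₂) =
        rvEntropy J ((s &ᵣ x₁) &ᵣ y₁ &ᵣ q &ᵣ w₂) := rvEntropy_congr J fun ω ω' => by
      simp only [join, Prod.mk.injEq]; tauto
    have h2 : rvEntropy J (w₁ &ᵣ (s &ᵣ x₁) &ᵣ q &ᵣ w₂) = rvEntropy J sent := rvEntropy_congr J fun ω ω' => by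
      simp only [join, Prod.mk.injEq, sent, s, q, w₁, w₂, x₁]; tauto
    have h3 : rvEntropy J (w₁ &ᵣ y₁ &ᵣ (s &ᵣ x₁) &ᵣ q &ᵣ w₂) = rvEntropy J obs :=
      rvEntropy_congr J fun ω ω' => by
      simp only [join, Prod.mk.injEq, obs, s, q, w₁, w₂, x₁, y₁]; tauto
    have h4 : rvEntropy J (y₁ &ᵣ q &ᵣ w₂) = rvEntropy J obsOther :=
      rvEntropy_congr J fun ω ω' => by
      simp only [join, Prod.mk.injEq, obsOther, q, w₂, y₁]; tauto
    rw [condMI_eq, h1, h2, h3] at h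
    rw [condMI_eq, h4]
    linarith
  -- The gap here is I(W₁; Y₁ | S W₂ X₁ Q).
  have hg : condMI J (s &ᵣ w₂ &ᵣ x₁) y₁ q ≤ rvEntropy J sent -
      rvEntropy J q - (rvEntropy J obs - rvEntropy J obsOut) := by
    have h := condMI_nonneg hJ w₁ y₁ ((s &ᵣ w₂ &ᵣ x₁) &ᵣ q)
    have h1 : rvEntropy J (y₁ &ᵣ (s &ᵣ w₂ &ᵣ x₁) &ᵣ q) =
        rvEntropy J ((s &ᵣ w₂ &ᵣ x₁) &ᵣ y₁ &ᵣ q) := rvEntropy_congr J fun ω ω' => by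
      simp only [join, Prod.mk.injEq]; tauto
    have h2 : rvEntropy J (w₁ &ᵣ (s &ᵣ w₂ &ᵣ x₁) &ᵣ q) = rvEntropy J sent := rvEntropy_congr J fun ω ω' => by
      simp only [join, Prod.mk.injEq, sent, s, q, w₁, w₂, x₁]; tauto
    have h3 : rvEntropy J (w₁ &ᵣ y₁ &ᵣ (s &ᵣ w₂ &ᵣ x₁) &ᵣ q) = rvEntropy J obs :=
      rvEntropy_congr J fun ω ω' => by
      simp only [join, Prod.mk.injEq, obs, s, q, w₁, w₂, x₁, y₁]; tauto
    have h4 : rvEntropy J (y₁ &ᵣ q) = rvEntropy J obsOut :=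
      rvEntropy_congr J fun ω ω' => by
      simp only [join, Prod.mk.injEq, obsOut, q, y₁]; tauto
    rw [condMI_eq, h1, h2, h3] at h
    rw [condMI_eq, h4]
    linarith
  -- I(W₂; Y₁ | Q W₁) and, in the next claim, I(W₂; Y₁ | Q) are the increments of the exponent when
  -- the foreign centre is also wrong. They give the orderings that the elimination of the hash
  -- rates uses.
  have nae : 0 ≤ rvEntropy J (q &ᵣ w₁ &ᵣ w₂) - rvEntropy J (q &ᵣ w₁) -
      (rvEntropy J obsCenters - rvEntropy J obsOwn) := by
    have h := condMI_nonneg hJ w₂ y₁ (q &ᵣ w₁)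
    have h1 : rvEntropy J (w₂ &ᵣ q &ᵣ w₁) = rvEntropy J (q &ᵣ w₁ &ᵣ w₂) :=
      rvEntropy_congr J fun ω ω' => by simp only [join, Prod.mk.injEq]; tauto
    have h2 : rvEntropy J (w₂ &ᵣ y₁ &ᵣ q &ᵣ w₁) = rvEntropy J obsCenters := rvEntropy_congr J fun ω ω' => by
      simp only [join, Prod.mk.injEq, obsCenters, q, w₁, w₂, y₁]; tauto
    have h3 : rvEntropy J (y₁ &ᵣ q &ᵣ w₁) = rvEntropy J obsOwn := rvEntropy_congr J fun ω ω' => by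
      simp only [join, Prod.mk.injEq, obsOwn, q, w₁, y₁]; tauto
    rw [condMI_eq, h1, h2, h3] at h
    exact h
  have ndg : 0 ≤ rvEntropy J (q &ᵣ w₂) - rvEntropy J q -
      (rvEntropy J obsOther - rvEntropy J obsOut) := by
    have h := condMI_nonneg hJ w₂ y₁ q
    have h1 : rvEntropy J (w₂ &ᵣ q) = rvEntropy J (q &ᵣ w₂) :=
      rvEntropy_congr J fun ω ω' => by simp only [join, Prod.mk.injEq]; tauto
    have h2 : rvEntropy J (w₂ &ᵣ y₁ &ᵣ q) = rvEntropy J obsOther := rvEntropy_congr J fun ω ω' => by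
      simp only [join, Prod.mk.injEq, obsOther, q, w₂, y₁]; tauto
    have h3 : rvEntropy J (y₁ &ᵣ q) = rvEntropy J obsOut := rvEntropy_congr J fun ω ω' => by
      simp only [join, Prod.mk.injEq, obsOut, q, y₁]; tauto
    rw [condMI_eq, h1, h2, h3] at h
    exact h
  change L.rate p N obsCenters L.kX₁ = rvEntropy J sent - rvEntropy J (q &ᵣ w₁ &ᵣ w₂) - _ - _ at ra
  change _ = rvEntropy J sent - rvEntropy J (q &ᵣ w₁) - _ - _ at re
  change _ = rvEntropy J sent - rvEntropy J (q &ᵣ w₂) - _ - _ at rd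
  change _ = rvEntropy J sent - rvEntropy J q - _ - _ at rg
  change L.rate p N obsCenters L.kX₁ = condMI J (s &ᵣ x₁) y₁ (q &ᵣ w₁ &ᵣ w₂) - _ ∧
    _ = condMI J (s &ᵣ w₂ &ᵣ x₁) y₁ (q &ᵣ w₁) - _ ∧ condMI J (s &ᵣ x₁) y₁ (q &ᵣ w₂) - _ ≤ _ ∧
    condMI J (s &ᵣ w₂ &ᵣ x₁) y₁ q - _ ≤ _ ∧ _
  rw [ia, ie, ra, re, rd, rg]
  refine ⟨rfl, rfl, ?_, ?_, ?_, ?_⟩ <;> linarith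

end Marginals

end Rates

/-! ### Choice of the hash rates and estimates of the error terms. -/

/-- Fourier–Motzkin elimination of the two hash rates. -/
lemma exists_hash_rates {h k a₁ d₁ e₁ g₁ a₂ d₂ e₂ g₂ : ℝ} (hd₁ : h < d₁) (hd₂ : k < d₂)
    (h₁₂ : h + k < a₁ + g₂) (h₂₁ : h + k < a₂ + g₁) (he : h + k < e₁ + e₂)
    (h₁ : 2 * h + k < a₁ + g₁ + e₂) (h₂ : h + 2 * k < a₂ + g₂ + e₁) (hae₁ : a₁ ≤ e₁)
    (hae₂ : a₂ ≤ e₂) (hdg₁ : d₁ ≤ g₁) (hdg₂ : d₂ ≤ g₂) :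
    ∃ x y : ℝ, 0 ≤ x ∧ 0 ≤ y ∧ h - x < a₁ ∧ h - x + y < e₁ ∧ h + y < g₁ ∧
      k - y < a₂ ∧ k - y + x < e₂ ∧ k + x < g₂ := by
  -- The bounds are those imposed on y directly, together with those left when every lower bound on
  -- x is compared with every upper one: k - e₂ and h + k - a₁ - e₂ from below, g₂ + e₁ - h - k from
  -- above. The remaining comparisons do not involve y and follow from the hypotheses.
  obtain ⟨y, hy1, hy2⟩ := exists_between (a₁ := max (max 0 (k - a₂)) (max (k - e₂) (h + k - a₁ - e₂)))
    (a₂ := min (g₁ - h) (g₂ + e₁ - h - k)) (by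
      simp only [max_lt_iff, lt_min_iff]
      refine ⟨⟨⟨?_, ?_⟩, ?_, ?_⟩, ⟨?_, ?_⟩, ?_, ?_⟩ <;> linarith)
  simp only [max_lt_iff, lt_min_iff] at hy1 hy2
  obtain ⟨⟨y1, y2⟩, y3, y4⟩ := hy1
  obtain ⟨y5, y6⟩ := hy2
  obtain ⟨x, hx1, hx2⟩ := exists_between (a₁ := max 0 (max (h - a₁) (h + y - e₁)))
    (a₂ := min (e₂ - k + y) (g₂ - k)) (by
      simp only [max_lt_iff, lt_min_iff]
      refine ⟨⟨?_, ?_, ?_⟩, ?_, ?_, ?_⟩ <;> linarith)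
  simp only [max_lt_iff, lt_min_iff] at hx1 hx2
  obtain ⟨x1, x2, x3⟩ := hx1
  obtain ⟨x4, x5⟩ := hx2
  exact ⟨x, y, x1.le, y1.le, by linarith, by linarith, by linarith, by linarith, by linarith,
    by linarith⟩

/-- Of the margin 2δ, one δ pays for the slack in the acceptance thresholds and the other is the
decay rate. The constant is 6 = 1 + 2 + 1 + 2, where each 2 comes from rounding `M₂` to an integer.
-/
lemma exponents_le {n : ℕ} {M₁ M₂ x y a e d g δ : ℝ} (hM₁ : (2 : ℝ) ^ (n * x) ≤ M₁)
    (hM₂ : 0 ≤ M₂) (hM₂' : M₂ ≤ 2 * (2 : ℝ) ^ (n * y)) (ha : 2 * δ ≤ a + x)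
    (he : 2 * δ ≤ e + x - y) (hd : 2 * δ ≤ d) (hg : 2 * δ ≤ g - y) :
    M₁⁻¹ * (2 : ℝ) ^ (-(n * (a - δ))) + M₁⁻¹ * M₂ * (2 : ℝ) ^ (-(n * (e - δ))) +
      (2 : ℝ) ^ (-(n * (d - δ))) + M₂ * (2 : ℝ) ^ (-(n * (g - δ))) ≤
        6 * (2 : ℝ) ^ (-(n * δ)) := by
  have hn : (0 : ℝ) ≤ n := Nat.cast_nonneg n
  have hpos : ∀ z : ℝ, 0 < (2 : ℝ) ^ z := fun z => Real.rpow_pos_of_pos two_pos z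
  have hinv : M₁⁻¹ ≤ (2 : ℝ) ^ (-(n * x)) := by
    rw [Real.rpow_neg two_pos.le]
    exact inv_anti₀ (hpos _) hM₁
  have hinv0 : 0 ≤ M₁⁻¹ := inv_nonneg.2 ((hpos _).le.trans hM₁)
  have hle : ∀ {z w : ℝ}, w ≤ z → (2 : ℝ) ^ (-(n * z)) ≤ (2 : ℝ) ^ (-(n * w)) := fun h =>
    Real.rpow_le_rpow_of_exponent_le (by norm_num) (neg_le_neg (mul_le_mul_of_nonneg_left h hn))
  have t1 : M₁⁻¹ * (2 : ℝ) ^ (-(n * (a - δ))) ≤ (2 : ℝ) ^ (-(n * δ)) := by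
    calc _ ≤ (2 : ℝ) ^ (-(n * x)) * (2 : ℝ) ^ (-(n * (a - δ))) :=
          mul_le_mul_of_nonneg_right hinv (hpos _).le
      _ = (2 : ℝ) ^ (-(n * (x + a - δ))) := by
          rw [← Real.rpow_add two_pos]
          congr 1
          ring
      _ ≤ _ := hle (by linarith)
  have t2 : M₁⁻¹ * M₂ * (2 : ℝ) ^ (-(n * (e - δ))) ≤ 2 * (2 : ℝ) ^ (-(n * δ)) := by
    calc _ ≤ (2 : ℝ) ^ (-(n * x)) * (2 * (2 : ℝ) ^ (n * y)) * (2 : ℝ) ^ (-(n * (e - δ))) :=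
          mul_le_mul_of_nonneg_right (mul_le_mul hinv hM₂' hM₂ (hpos _).le) (hpos _).le
      _ = 2 * (2 : ℝ) ^ (-(n * (x - y + e - δ))) := by
          rw [mul_left_comm, mul_assoc, ← Real.rpow_add two_pos, ← Real.rpow_add two_pos]
          congr 2
          ring
      _ ≤ _ := mul_le_mul_of_nonneg_left (hle (by linarith)) two_pos.le
  have t3 : (2 : ℝ) ^ (-(n * (d - δ))) ≤ (2 : ℝ) ^ (-(n * δ)) := hle (by linarith)
  have t4 : M₂ * (2 : ℝ) ^ (-(n * (g - δ))) ≤ 2 * (2 : ℝ) ^ (-(n * δ)) := by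
    calc _ ≤ (2 * (2 : ℝ) ^ (n * y)) * (2 : ℝ) ^ (-(n * (g - δ))) :=
          mul_le_mul_of_nonneg_right hM₂' (hpos _).le
      _ = 2 * (2 : ℝ) ^ (-(n * (g - y - δ))) := by
          rw [mul_assoc, ← Real.rpow_add two_pos]
          congr 2
          ring
      _ ≤ _ := mul_le_mul_of_nonneg_left (hle (by linarith)) two_pos.le
  linarith

/-- Since x ≥ 0 the power is at least 1, so rounding it up at most doubles it. -/
lemma exists_hash_size (n : ℕ) {x : ℝ} (hx : 0 ≤ x) :
    ∃ M : ℕ, M ≠ 0 ∧ (2 : ℝ) ^ (n * x) ≤ M ∧ (M : ℝ) ≤ 2 * (2 : ℝ) ^ (n * x) := by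
  have h1 : 1 ≤ (2 : ℝ) ^ (n * x) := Real.one_le_rpow (by norm_num) (by positivity)
  refine ⟨⌈(2 : ℝ) ^ (n * x)⌉₊, (Nat.ceil_pos.2 (by linarith)).ne', Nat.le_ceil _, ?_⟩
  linarith [Nat.ceil_lt_add_one (a := (2 : ℝ) ^ (n * x)) (by linarith)]

/-! ### The coding theorem for both decoders. -/

section Coding

variable {S T Q W₁ W₂ X₁ X₂ Y₁ Y₂ : Type*} [Fintype S] [Fintype T] [Fintype Q] [Fintype W₁]
  [Fintype W₂] [Fintype X₁] [Fintype X₂] [Fintype Y₁] [Fintype Y₂]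

/-- The source seen by the second user. -/
def swapSource (p : S × T → ℝ) : T × S → ℝ := fun ts => p ts.swap

/-- The channel with the roles of the users exchanged. -/
def swapChannel (N : X₁ → X₂ → Y₁ × Y₂ → ℝ) : X₂ → X₁ → Y₂ × Y₁ → ℝ := fun x₂ x₁ y => N x₁ x₂ y.swap

/-- The auxiliary kernels with the roles of the users exchanged. -/
def SourceLaw.swap (L : SourceLaw S T Q W₁ W₂ X₁ X₂) : SourceLaw T S Q W₂ W₁ X₂ X₁ where
  pQ := L.pQ
  pW₁ := L.pW₂
  pW₂ := L.pW₁
  pX₁ := L.pX₂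
  pX₂ := L.pX₁
  pQ_mem := L.pQ_mem
  pW₁_mem := L.pW₂_mem
  pW₂_mem := L.pW₁_mem
  pX₁_mem := L.pX₂_mem
  pX₂_mem := L.pX₁_mem

lemma swap_mem_stdSimplex {α β : Type*} [Fintype α] [Fintype β] {f : α × β → ℝ}
    (hf : f ∈ stdSimplex ℝ (α × β)) : (fun x : β × α => f x.swap) ∈ stdSimplex ℝ (β × α) :=
  ⟨fun _ => hf.1 _, ((Equiv.prodComm β α).sum_comp f).trans hf.2⟩

/-- Samples with the roles of the users exchanged. -/
def swapEquiv (S T Q W₁ W₂ X₁ X₂ Y₁ Y₂ : Type*) : S × T × Q × W₁ × W₂ × X₁ × X₂ × Y₁ × Y₂ ≃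
    T × S × Q × W₂ × W₁ × X₂ × X₁ × Y₂ × Y₁ where
  toFun ω := (ω.2.1, ω.1, ω.2.2.1, ω.2.2.2.2.1, ω.2.2.2.1, ω.2.2.2.2.2.2.1, ω.2.2.2.2.2.1,
    ω.2.2.2.2.2.2.2.2, ω.2.2.2.2.2.2.2.1)
  invFun ω := (ω.2.1, ω.1, ω.2.2.1, ω.2.2.2.2.1, ω.2.2.2.1, ω.2.2.2.2.2.2.1, ω.2.2.2.2.2.1,
    ω.2.2.2.2.2.2.2.2, ω.2.2.2.2.2.2.2.1)
  left_inv _ := rfl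
  right_inv _ := rfl

lemma SourceLaw.joint_swap (L : SourceLaw S T Q W₁ W₂ X₁ X₂) (p : S × T → ℝ)
    (N : X₁ → X₂ → Y₁ × Y₂ → ℝ) : L.joint p N = fun ω =>
      L.swap.joint (swapSource p) (swapChannel N) (swapEquiv S T Q W₁ W₂ X₁ X₂ Y₁ Y₂ ω) := by
  funext ⟨s, t, q, w₁, w₂, x₁, x₂, y₁, y₂⟩
  simp only [SourceLaw.joint, swapEquiv, SourceLaw.swap, swapSource, swapChannel, Equiv.coe_fn_mk,
    Prod.swap_prod_mk]
  ring

lemma BlockCode.err₁_eq {n : ℕ} (c : BlockCode S T X₁ X₂ Y₁ Y₂ n) (p : S × T → ℝ)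
    (N : X₁ → X₂ → Y₁ × Y₂ → ℝ) :
    c.err₁ p N = wordErr (blockSource p n) (blockChannel N n) c.f₁ c.f₂ c.φ₁ := by
  unfold BlockCode.err₁ wordErr
  refine Finset.sum_congr rfl fun s _ => Finset.sum_congr rfl fun t _ =>
    Finset.sum_congr rfl fun y₁ _ => Finset.sum_congr rfl fun y₂ _ => ?_
  split_ifs <;> rfl

lemma BlockCode.err₂_eq {n : ℕ} (c : BlockCode S T X₁ X₂ Y₁ Y₂ n) (p : S × T → ℝ)
    (N : X₁ → X₂ → Y₁ × Y₂ → ℝ) :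
    c.err₂ p N = wordErr (blockSource (swapSource p) n) (blockChannel (swapChannel N) n)
      c.f₂ c.f₁ c.φ₂ := by
  unfold BlockCode.err₂ wordErr
  rw [Finset.sum_comm]
  refine Finset.sum_congr rfl fun t _ => Finset.sum_congr rfl fun s _ => ?_
  rw [Finset.sum_comm]
  refine Finset.sum_congr rfl fun y₂ _ => Finset.sum_congr rfl fun y₁ _ => ?_
  split_ifs <;> rfl

lemma wordErr_nonneg {p : S × T → ℝ} (hp : ∀ st, 0 ≤ p st)
    {N : X₁ → X₂ → Y₁ × Y₂ → ℝ} (hN : ∀ x₁ x₂ y, 0 ≤ N x₁ x₂ y) (f₁ : S → X₁) (f₂ : T → X₂)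
    (φ : Y₁ → S) : 0 ≤ wordErr p N f₁ f₂ φ := by
  refine Finset.sum_nonneg fun s _ => Finset.sum_nonneg fun t _ => Finset.sum_nonneg fun y₁ _ =>
    Finset.sum_nonneg fun y₂ _ => ?_
  split_ifs
  · exact mul_nonneg (hp _) (hN _ _ _)
  · exact le_rfl

/-- Random coding bound for the first decoder on blocks of length `n`. -/
lemma SourceLaw.exists_block_error_le [DecidableEq S] [DecidableEq T] [Nonempty S]
    (L : SourceLaw S T Q W₁ W₂ X₁ X₂) {p : S × T → ℝ}
    (hp : p ∈ stdSimplex ℝ (S × T)) {N : X₁ → X₂ → Y₁ × Y₂ → ℝ}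
    (hN : ∀ x₁ x₂, N x₁ x₂ ∈ stdSimplex ℝ (Y₁ × Y₂)) {x y δ : ℝ} (hδ : 0 < δ)
    (ha : 2 * δ ≤ L.rate p N obsCenters L.kX₁ + x)
    (he : 2 * δ ≤ L.rate p N obsOwn (fun ω => L.kX₁ ω * L.kW₂ ω) + x - y)
    (hd : 2 * δ ≤ L.rate p N obsOther (fun ω => L.kW₁ ω * L.kX₁ ω))
    (hg : 2 * δ ≤ L.rate p N obsOut (fun ω => L.kW₁ ω * (L.kX₁ ω * L.kW₂ ω)) - y) :
    ∃ K : ℝ, ∀ n : ℕ, 1 ≤ n →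
      ∃ A : Set ((Fin n → Q) × (Fin n → S) × (Fin n → W₁) × (Fin n → X₁) × (Fin n → W₂) ×
        (Fin n → Y₁)), ∀ M₁ M₂ : ℕ, M₁ ≠ 0 → M₂ ≠ 0 → (2 : ℝ) ^ (n * x) ≤ M₁ →
        (M₂ : ℝ) ≤ 2 * (2 : ℝ) ^ (n * y) →
        ∑ q, (L.block n).pQ q * ∑ c₁ : Book (Fin n → S) (Fin n → W₁) (Fin n → X₁) M₁,
          (L.block n).bookWeight₁ q c₁ *
          ∑ c₂ : Book (Fin n → T) (Fin n → W₂) (Fin n → X₂) M₂, (L.block n).bookWeight₂ q c₂ *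
            wordErr (blockSource p n) (blockChannel N n) c₁.2.2 c₂.2.2 (decode A q c₁ c₂) ≤
          K / n + 6 * (2 : ℝ) ^ (-(n * δ)) := by
  obtain ⟨K, hK, htail⟩ := L.exists_block_tail_le hp hN hδ
  refine ⟨K, fun n hn => ⟨(L.block n).accept (blockSource p n) (blockChannel N n)
    ((2 : ℝ) ^ (-(n * (L.rate p N obsCenters L.kX₁ - δ))))
    ((2 : ℝ) ^ (-(n * (L.rate p N obsOwn (fun ω => L.kX₁ ω * L.kW₂ ω) - δ))))
    ((2 : ℝ) ^ (-(n * (L.rate p N obsOther (fun ω => L.kW₁ ω * L.kX₁ ω) - δ))))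
    ((2 : ℝ) ^ (-(n * (L.rate p N obsOut (fun ω => L.kW₁ ω * (L.kX₁ ω * L.kW₂ ω)) - δ)))),
    fun M₁ M₂ hM₁ hM₂ h₁ h₂ => ?_⟩⟩
  have hpos : ∀ z : ℝ, 0 ≤ (2 : ℝ) ^ z := fun z => (Real.rpow_pos_of_pos two_pos z).le
  exact ((L.block n).average_error_le (blockSource_mem hp n) (blockChannel_mem hN n) hM₁ hM₂ _
    (hpos _) (hpos _) (hpos _) (hpos _) (fun _ _ _ _ _ _ h => h.1) (fun _ _ _ _ _ _ h => h.2.1)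
    (fun _ _ _ _ _ _ h => h.2.2.1) (fun _ _ _ _ _ _ h => h.2.2.2)).trans
    (add_le_add (htail n hn) (exponents_le h₁ (Nat.cast_nonneg _) h₂ ha he hd hg))

/-- The same time-sharing value and the same two books must serve both decoders, so it is the sum of
the two errors that is averaged. Some choice does no worse than the mean. -/
lemma SourceLaw.exists_codebooks [DecidableEq S] [DecidableEq T] [Nonempty S] [Nonempty T]
    (L : SourceLaw S T Q W₁ W₂ X₁ X₂) {M₁ M₂ : ℕ} (hM₁ : M₁ ≠ 0) (hM₂ : M₂ ≠ 0)
    {E₁ E₂ : Q → Book S W₁ X₁ M₁ → Book T W₂ X₂ M₂ → ℝ} {δ₁ δ₂ : ℝ}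
    (h₁ : ∑ q, L.pQ q * ∑ c₁ : Book S W₁ X₁ M₁, L.bookWeight₁ q c₁ *
      ∑ c₂ : Book T W₂ X₂ M₂, L.bookWeight₂ q c₂ * E₁ q c₁ c₂ ≤ δ₁)
    (h₂ : ∑ q, L.pQ q * ∑ c₂ : Book T W₂ X₂ M₂, L.bookWeight₂ q c₂ *
      ∑ c₁ : Book S W₁ X₁ M₁, L.bookWeight₁ q c₁ * E₂ q c₁ c₂ ≤ δ₂) :
    ∃ q c₁ c₂, E₁ q c₁ c₂ + E₂ q c₁ c₂ ≤ δ₁ + δ₂ := by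
  have h := add_le_add h₁ h₂
  simp only [sum_mul_sum_comm (L.bookWeight₂ _)] at h
  rw [← Finset.sum_add_distrib] at h
  simp only [← mul_add, ← Finset.sum_add_distrib] at h
  obtain ⟨q, hq⟩ := exists_le_of_sum_mul_le L.pQ_mem.1 L.pQ_mem.2 h
  obtain ⟨c₁, hc₁⟩ := exists_le_of_sum_mul_le
    (fun c => Book.weight_nonneg (L.pW₁_mem q) (fun s w => L.pX₁_mem s w q) c)
    (Book.sum_weight hM₁ (L.pW₁_mem q) (fun s w => L.pX₁_mem s w q)) hq
  obtain ⟨c₂, hc₂⟩ := exists_le_of_sum_mul_le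
    (fun c => Book.weight_nonneg (L.pW₂_mem q) (fun s w => L.pX₂_mem s w q) c)
    (Book.sum_weight hM₂ (L.pW₂_mem q) (fun s w => L.pX₂_mem s w q)) hc₁
  exact ⟨q, c₁, c₂, hc₂⟩

lemma tendsto_error_bound (K : ℝ) {δ : ℝ} (hδ : 0 < δ) :
    Filter.Tendsto (fun n : ℕ => K / n + 6 * (2 : ℝ) ^ (-(n * δ))) Filter.atTop (nhds 0) := by
  have h1 := tendsto_const_div_atTop_nhds_zero_nat K
  have h2 : Filter.Tendsto (fun n : ℕ => ((2 : ℝ) ^ (-δ)) ^ n) Filter.atTop (nhds 0) :=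
    tendsto_pow_atTop_nhds_zero_of_lt_one (Real.rpow_pos_of_pos two_pos _).le
      (Real.rpow_lt_one_of_one_lt_of_neg (by norm_num) (by linarith))
  have h3 := h1.add (h2.const_mul 6)
  rw [mul_zero, add_zero] at h3
  refine h3.congr fun n => ?_
  rw [← Real.rpow_natCast, ← Real.rpow_mul two_pos.le]
  congr 3
  ring

/-- Any source that satisfies the seven inequalities is admissible. -/
theorem admissible_of_sourceConditions {p : S × T → ℝ}
    (hp : p ∈ stdSimplex ℝ (S × T)) {N : X₁ → X₂ → Y₁ × Y₂ → ℝ}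
    (hN : ∀ x₁ x₂, N x₁ x₂ ∈ stdSimplex ℝ (Y₁ × Y₂)) (L : SourceLaw S T Q W₁ W₂ X₁ X₂)
    (h : SourceConditions p N L) : Admissible p N := by
  classical
  have hST : Nonempty (S × T) := by
    by_contra hne
    rw [not_nonempty_iff] at hne
    simpa using hp.2
  have hS : Nonempty S := hST.map Prod.fst
  have hT : Nonempty T := hST.map Prod.snd
  have hp' : swapSource p ∈ stdSimplex ℝ (T × S) := swap_mem_stdSimplex hp
  have hN' : ∀ x₂ x₁, swapChannel N x₂ x₁ ∈ stdSimplex ℝ (Y₂ × Y₁) := fun x₂ x₁ =>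
    swap_mem_stdSimplex (hN x₁ x₂)
  obtain ⟨ra₁, re₁, rd₁, rg₁, ae₁, dg₁⟩ := L.rate_bounds hp hN
  obtain ⟨ra₂, re₂, rd₂, rg₂, ae₂, dg₂⟩ := L.swap.rate_bounds hp' hN'
  obtain ⟨c1, c2, c3, c4, c5, c6, c7⟩ := h
  have hk : margS (swapSource p) = margT p := rfl
  rw [hk] at ra₂ re₂ rd₂ rg₂
  set a₁ := L.rate p N obsCenters L.kX₁
  set e₁ := L.rate p N obsOwn (fun ω => L.kX₁ ω * L.kW₂ ω)
  set d₁ := L.rate p N obsOther (fun ω => L.kW₁ ω * L.kX₁ ω)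
  set g₁ := L.rate p N obsOut (fun ω => L.kW₁ ω * (L.kX₁ ω * L.kW₂ ω))
  set a₂ := L.swap.rate (swapSource p) (swapChannel N) obsCenters L.swap.kX₁
  set e₂ := L.swap.rate (swapSource p) (swapChannel N) obsOwn
    (fun ω => L.swap.kX₁ ω * L.swap.kW₂ ω)
  set d₂ := L.swap.rate (swapSource p) (swapChannel N) obsOther
    (fun ω => L.swap.kW₁ ω * L.swap.kX₁ ω)
  set g₂ := L.swap.rate (swapSource p) (swapChannel N) obsOut
    (fun ω => L.swap.kW₁ ω * (L.swap.kX₁ ω * L.swap.kW₂ ω))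
  -- The second user's informations were obtained on the sample space with exchanged users. Pulling
  -- them back expresses both sets of exponents through one joint law.
  rw [← condMI_comp_equiv (swapEquiv S T Q W₁ W₂ X₁ X₂ Y₁ Y₂), ← L.joint_swap] at ra₂ re₂ rd₂ rg₂
  set J := L.joint p N
  set HS := entropy (margS p)
  set HT := entropy (margT p)
  let s : S × T × Q × W₁ × W₂ × X₁ × X₂ × Y₁ × Y₂ → S := fun ω => ω.1
  let t : S × T × Q × W₁ × W₂ × X₁ × X₂ × Y₁ × Y₂ → T := fun ω => ω.2.1
  let q : S × T × Q × W₁ × W₂ × X₁ × X₂ × Y₁ × Y₂ → Q := fun ω => ω.2.2.1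
  let w₁ : S × T × Q × W₁ × W₂ × X₁ × X₂ × Y₁ × Y₂ → W₁ := fun ω => ω.2.2.2.1
  let w₂ : S × T × Q × W₁ × W₂ × X₁ × X₂ × Y₁ × Y₂ → W₂ := fun ω => ω.2.2.2.2.1
  let x₁ : S × T × Q × W₁ × W₂ × X₁ × X₂ × Y₁ × Y₂ → X₁ := fun ω => ω.2.2.2.2.2.1
  let x₂ : S × T × Q × W₁ × W₂ × X₁ × X₂ × Y₁ × Y₂ → X₂ := fun ω => ω.2.2.2.2.2.2.1
  let y₁ : S × T × Q × W₁ × W₂ × X₁ × X₂ × Y₁ × Y₂ → Y₁ := fun ω => ω.2.2.2.2.2.2.2.1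
  let y₂ : S × T × Q × W₁ × W₂ × X₁ × X₂ × Y₁ × Y₂ → Y₂ := fun ω => ω.2.2.2.2.2.2.2.2
  change a₁ = condMI J (s &ᵣ x₁) y₁ (q &ᵣ w₁ &ᵣ w₂) - HS at ra₁
  change e₁ = condMI J (s &ᵣ w₂ &ᵣ x₁) y₁ (q &ᵣ w₁) - HS at re₁
  change condMI J (s &ᵣ x₁) y₁ (q &ᵣ w₂) - HS ≤ d₁ at rd₁
  change condMI J (s &ᵣ w₂ &ᵣ x₁) y₁ q - HS ≤ g₁ at rg₁
  change a₂ = condMI J (t &ᵣ x₂) y₂ (q &ᵣ w₂ &ᵣ w₁) - HT at ra₂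
  change e₂ = condMI J (t &ᵣ w₁ &ᵣ x₂) y₂ (q &ᵣ w₂) - HT at re₂
  change condMI J (t &ᵣ x₂) y₂ (q &ᵣ w₁) - HT ≤ d₂ at rd₂
  change condMI J (t &ᵣ w₁ &ᵣ x₂) y₂ q - HT ≤ g₂ at rg₂
  change HS < condMI J (s &ᵣ x₁) y₁ (q &ᵣ w₂) at c1
  change HT < condMI J (t &ᵣ x₂) y₂ (q &ᵣ w₁) at c2
  change HS + HT < condMI J (s &ᵣ x₁) y₁ (q &ᵣ w₁ &ᵣ w₂) + condMI J (w₁ &ᵣ t &ᵣ x₂) y₂ q at c3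
  change HS + HT < condMI J (t &ᵣ x₂) y₂ (q &ᵣ w₁ &ᵣ w₂) + condMI J (w₂ &ᵣ s &ᵣ x₁) y₁ q at c4
  change HS + HT < condMI J (s &ᵣ w₂ &ᵣ x₁) y₁ (q &ᵣ w₁) +
    condMI J (t &ᵣ w₁ &ᵣ x₂) y₂ (q &ᵣ w₂) at c5
  change 2 * HS + HT < condMI J (s &ᵣ x₁) y₁ (q &ᵣ w₁ &ᵣ w₂) + condMI J (s &ᵣ w₂ &ᵣ x₁) y₁ q +
    condMI J (t &ᵣ w₁ &ᵣ x₂) y₂ (q &ᵣ w₂) at c6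
  change HS + 2 * HT < condMI J (t &ᵣ x₂) y₂ (q &ᵣ w₁ &ᵣ w₂) + condMI J (t &ᵣ w₁ &ᵣ x₂) y₂ q +
    condMI J (s &ᵣ w₂ &ᵣ x₁) y₁ (q &ᵣ w₁) at c7
  have m1 : condMI J (w₁ &ᵣ t &ᵣ x₂) y₂ q = condMI J (t &ᵣ w₁ &ᵣ x₂) y₂ q :=
    condMI_congr J (fun ω ω' => by simp only [join, Prod.mk.injEq]; tauto)
      (fun _ _ => Iff.rfl) (fun _ _ => Iff.rfl)
  have m2 : condMI J (w₂ &ᵣ s &ᵣ x₁) y₁ q = condMI J (s &ᵣ w₂ &ᵣ x₁) y₁ q :=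
    condMI_congr J (fun ω ω' => by simp only [join, Prod.mk.injEq]; tauto)
      (fun _ _ => Iff.rfl) (fun _ _ => Iff.rfl)
  have m3 : condMI J (t &ᵣ x₂) y₂ (q &ᵣ w₁ &ᵣ w₂) = condMI J (t &ᵣ x₂) y₂ (q &ᵣ w₂ &ᵣ w₁) :=
    condMI_congr J (fun _ _ => Iff.rfl) (fun _ _ => Iff.rfl)
      (fun ω ω' => by simp only [join, Prod.mk.injEq]; tauto)
  rw [m1] at c3
  rw [m3, m2] at c4
  rw [m3] at c7
  -- Both source rates are set to 0 because the exponents already have H(S) and H(T) subtracted.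
  obtain ⟨x, y, hx, hy, i1, i2, i3, i4, i5, i6⟩ := exists_hash_rates (h := 0) (k := 0) (a₁ := a₁)
    (d₁ := d₁) (e₁ := e₁) (g₁ := g₁) (a₂ := a₂) (d₂ := d₂) (e₂ := e₂) (g₂ := g₂)
    (by linarith) (by linarith) (by linarith) (by linarith) (by linarith) (by linarith)
    (by linarith) ae₁ ae₂ dg₁ dg₂
  -- One δ below half of each of the eight margins, four for each decoder.
  obtain ⟨δ, hδ0, hδ⟩ := exists_between (a₁ := 0) (a₂ := min (min (min ((a₁ + x) / 2)
    ((e₁ + x - y) / 2)) (min (d₁ / 2) ((g₁ - y) / 2))) (min (min ((a₂ + y) / 2)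
    ((e₂ + y - x) / 2)) (min (d₂ / 2) ((g₂ - x) / 2)))) (by
      simp only [lt_min_iff]
      refine ⟨⟨⟨?_, ?_⟩, ?_, ?_⟩, ⟨?_, ?_⟩, ?_, ?_⟩ <;> linarith)
  simp only [lt_min_iff] at hδ
  obtain ⟨⟨⟨j1, j2⟩, j3, j4⟩, ⟨j5, j6⟩, j7, j8⟩ := hδ
  obtain ⟨K₁, hK₁⟩ := L.exists_block_error_le hp hN (x := x) (y := y) hδ0 (by linarith)
    (by linarith) (by linarith) (by linarith)
  -- With the users exchanged, y is the rate of the own hash and x that of the foreign one.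
  obtain ⟨K₂, hK₂⟩ := L.swap.exists_block_error_le hp' hN' (x := y) (y := x) hδ0 (by linarith)
    (by linarith) (by linarith) (by linarith)
  intro ε hε _
  have hlim := (tendsto_error_bound K₁ hδ0).add (tendsto_error_bound K₂ hδ0)
  rw [add_zero] at hlim
  obtain ⟨n₀, hn₀⟩ := Filter.eventually_atTop.1 (hlim.eventually_lt_const hε)
  -- The Chebyshev term K/n is a bound only for n ≥ 1.
  refine ⟨max n₀ 1, fun n hn => ?_⟩
  obtain ⟨A₁, hA₁⟩ := hK₁ n (le_trans (le_max_right _ _) hn)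
  obtain ⟨A₂, hA₂⟩ := hK₂ n (le_trans (le_max_right _ _) hn)
  obtain ⟨M₁, hM₁, hM₁l, hM₁u⟩ := exists_hash_size n hx
  obtain ⟨M₂, hM₂, hM₂l, hM₂u⟩ := exists_hash_size n hy
  have b₁ := hA₁ M₁ M₂ hM₁ hM₂ hM₁l hM₂u
  have b₂ := hA₂ M₂ M₁ hM₂ hM₁ hM₂l hM₁u
  obtain ⟨q, c₁, c₂, hc⟩ := (L.block n).exists_codebooks hM₁ hM₂ b₁
    (E₂ := fun q c₁ c₂ => wordErr (blockSource (swapSource p) n) (blockChannel (swapChannel N) n)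
      c₂.2.2 c₁.2.2 (decode A₂ q c₂ c₁)) b₂
  refine ⟨⟨c₁.2.2, c₂.2.2, decode A₁ q c₁ c₂, decode A₂ q c₂ c₁⟩, ?_⟩
  rw [BlockCode.err₁_eq, BlockCode.err₂_eq]
  have n₁ := wordErr_nonneg (blockSource_mem hp n).1 (fun x₁ x₂ => (blockChannel_mem hN n x₁ x₂).1)
    c₁.2.2 c₂.2.2 (decode A₁ q c₁ c₂)
  have n₂ := wordErr_nonneg (blockSource_mem hp' n).1
    (fun x₁ x₂ => (blockChannel_mem hN' n x₁ x₂).1) c₂.2.2 c₁.2.2 (decode A₂ q c₂ c₁)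
  have hlt := hn₀ n (le_trans (le_max_left _ _) hn)
  exact max_le (by linarith) (by linarith)

end Coding

end InterferenceChannel

theorem corollary1 {X₁ X₂ Y₁ Y₂ : Type*} [Fintype X₁] [Fintype X₂] [Fintype Y₁] [Fintype Y₂]
    (N : X₁ → X₂ → Y₁ × Y₂ → ℝ) (hN : ∀ x₁ x₂, N x₁ x₂ ∈ stdSimplex ℝ (Y₁ × Y₂)) :
    -- the sufficient condition for sources without a common part
    (∀ {S T Q W₁ W₂ : Type*} [Fintype S] [Fintype T] [Fintype Q] [Fintype W₁] [Fintype W₂]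
      (p : S × T → ℝ), p ∈ stdSimplex ℝ (S × T) → NoCommonPart p →
      ∀ L : SourceLaw S T Q W₁ W₂ X₁ X₂, SourceConditions p N L → Admissible p N) ∧
    -- independent sources, inputs that do not look at the sources: the same seven inequalities
    (∀ {S T Q W₁ W₂ : Type*} [Fintype S] [Fintype T] [Fintype Q] [Fintype W₁] [Fintype W₂]
      (pS : S → ℝ) (pT : T → ℝ), pS ∈ stdSimplex ℝ S → pT ∈ stdSimplex ℝ T →
      ∀ L : HKLaw Q W₁ W₂ X₁ X₂,
        SourceConditions (indep pS pT) N (L.toSourceLaw S T) ↔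
          HKConditions N L (entropy pS) (entropy pT)) ∧
    -- the resulting region is the simplified Han–Kobayashi region
    indepSourceRegion N = hkRegion N ∧
    -- and independent sources with entropies in that region are admissible
    (∀ {S T : Type*} [Fintype S] [Fintype T] (pS : S → ℝ) (pT : T → ℝ),
      pS ∈ stdSimplex ℝ S → pT ∈ stdSimplex ℝ T →
      (entropy pS, entropy pT) ∈ hkRegion N → Admissible (indep pS pT) N) := by
  refine ⟨fun p hp _ L h => admissible_of_sourceConditions hp hN L h,
    fun pS pT hS hT L => sourceConditions_indep_iff hN hS hT L,
    indepSourceRegion_eq_hkRegion hN, ?_⟩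
  rintro S T _ _ pS pT hS hT ⟨-, -, a, b, c, L, hL⟩
  refine admissible_of_sourceConditions ⟨fun st => mul_nonneg (hS.1 _) (hT.1 _), ?_⟩ hN _
    ((sourceConditions_indep_iff hN hS hT L).2 hL)
  simp only [Fintype.sum_prod_type, ← Finset.mul_sum, hT.2, hS.2, mul_one]
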